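/- Let $d,d_x,d_y\ge 1$, let $\mathcal X\subseteq\mathbb R^{d_x}$ and $\mathcal Y\subseteq\mathbb R^{d_y}$ be Borel sets, let $\Theta\subseteq\mathbb R^d$ be open, let $\mu$ be a finite measure on $\mathcal X$ and $\nu$ a measure on $\mathcal Y$. For $\theta\in\Theta$ let $p_\theta(x'|x)\ge 0$ and $q_\theta(y|x)\ge 0$ be measurable functions of $(x',x)\in\mathcal X\times\mathcal X$ and $(y,x)\in\mathcal Y\times\mathcal X$ with $\int p_\theta(x'|x)\,\mu(dx')=\int q_\theta(y|x)\,\nu(dy)=1$ for all $x\in\mathcal X$, and put $r_\theta(y,x'|x)=q_\theta(y|x')\,p_\theta(x'|x)$. For $\theta\in\Theta$ and a probability measure $\lambda$ on $\mathcal X$, let $\{(X_n^{\theta,\lambda},Y_n^{\theta,\lambda})\}_{n\ge 0}$ be an $\mathcal X\times\mathcal Y$-valued process on a probability space such that, for all Borel sets $B\subseteq\mathcal X\times\mathcal Y$ and $n\ge 0$, $$P\big((X_0^{\theta,\lambda},Y_0^{\theta,\lambda})\in B\big)=\iint I_B(x,y)\,q_\theta(y|x)\,\nu(dy)\,\lambda(dx),$$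 $$P\big((X_{n+1}^{\theta,\lambda},Y_{n+1}^{\theta,\lambda})\in B\,\big|\,X_{0:n}^{\theta,\lambda},Y_{0:n}^{\theta,\lambda}\big)=\iint I_B(x,y)\,q_\theta(y|x)\,p_\theta(x|X_n^{\theta,\lambda})\,\nu(dy)\,\mu(dx)\quad\text{a.s.}$$ For $n\ge1$ let $$q_\theta^n(y_{1:n}|\lambda)=\int\cdots\int\prod_{k=1}^n r_\theta(y_k,x_k|x_{k-1})\,\mu(dx_n)\cdots\mu(dx_1)\,\lambda(dx_0)$$ be the density of $Y_{1:n}^{\theta,\lambda}$, and let $h_n(\theta,\lambda)=-E\big(\tfrac1n\log q_\theta^n(Y_{1:n}^{\theta,\lambda}|\lambda)\big)$ be its average entropy. For $\delta\in(0,1)$ let $V_\delta(\Theta)=\{\eta\in\mathbb C^d:\exists\,\theta\in\Theta,\ \|\eta-\theta\|<\delta\}$, with $\|\cdot\|$ the Euclidean norm. Assume the following. 1. There are $\varepsilon\in(0,1)$ and, for each $\theta\in\Theta$, $y\in\mathcal Y$, a finite measure $\lambda_\theta(dx|y)$ on $\mathcal X$ with $\varepsilon\lambda_\theta(B|y)\le\int_B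 r_\theta(y,x'|x)\,\mu(dx')\le\lambda_\theta(B|y)/\varepsilon$ for all $x\in\mathcal X$ and Borel $B\subseteq\mathcal X$. 2. $r_\theta(y,x'|x)$ is real-analytic in $\theta\in\Theta$ for all $x,x',y$, and there are $\delta\in(0,1)$, functions $\hat r_\eta(y,x'|x)\in\mathbb C$ and $\varphi_\eta(y)\in\mathbb C$ ($\eta\in\mathbb C^d$, $x,x'\in\mathcal X$, $y\in\mathcal Y$), with $\hat r_\eta$ measurable in $(y,x',x)$ for $\eta\in V_\delta(\Theta)$, and functions $\phi,\psi:\mathcal Y\to(0,\infty)$ with $\int\phi\,d\nu<\infty$, such that $\hat r_\theta=r_\theta$ for $\theta\in\Theta$; $\hat r_\eta(y,x'|x)$ and $\varphi_\eta(y)$ are analytic in $\eta\in V_\delta(\Theta)$; and, for all $\eta\in V_\delta(\Theta)$ and all $x,x',y$: $\varphi_\eta(y)\ne0$, $|\hat r_\eta(y,x'|x)|\le|\varphi_\eta(y)|\le\phi(y)$ and $\big|\log|\varphi_\eta(y)|\big|\le\psi(y)$. 3. There is $\gamma\in(0,1)$ with $\int r_\theta(y,x'|x)\,\mu(dx')\ge\gamma|\varphi_\theta(y)|$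 for all $\theta\in\Theta$, $x\in\mathcal X$, $y\in\mathcal Y$. 4. $\int\psi(y)\phi(y)\,\nu(dy)<\infty$. Then $\log q_\theta^n(Y_{1:n}^{\theta,\lambda}|\lambda)$ is integrable for all $\theta\in\Theta$, all probability measures $\lambda$ on $\mathcal X$ and all $n\ge1$ (so that $h_n(\theta,\lambda)$ is well defined), and there is a function $h:\Theta\to\mathbb R$, real-analytic on $\Theta$, such that $$\lim_{n\to\infty}h_n(\theta,\lambda)=h(\theta)\quad\text{for all }\theta\in\Theta\text{ and all probability measures }\lambda\text{ on }\mathcal X.$$ -/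

import Mathlib

open MeasureTheory ProbabilityTheory Filter Topology

noncomputable section

namespace HMMEntropy

/-- The real parameter vector `θ ∈ ℝ^d` seen as an element of `ℂ^d`. -/
def toComplex {d : ℕ} (θ : EuclideanSpace ℝ (Fin d)) : EuclideanSpace ℂ (Fin d) :=
  WithLp.toLp 2 fun i => (θ i : ℂ)

/-- The open `δ`-vicinity of `Θ ⊆ ℝ^d` in `ℂ^d` for the Euclidean norm. -/
def vicinity {d : ℕ} (δ : ℝ) (Θ : Set (EuclideanSpace ℝ (Fin d))) :
    Set (EuclideanSpace ℂ (Fin d)) :=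
  {η | ∃ θ ∈ Θ, ‖η - toComplex θ‖ < δ}

section Model

variable {d : ℕ} {S T : Type*} [MeasurableSpace S] [MeasurableSpace T]

/-- `p θ x' x` is a transition density on `S` with respect to `μ`, and `q θ y x` is a conditional
density on `T` given the state, with respect to `ν`, for every parameter `θ ∈ Θ`. -/
structure IsDensityFamily (Θ : Set (EuclideanSpace ℝ (Fin d))) (μ : Measure S) (ν : Measure T)
    (p : EuclideanSpace ℝ (Fin d) → S → S → ℝ)
    (q : EuclideanSpace ℝ (Fin d) → T → S → ℝ) : Prop where
  p_nonneg : ∀ θ ∈ Θ, ∀ x' x, 0 ≤ p θ x' x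
  q_nonneg : ∀ θ ∈ Θ, ∀ y x, 0 ≤ q θ y x
  p_measurable : ∀ θ ∈ Θ, Measurable fun z : S × S => p θ z.1 z.2
  q_measurable : ∀ θ ∈ Θ, Measurable fun z : T × S => q θ z.1 z.2
  p_lintegral : ∀ θ ∈ Θ, ∀ x, ∫⁻ x', ENNReal.ofReal (p θ x' x) ∂μ = 1
  q_lintegral : ∀ θ ∈ Θ, ∀ x, ∫⁻ y, ENNReal.ofReal (q θ y x) ∂ν = 1

/-- `r_θ(y, x' | x) = q_θ(y | x') p_θ(x' | x)`. -/
def jointDensity (p : EuclideanSpace ℝ (Fin d) → S → S → ℝ)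
    (q : EuclideanSpace ℝ (Fin d) → T → S → ℝ)
    (θ : EuclideanSpace ℝ (Fin d)) (y : T) (x' x : S) : ℝ :=
  q θ y x' * p θ x' x

/-- The process `(X_n, Y_n)` on `(Ω, P)` is a hidden Markov model with transition density
`p x' x` (with respect to `μ`), observation density `q y x` (with respect to `ν`) and initial
state distribution `lam`. -/
structure IsHMM {Ω : Type*} [MeasurableSpace Ω] (P : Measure Ω) (μ : Measure S) (ν : Measure T)
    (p : S → S → ℝ) (q : T → S → ℝ) (lam : Measure S)
    (X : ℕ → Ω → S) (Y : ℕ → Ω → T) : Prop where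
  measurable_X : ∀ n, Measurable (X n)
  measurable_Y : ∀ n, Measurable (Y n)
  initial : ∀ B : Set (S × T), MeasurableSet B →
    P {ω | (X 0 ω, Y 0 ω) ∈ B} =
      ∫⁻ x, ∫⁻ y, B.indicator (fun z => ENNReal.ofReal (q z.2 z.1)) (x, y) ∂ν ∂lam
  transition : ∀ (n : ℕ) (B : Set (S × T)), MeasurableSet B →
    P⟦{ω | (X (n + 1) ω, Y (n + 1) ω) ∈ B} |
        MeasurableSpace.comap (fun ω (k : Fin (n + 1)) => (X k ω, Y k ω)) inferInstance⟧
      =ᵐ[P] fun ω =>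
        (∫⁻ x, ∫⁻ y,
          B.indicator (fun z => ENNReal.ofReal (q z.2 z.1 * p z.1 (X n ω))) (x, y) ∂ν ∂μ).toReal

/-- The iterated integral
`∫ ⋯ ∫ ∏_{k=1}^n r(y_k, x_k | x_{k-1}) μ(dx_n) ⋯ μ(dx_1)` as a function of `x_0`; each factor is
taken out of the integrals over the later states. The entry `y 0` is `y_1`. -/
def condObsDensity (μ : Measure S) (r : T → S → S → ℝ) : (n : ℕ) → (Fin n → T) → S → ENNReal
  | 0, _, _ => 1
  | n + 1, y, x =>
      ∫⁻ x', ENNReal.ofReal (r (y 0) x' x) * condObsDensity μ r n (fun k => y k.succ) x' ∂μ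

/-- The density `q^n(y_{1:n} | lam)` of `Y_{1:n}` when `X_0` has distribution `lam`. -/
def obsDensity (μ : Measure S) (r : T → S → S → ℝ) (lam : Measure S) (n : ℕ)
    (y : Fin n → T) : ℝ :=
  (∫⁻ x, condObsDensity μ r n y x ∂lam).toReal

/-- The average entropy `-E((1/n) log q^n(Y_{1:n} | lam))` of `Y_{1:n} = (Y_1, …, Y_n)`. -/
def entropy {Ω : Type*} [MeasurableSpace Ω] (P : Measure Ω) (μ : Measure S)
    (r : T → S → S → ℝ) (lam : Measure S) (Y : ℕ → Ω → T) (n : ℕ) : ℝ :=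
  -∫ ω, (1 / (n : ℝ)) * Real.log (obsDensity μ r lam n fun k => Y (k + 1) ω) ∂P

/-- The mixing condition, for `r θ y x' x` with respect to `μ`. -/
def MixingCondition (Θ : Set (EuclideanSpace ℝ (Fin d))) (μ : Measure S)
    (r : EuclideanSpace ℝ (Fin d) → T → S → S → ℝ) : Prop :=
  ∃ ε : ℝ, 0 < ε ∧ ε < 1 ∧ ∀ θ ∈ Θ, ∀ y : T, ∃ lam : Measure S, IsFiniteMeasure lam ∧
    ∀ (x : S) (B : Set S), MeasurableSet B →
      ENNReal.ofReal ε * lam B ≤ ∫⁻ x' in B, ENNReal.ofReal (r θ y x' x) ∂μ ∧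
      ∫⁻ x' in B, ENNReal.ofReal (r θ y x' x) ∂μ ≤ lam B / ENNReal.ofReal ε

/-- `rhat` is an analytic continuation of `r` to the complex `δ`-vicinity of `Θ`, controlled by the
analytic function `varphi` and by the bounding functions `phi`, `psi`. -/
structure IsAnalyticContinuation (Θ : Set (EuclideanSpace ℝ (Fin d))) (ν : Measure T)
    (r : EuclideanSpace ℝ (Fin d) → T → S → S → ℝ) (δ : ℝ)
    (rhat : EuclideanSpace ℂ (Fin d) → T → S → S → ℂ)
    (varphi : EuclideanSpace ℂ (Fin d) → T → ℂ) (phi psi : T → ℝ) : Prop where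
  r_analytic : ∀ y x' x, AnalyticOnNhd ℝ (fun θ => r θ y x' x) Θ
  rhat_eq : ∀ θ ∈ Θ, ∀ y x' x, rhat (toComplex θ) y x' x = (r θ y x' x : ℂ)
  rhat_measurable : ∀ η ∈ vicinity δ Θ,
    Measurable fun z : T × S × S => rhat η z.1 z.2.1 z.2.2
  delta_pos : 0 < δ
  delta_lt_one : δ < 1
  rhat_analytic : ∀ y x' x, AnalyticOnNhd ℂ (fun η => rhat η y x' x) (vicinity δ Θ)
  varphi_analytic : ∀ y, AnalyticOnNhd ℂ (fun η => varphi η y) (vicinity δ Θ)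
  varphi_ne_zero : ∀ η ∈ vicinity δ Θ, ∀ y, varphi η y ≠ 0
  norm_rhat_le : ∀ η ∈ vicinity δ Θ, ∀ y x' x, ‖rhat η y x' x‖ ≤ ‖varphi η y‖
  phi_pos : ∀ y, 0 < phi y
  psi_pos : ∀ y, 0 < psi y
  phi_integrable : Integrable phi ν
  norm_varphi_le : ∀ η ∈ vicinity δ Θ, ∀ y, ‖varphi η y‖ ≤ phi y
  abs_log_varphi_le : ∀ η ∈ vicinity δ Θ, ∀ y, |Real.log ‖varphi η y‖| ≤ psi y

/-- The one-step observation density is bounded below by a multiple of `|varphi|`. -/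
def LowerBoundCondition (Θ : Set (EuclideanSpace ℝ (Fin d))) (μ : Measure S)
    (r : EuclideanSpace ℝ (Fin d) → T → S → S → ℝ)
    (varphi : EuclideanSpace ℂ (Fin d) → T → ℂ) : Prop :=
  ∃ γ : ℝ, 0 < γ ∧ γ < 1 ∧ ∀ θ ∈ Θ, ∀ (x : S) (y : T),
    ENNReal.ofReal (γ * ‖varphi (toComplex θ) y‖) ≤ ∫⁻ x', ENNReal.ofReal (r θ y x' x) ∂μ

end Model

end HMMEntropy

end

/-!
The mean log-likelihood of `n` observations, started from a state `x`, is a sum of mean increments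
`a k x`, `k < n` (`IsMixingKernel.integral_log_obsKernel`). Averages with respect to comparable
weights contract oscillations (`norm_weighted_average_sub_le`), so the mixing condition makes the
predictive densities forget the initial state geometrically, and the transition kernel of the states
contracts as well. Hence `a k x` is, up to an error `O(ρ ^ k)` with `ρ < 1` uniform in the
parameter, independent of `x` and Cauchy in `k` (`IsMixingKernel.abs_meanLogIncrement_sub_le`,
`IsMixingKernel.abs_meanLogIncrement_succ_sub_le`). Its limit is minus the entropy rate: the law of
`Y_1, …, Y_n` is a mixture of the laws started from fixed states (`IsHMM.map_observations`), and
passing to an arbitrary initial distribution costs a bounded error, which disappears after division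
by `n` (`IsHMM.tendsto_entropy`).

For analyticity, the observation density `g` is extended to complex parameters. By the Schwarz lemma
the complex kernel is, near a real parameter and uniformly in the observation, a small perturbation
of a complex multiple of the real kernel. The quotient of the complex by the real density stays in a
cone of functions whose oscillation is small compared with their modulus
(`IsMixingKernel.complexObsKernel_div_mem_cone`); so `g` has no zeros on a complex ball that does
not depend on `n`, with a lower bound for `|g|` of product form. A branch of `log g` is therefore
controlled by the Borel-Carathéodory theorem, and `∫ g log g` is a holomorphic extension of the mean
log-likelihood that grows at most geometrically in `n` (`exists_analytic_mean_log`).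

Nothing better than geometric growth is available for these extensions. Their second differences,
however, decay geometrically at real parameters, and a two-constants estimate on complex lines
(`exists_two_constants`, `exists_geometric_bound_of_real`) turns this into geometric decay on a
smaller complex ball. So the extended increments converge uniformly, and the limit is analytic
(`analyticAt_of_tendsto_of_geometric`, `exists_analytic_limit`). Analyticity in several complex
variables comes from Osgood's lemma (`analyticOnNhd_of_differentiableAt_line`).
-/

noncomputable section

/-! ### Analyticity from separate differentiability: Osgood and the torus Cauchy formula -/

namespace HMMEntropy
open Metric Complex

/-- The Cauchy integral formula on a polydisc, for a continuous function that is holomorphic in each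
variable separately. -/
theorem torusIntegral_prod_sub_inv_mul {d : ℕ} {f : (Fin d → ℂ) → ℂ} {c : Fin d → ℂ} {R : ℝ}
    (hR : 0 < R) (hc : ContinuousOn f (closedBall c R))
    (hd : ∀ z ∈ closedBall c R, ∀ i, DifferentiableAt ℂ (fun t => f (Function.update z i t)) (z i))
    {w : Fin d → ℂ} (hw : w ∈ ball c R) :
    (∯ ζ in T(c, fun _ => R), (∏ i, (ζ i - w i)⁻¹) * f ζ) = (2 * Real.pi * I) ^ d * f w := by
  induction d with
  | zero =>
    rw [torusIntegral_dim0]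
    simp [Subsingleton.elim c w]
  | succ d ih =>
    have hmem : ∀ θ, torusMap c (fun _ => R) θ ∈ closedBall c R := by
      intro θ
      rw [mem_closedBall, dist_pi_le_iff hR.le]
      intro i
      simp [torusMap, abs_of_pos hR]
    have hne : ∀ θ i, torusMap c (fun _ => R) θ i - w i ≠ 0 := by
      intro θ i h0
      have h1 : dist (w i) (c i) < R := (dist_pi_lt_iff hR).1 hw i
      have h2 : w i = torusMap c (fun _ => R) θ i := (sub_eq_zero.1 h0).symm
      rw [h2] at h1
      simp [torusMap, abs_of_pos hR] at h1
    have hcm : Continuous (torusMap c fun _ => R) := by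
      unfold torusMap; fun_prop
    have hint : TorusIntegrable (fun ζ => (∏ i, (ζ i - w i)⁻¹) * f ζ) c (fun _ => R) := by
      refine Continuous.integrableOn_Icc ?_
      refine Continuous.mul ?_ ?_
      · refine continuous_finsetProd _ fun i _ => Continuous.inv₀ ?_ (fun θ => hne θ i)
        fun_prop
      · exact hc.comp_continuous hcm hmem
    rw [torusIntegral_succ hint]
    have hcons : ∀ a b, a ∈ closedBall (c 0) R → b ∈ closedBall (c ∘ Fin.succ) R →
        (Fin.cons a b : Fin (d + 1) → ℂ) ∈ closedBall c R := by
      intro a b ha hb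
      rw [mem_closedBall, dist_pi_le_iff hR.le] at *
      intro i
      refine Fin.cases ?_ (fun j => ?_) i
      · simpa using ha
      · simpa using hb j
    have hw' : (w ∘ Fin.succ) ∈ ball (c ∘ Fin.succ) R := by
      rw [mem_ball, dist_pi_lt_iff hR] at *
      exact fun j => hw j.succ
    have hw0 : w 0 ∈ ball (c 0) R := by
      rw [mem_ball, dist_pi_lt_iff hR] at hw
      exact hw 0
    have key : ∀ x ∈ sphere (c 0) R,
        (∯ y in T(c ∘ Fin.succ, (fun _ => R) ∘ Fin.succ),
          (∏ i, ((Fin.cons x y : Fin (d + 1) → ℂ) i - w i)⁻¹) * f (Fin.cons x y))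
        = (x - w 0)⁻¹ • ((2 * Real.pi * I) ^ d * f (Fin.cons x (w ∘ Fin.succ))) := by
      intro x hx
      have hx' := sphere_subset_closedBall hx
      rw [← ih (f := fun y => f (Fin.cons x y)) (c := c ∘ Fin.succ) ?_ ?_ hw', smul_eq_mul,
        ← torusIntegral_const_mul]
      · simp only [Fin.prod_univ_succ, Fin.cons_zero, Fin.cons_succ, mul_assoc, Function.comp_def]
      · refine hc.comp (Continuous.continuousOn (by fun_prop)) fun y hy => hcons _ _ hx' hy
      · intro z hz i
        have := hd _ (hcons x z hx' hz) i.succ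
        simpa [Fin.cons_update] using this
    rw [circleIntegral.integral_congr hR.le key]
    have hdiff : ∀ x ∈ closedBall (c 0) R, DifferentiableAt ℂ
        (fun x => (2 * Real.pi * I) ^ d * f (Fin.cons x (w ∘ Fin.succ))) x := by
      intro x hx
      have h1 := hd _ (hcons x (w ∘ Fin.succ) hx (ball_subset_closedBall hw')) 0
      simp only [Fin.cons_zero, Fin.update_cons_zero] at h1
      exact h1.const_mul _
    have hdc : DiffContOnCl ℂ (fun x => (2 * Real.pi * I) ^ d * f (Fin.cons x (w ∘ Fin.succ)))
        (ball (c 0) R) := by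
      refine DifferentiableOn.diffContOnCl fun x hx => ?_
      rw [closure_ball _ hR.ne'] at hx
      exact (hdiff x hx).differentiableWithinAt
    rw [hdc.circleIntegral_sub_inv_smul hw0]
    have : (Fin.cons (w 0) (w ∘ Fin.succ) : Fin (d + 1) → ℂ) = w := Fin.cons_self_tail w
    rw [this, smul_eq_mul]; ring

open scoped BoundedContinuousFunction in
/-- A continuous, separately holomorphic function is analytic. The Cauchy kernel is analytic in `w`
as a function with values in the Banach algebra of bounded continuous functions on the torus
parameters, since inversion is analytic there; integration against `f` is a continuous linear
functional on that algebra. -/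
theorem analyticAt_of_separately_differentiable {d : ℕ} {f : (Fin d → ℂ) → ℂ} {c : Fin d → ℂ}
    {R : ℝ} (hR : 0 < R) (hc : ContinuousOn f (closedBall c R))
    (hd : ∀ z ∈ closedBall c R, ∀ i,
      DifferentiableAt ℂ (fun t => f (Function.update z i t)) (z i)) :
    AnalyticAt ℂ f c := by
  have hmem : ∀ θ, torusMap c (fun _ => R) θ ∈ closedBall c R := by
    intro θ
    rw [mem_closedBall, dist_pi_le_iff hR.le]
    intro i
    simp [torusMap, abs_of_pos hR]
  have hcm : Continuous (torusMap c fun _ => R) := by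
    unfold torusMap; fun_prop
  -- the coordinates of the torus, as elements of the Banach algebra
  let u : Fin d → (Fin d → ℝ) →ᵇ ℂ := fun i => BoundedContinuousFunction.ofNormedAddCommGroup
    (fun θ => torusMap c (fun _ => R) θ i) (by fun_prop) (‖c i‖ + R) (by
      intro θ
      refine (norm_add_le _ _).trans ?_
      simp [abs_of_pos hR])
  let h : (Fin d → ℝ) → ℂ := fun θ =>
    (∏ i : Fin d, (R : ℂ) * exp (θ i * I) * I) * f (torusMap c (fun _ => R) θ)
  have hh : Continuous h := by
    refine Continuous.mul (by fun_prop) (hc.comp_continuous hcm hmem)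
  let K : Set (Fin d → ℝ) := Set.Icc 0 fun _ => 2 * Real.pi
  have hhi : IntegrableOn h K := hh.integrableOn_Icc
  have hbi : ∀ g : (Fin d → ℝ) →ᵇ ℂ, IntegrableOn (fun θ => g θ * h θ) K := fun g =>
    (g.continuous.mul hh).integrableOn_Icc
  -- integration against the torus map's Jacobian times `f`
  let Ψ : ((Fin d → ℝ) →ᵇ ℂ) →L[ℂ] ℂ := LinearMap.mkContinuous
    { toFun := fun g => ∫ θ in K, g θ * h θ
      map_add' := fun g g' => by
        rw [← integral_add (hbi g) (hbi g')]
        simp [add_mul]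
      map_smul' := fun a g => by
        rw [RingHom.id_apply, smul_eq_mul, ← integral_const_mul]
        simp [mul_assoc] } (∫ θ in K, ‖h θ‖) (by
      intro g
      refine (norm_integral_le_integral_norm _).trans ?_
      rw [← integral_mul_const]
      refine integral_mono (hbi g).norm (hhi.norm.mul_const _) fun θ => ?_
      simp only [norm_mul]
      rw [mul_comm]
      gcongr
      exact g.norm_coe_le_norm θ)
  have hunit : ∀ w ∈ ball c R, ∀ i, IsUnit (u i - algebraMap ℂ ((Fin d → ℝ) →ᵇ ℂ) (w i)) := by
    intro w hw i
    have h1 : dist (w i) (c i) < R := (dist_pi_lt_iff hR).1 hw i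
    have hlow : ∀ θ, R - dist (w i) (c i) ≤ ‖torusMap c (fun _ => R) θ i - w i‖ := by
      intro θ
      have h2 : ‖torusMap c (fun _ => R) θ i - c i‖ = R := by simp [torusMap, abs_of_pos hR]
      have h3 := norm_sub_le (torusMap c (fun _ => R) θ i - w i) (c i - w i)
      rw [sub_sub_sub_cancel_right, h2] at h3
      rw [dist_comm, dist_eq_norm]
      linarith
    have hne : ∀ θ, torusMap c (fun _ => R) θ i - w i ≠ 0 := fun θ h0 => by
      have := hlow θ; rw [h0, norm_zero] at this; linarith
    let b : (Fin d → ℝ) →ᵇ ℂ := BoundedContinuousFunction.ofNormedAddCommGroup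
      (fun θ => (torusMap c (fun _ => R) θ i - w i)⁻¹)
      (Continuous.inv₀ (by fun_prop) hne) ((R - dist (w i) (c i))⁻¹) (by
        intro θ
        rw [norm_inv]
        exact inv_anti₀ (by linarith) (hlow θ))
    refine IsUnit.of_mul_eq_one b ?_
    ext θ
    exact mul_inv_cancel₀ (hne θ)
  have hAn : AnalyticAt ℂ
      (fun w : Fin d → ℂ => ∏ i, Ring.inverse (u i - algebraMap ℂ ((Fin d → ℝ) →ᵇ ℂ) (w i))) c := by
    have : (fun w : Fin d → ℂ => ∏ i, Ring.inverse (u i - algebraMap ℂ ((Fin d → ℝ) →ᵇ ℂ) (w i)))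
        = ∏ i, fun w : Fin d → ℂ => Ring.inverse (u i - algebraMap ℂ ((Fin d → ℝ) →ᵇ ℂ) (w i)) := by
      ext1 w; simp
    rw [this]
    refine Finset.analyticAt_prod _ fun i _ => ?_
    refine AnalyticAt.comp (g := Ring.inverse)
      (f := fun w : Fin d → ℂ => u i - algebraMap ℂ ((Fin d → ℝ) →ᵇ ℂ) (w i)) ?_ ?_
    · obtain ⟨x, hx⟩ := hunit c (mem_ball_self hR) i
      rw [← hx]; exact analyticAt_inverse x
    · refine analyticAt_const.sub ?_
      simp only [Algebra.algebraMap_eq_smul_one]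
      exact ((ContinuousLinearMap.proj (R := ℂ) (φ := fun _ : Fin d => ℂ) i).analyticAt c).smul
        analyticAt_const
  have hfin := (analyticAt_const (v := ((2 * Real.pi * I) ^ d)⁻¹)).mul ((Ψ.analyticAt _).comp hAn)
  refine hfin.congr ?_
  filter_upwards [ball_mem_nhds c hR] with w hw
  have h0 := torusIntegral_prod_sub_inv_mul hR hc hd hw
  rw [← mul_right_inj' (a := ((2 * Real.pi * I : ℂ) ^ d)) (by simp [Real.pi_ne_zero]), ← h0]
  change _ * (_ * Ψ _) = _
  rw [← mul_assoc, mul_inv_cancel₀ (by simp [Real.pi_ne_zero]), one_mul, torusIntegral]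
  change ∫ θ in K, (∏ i, Ring.inverse (u i - algebraMap ℂ ((Fin d → ℝ) →ᵇ ℂ) (w i)) :
    (Fin d → ℝ) →ᵇ ℂ) θ * h θ = _
  congr 1
  ext θ
  have hev : (∏ i, Ring.inverse (u i - algebraMap ℂ ((Fin d → ℝ) →ᵇ ℂ) (w i)) :
      (Fin d → ℝ) →ᵇ ℂ) θ = ∏ i, (torusMap c (fun _ => R) θ i - w i)⁻¹ := by
    rw [BoundedContinuousFunction.prod_apply]
    refine Finset.prod_congr rfl fun i _ => ?_
    have := congrArg (fun g : (Fin d → ℝ) →ᵇ ℂ => g θ) (Ring.inverse_mul_cancel _ (hunit w hw i))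
    refine eq_inv_of_mul_eq_one_left ?_
    exact this
  rw [hev, smul_eq_mul]
  simp only [h]
  ring

/-- Osgood's lemma: a continuous function that is complex differentiable along every complex line is
analytic. -/
theorem analyticOnNhd_of_differentiableAt_line {d : ℕ} {f : EuclideanSpace ℂ (Fin d) → ℂ}
    {U : Set (EuclideanSpace ℂ (Fin d))} (hU : IsOpen U) (hc : ContinuousOn f U)
    (hd : ∀ x ∈ U, ∀ v, DifferentiableAt ℂ (fun t : ℂ => f (x + t • v)) 0) :
    AnalyticOnNhd ℂ f U := by
  intro x hx
  let e := EuclideanSpace.equiv (Fin d) ℂ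
  have hopen : IsOpen (e.symm ⁻¹' U) := hU.preimage e.symm.continuous
  obtain ⟨R, hR, hsub⟩ := nhds_basis_closedBall.mem_iff.1
    (hopen.mem_nhds (show e x ∈ e.symm ⁻¹' U by simpa using hx))
  have h1 : AnalyticAt ℂ (fun y => f (e.symm y)) (e x) := by
    refine analyticAt_of_separately_differentiable hR
      (hc.comp e.symm.continuous.continuousOn fun y hy => hsub hy) fun z hz i => ?_
    have h2 := hd (e.symm z) (hsub hz) (e.symm (Pi.single i 1))
    have h3 : (fun t => f (e.symm (Function.update z i t)))
        = (fun t : ℂ => f (e.symm z + t • e.symm (Pi.single i 1))) ∘ fun t => t - z i := by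
      ext t
      simp only [Function.comp, ← map_smul, ← map_add]
      congr 2
      ext j
      by_cases hj : j = i
      · subst hj; simp
      · simp [hj]
    rw [h3]
    refine DifferentiableAt.comp _ (by simpa using h2) (by fun_prop)
  have h4 := h1.comp ((e : EuclideanSpace ℂ (Fin d) →L[ℂ] (Fin d → ℂ)).analyticAt x)
  simpa [Function.comp_def] using h4
end HMMEntropy

/-! ### Analyticity of integrals and uniform limits, and a two-constants estimate -/

namespace HMMEntropy
open Metric Complex

theorem analyticOnNhd_integral {d : ℕ} {α : Type*} [MeasurableSpace α] {m : Measure α}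
    {f : EuclideanSpace ℂ (Fin d) → α → ℂ} {U : Set (EuclideanSpace ℂ (Fin d))} (hU : IsOpen U)
    {bound : α → ℝ} (hint : Integrable bound m)
    (hmeas : ∀ η ∈ U, AEStronglyMeasurable (f η) m)
    (hbd : ∀ η ∈ U, ∀ a, ‖f η a‖ ≤ bound a)
    (han : ∀ a, AnalyticOnNhd ℂ (fun η => f η a) U) :
    AnalyticOnNhd ℂ (fun η => ∫ a, f η a ∂m) U := by
  refine analyticOnNhd_of_differentiableAt_line hU ?_ fun x hx v => ?_
  · refine continuousOn_of_dominated (bound := bound) hmeas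
      (fun η hη => Eventually.of_forall (hbd η hη)) hint
      (Eventually.of_forall fun a => (han a).continuousOn)
  · have hcont : Continuous fun t : ℂ => x + t • v := by fun_prop
    obtain ⟨ε, hε, hsub⟩ := Metric.isOpen_iff.1 (hU.preimage hcont) 0 (by simpa using hx)
    have hda : ∀ a, ∀ t ∈ ball (0 : ℂ) ε, DifferentiableAt ℂ (fun t : ℂ => f (x + t • v) a) t := by
      intro a t ht
      have h1 : DifferentiableAt ℂ (fun η => f η a) (x + t • v) :=
        (han a _ (hsub ht)).differentiableAt
      exact DifferentiableAt.comp (f := fun t : ℂ => x + t • v) t h1 (by fun_prop)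
    have hder : ∀ a, ∀ t ∈ ball (0 : ℂ) (ε / 2),
        ‖deriv (fun t : ℂ => f (x + t • v) a) t‖ ≤ bound a / (ε / 4) := by
      intro a t ht
      have hcl : closedBall t (ε / 4) ⊆ ball 0 ε := by
        intro s hs
        rw [mem_ball] at ht ⊢
        rw [mem_closedBall] at hs
        linarith [dist_triangle s t 0]
      refine norm_deriv_le_of_forall_mem_sphere_norm_le (by positivity)
        (DifferentiableOn.diffContOnCl fun s hs => ?_) fun s hs => ?_
      · rw [closure_ball _ (by positivity)] at hs
        exact (hda a s (hcl hs)).differentiableWithinAt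
      · exact hbd _ (hsub (hcl (sphere_subset_closedBall hs))) a
    refine (hasDerivAt_integral_of_dominated_loc_of_deriv_le
      (F := fun (t : ℂ) a => f (x + t • v) a)
      (F' := fun t a => deriv (fun t : ℂ => f (x + t • v) a) t)
      (bound := fun a => bound a / (ε / 4)) (ball_mem_nhds (0 : ℂ) (half_pos hε)) ?_ ?_ ?_ ?_ ?_
      ?_).2.differentiableAt
    · filter_upwards [ball_mem_nhds (0 : ℂ) hε] with t ht using hmeas _ (hsub ht)
    · have h0 : x + (0 : ℂ) • v ∈ U := by simpa using hx
      exact Integrable.mono' hint (hmeas _ h0) (Eventually.of_forall (hbd _ h0))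
    · -- the derivative at `0` is the limit of the difference quotients along `ε / (n + 2)`
      let s : ℕ → ℂ := fun n => ((ε / (n + 2) : ℝ) : ℂ)
      have hs0 : ∀ n, s n ≠ 0 := fun n => by
        simp only [s, ne_eq, ofReal_eq_zero]; positivity
      have hsb : ∀ n, s n ∈ ball (0 : ℂ) ε := fun n => by
        simp only [s, mem_ball_zero_iff, norm_real, Real.norm_eq_abs]
        rw [abs_of_pos (by positivity)]
        exact div_lt_self hε (by have : (0 : ℝ) ≤ n := n.cast_nonneg; linarith)
      have hst : Tendsto s atTop (𝓝[≠] 0) := by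
        refine tendsto_nhdsWithin_iff.2 ⟨?_, Eventually.of_forall hs0⟩
        have : Tendsto (fun n : ℕ => ε / ((n : ℝ) + 2)) atTop (𝓝 0) :=
          tendsto_const_nhds.div_atTop
            (tendsto_atTop_add_const_right _ _ tendsto_natCast_atTop_atTop)
        simpa only [ofReal_zero, Function.comp_def] using (continuous_ofReal.tendsto 0).comp this
      refine aestronglyMeasurable_of_tendsto_ae atTop
        (f := fun n a => (s n)⁻¹ • (f (x + s n • v) a - f (x + (0 : ℂ) • v) a)) (fun n => ?_) ?_
      · have h0 : x + (0 : ℂ) • v ∈ U := by simpa using hx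
        exact ((hmeas _ (hsub (hsb n))).sub (hmeas _ h0)).const_smul (s n)⁻¹
      · refine Eventually.of_forall fun a => ?_
        have := (hda a 0 (mem_ball_self hε)).hasDerivAt.tendsto_slope_zero.comp hst
        simpa [Function.comp_def] using this
    · exact Eventually.of_forall fun a t ht => hder a t ht
    · exact hint.div_const _
    · exact Eventually.of_forall fun a t ht => (hda a t
        (ball_subset_ball (by linarith) ht)).hasDerivAt

theorem analyticOnNhd_of_tendstoUniformlyOn {d : ℕ} {F : ℕ → EuclideanSpace ℂ (Fin d) → ℂ}
    {f : EuclideanSpace ℂ (Fin d) → ℂ} {U : Set (EuclideanSpace ℂ (Fin d))} (hU : IsOpen U)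
    (hF : ∀ n, AnalyticOnNhd ℂ (F n) U) (hlim : TendstoUniformlyOn F f atTop U) :
    AnalyticOnNhd ℂ f U := by
  refine analyticOnNhd_of_differentiableAt_line hU ?_ fun x hx v => ?_
  · exact hlim.continuousOn (Frequently.of_forall fun n => (hF n).continuousOn)
  · have hcont : Continuous fun t : ℂ => x + t • v := by fun_prop
    have hopen := hU.preimage hcont
    have h1 : TendstoLocallyUniformlyOn (fun n (t : ℂ) => F n (x + t • v))
        (fun t => f (x + t • v)) atTop ((fun t : ℂ => x + t • v) ⁻¹' U) :=
      (hlim.comp fun t : ℂ => x + t • v).tendstoLocallyUniformlyOn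
    have h2 := h1.differentiableOn (Eventually.of_forall fun n t ht => by
      have h3 : DifferentiableAt ℂ (F n) (x + t • v) := (hF n _ ht).differentiableAt
      exact (DifferentiableAt.comp (f := fun t : ℂ => x + t • v) t h3
        (by fun_prop)).differentiableWithinAt) hopen
    exact h2.differentiableAt (hopen.mem_nhds (by simpa using hx))

/-- A two-constants estimate: a holomorphic function on the closed unit disc that is at most `C * B
^ n` everywhere and at most `C * ρ ^ n` on the real diameter, with `ρ < 1`, is at most `C * ρ' ^ n`
at the point `t * I`, where `t` and `ρ' < 1` depend on `B` and `ρ` only. This is the three lines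
theorem, transported to the half disc. -/
theorem exists_two_constants {B ρ : ℝ} (hB : 0 < B) (hρ : 0 < ρ) (hρ1 : ρ < 1) :
    ∃ t : ℝ, 0 < t ∧ t ≤ 1 ∧ ∃ ρ' : ℝ, 0 < ρ' ∧ ρ' < 1 ∧ ∀ (C : ℝ) (n : ℕ) (f : ℂ → ℂ), 0 < C →
      (∀ z ∈ closedBall (0 : ℂ) 1, DifferentiableAt ℂ f z) →
      (∀ z ∈ closedBall (0 : ℂ) 1, ‖f z‖ ≤ C * B ^ n) →
      (∀ x : ℝ, |x| ≤ 1 → ‖f x‖ ≤ C * ρ ^ n) → ‖f (t * I)‖ ≤ C * ρ' ^ n := by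
  obtain ⟨u, hu0, hu1, hu⟩ : ∃ u : ℝ, 0 < u ∧ u < 1 ∧ ρ ^ (1 - u) * B ^ u < 1 := by
    have h1 : ContinuousAt (fun u : ℝ => ρ ^ (1 - u) * B ^ u) 0 := by
      refine ContinuousAt.mul ?_ ?_
      · exact ContinuousAt.rpow (by fun_prop) (by fun_prop) (Or.inl hρ.ne')
      · exact ContinuousAt.rpow (by fun_prop) (by fun_prop) (Or.inl hB.ne')
    have h2 : ∀ᶠ u in 𝓝[>] (0 : ℝ), ρ ^ (1 - u) * B ^ u < 1 :=
      (h1.tendsto.mono_left nhdsWithin_le_nhds).eventually_lt_const (by simpa using hρ1)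
    have h3 : ∀ᶠ u in 𝓝[>] (0 : ℝ), u ∈ Set.Ioo (0 : ℝ) 1 := Ioo_mem_nhdsGT one_pos
    obtain ⟨u, h, h'⟩ := (h2.and h3).exists
    exact ⟨u, h'.1, h'.2, h⟩
  set α : ℝ := Real.pi / 2 * u with hα
  have hα0 : 0 < α := by positivity
  have hα1 : α < Real.pi / 2 := by nlinarith [Real.pi_pos]
  have hs : 0 < Real.sin α := Real.sin_pos_of_pos_of_lt_pi hα0 (by linarith [Real.pi_pos])
  have hcs : 0 < Real.cos α := Real.cos_pos_of_mem_Ioo ⟨by linarith, hα1⟩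
  have hsc := Real.sin_sq_add_cos_sq α
  -- `Φ` maps the closed strip `0 ≤ re ≤ 1` into the closed unit disc, and the line `re = 0` into
  -- the real axis.
  let Z : ℂ → ℂ := fun w => exp ((Real.pi / 2 : ℝ) * w * I)
  let Φ : ℂ → ℂ := fun w => (Z w - 1) / (Z w + 1)
  have hre : ∀ w : ℂ, w ∈ HadamardThreeLines.verticalClosedStrip 0 1 → 0 ≤ (Z w).re := by
    intro w hw
    have hw' : w.re ∈ Set.Icc (0 : ℝ) 1 := hw
    simp only [Z, exp_re]
    refine mul_nonneg (Real.exp_pos _).le (Real.cos_nonneg_of_mem_Icc ?_)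
    have : ((Real.pi / 2 : ℝ) * w * I).im = Real.pi / 2 * w.re := by simp
    rw [this]
    constructor <;> nlinarith [Real.pi_pos, hw'.1, hw'.2]
  have hne : ∀ w : ℂ, w ∈ HadamardThreeLines.verticalClosedStrip 0 1 → Z w + 1 ≠ 0 := by
    intro w hw h0
    have := hre w hw
    have h1 := congrArg re h0
    simp only [add_re, one_re, zero_re] at h1
    linarith
  have hΦ : ∀ w : ℂ, w ∈ HadamardThreeLines.verticalClosedStrip 0 1 →
      Φ w ∈ closedBall (0 : ℂ) 1 := by
    intro w hw
    rw [mem_closedBall_zero_iff, norm_div, div_le_one (norm_pos_iff.2 (hne w hw))]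
    rw [← sq_le_sq₀ (norm_nonneg _) (norm_nonneg _), ← normSq_eq_norm_sq, ← normSq_eq_norm_sq,
      normSq_apply, normSq_apply]
    simp only [sub_re, add_re, sub_im, add_im, one_re, one_im]
    nlinarith [hre w hw]
  have hΦ0 : ∀ w : ℂ, w.re = 0 → ∃ x : ℝ, |x| ≤ 1 ∧ Φ w = x := by
    intro w hw
    have hZ : Z w = (Real.exp (-(Real.pi / 2) * w.im) : ℝ) := by
      simp only [Z, ofReal_exp]
      congr 1
      apply Complex.ext <;> simp [hw]
    have hx := Real.exp_pos (-(Real.pi / 2) * w.im)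
    refine ⟨(Real.exp (-(Real.pi / 2) * w.im) - 1) / (Real.exp (-(Real.pi / 2) * w.im) + 1), ?_, ?_⟩
    · rw [abs_div, abs_of_pos (by linarith : 0 < Real.exp (-(Real.pi / 2) * w.im) + 1),
        div_le_one (by linarith), abs_le]
      constructor <;> linarith
    · simp only [Φ, hZ]; push_cast; rfl
  have hu' : ((u : ℝ) : ℂ) ∈ HadamardThreeLines.verticalClosedStrip 0 1 := by
    change (u : ℂ).re ∈ Set.Icc (0 : ℝ) 1
    simp [hu0.le, hu1.le]
  have hΦu : Φ u = ((Real.sin α / (1 + Real.cos α) : ℝ) : ℂ) * I := by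
    have hZ : Z u = Real.cos α + Real.sin α * I := by
      simp only [Z]
      rw [← ofReal_mul, ← hα, exp_mul_I, ofReal_cos, ofReal_sin]
    have h1 : (Real.sin α / (1 + Real.cos α)) * (1 + Real.cos α) = Real.sin α := by
      field_simp
    have h2 : (Real.sin α / (1 + Real.cos α)) * Real.sin α = 1 - Real.cos α := by
      field_simp; nlinarith
    rw [div_eq_iff (hne _ hu'), hZ]
    generalize Real.sin α / (1 + Real.cos α) = t at h1 h2
    apply Complex.ext
    · simp [-ofReal_cos, -ofReal_sin]; linarith
    · simp [-ofReal_cos, -ofReal_sin]; linarith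
  refine ⟨Real.sin α / (1 + Real.cos α), by positivity, ?_, ρ ^ (1 - u) * B ^ u, by positivity, hu,
    fun C n f hC hd hb hr => ?_⟩
  · rw [div_le_one (by positivity)]
    linarith [Real.sin_le_one α]
  · have hcl : closure (HadamardThreeLines.verticalStrip 0 1)
        = HadamardThreeLines.verticalClosedStrip 0 1 := by
      rw [HadamardThreeLines.verticalClosedStrip, HadamardThreeLines.verticalStrip,
        ← closure_Ioo zero_ne_one, ← closure_preimage_re]
    have h3 := HadamardThreeLines.norm_le_interp_of_mem_verticalClosedStrip₀₁' (fun w => f (Φ w))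
      (z := u) (a := C * ρ ^ n) (b := C * B ^ n) hu' ?_ ?_ ?_ ?_
    · rw [← hΦu]
      refine h3.trans (le_of_eq ?_)
      rw [ofReal_re, Real.mul_rpow hC.le (by positivity), Real.mul_rpow hC.le (by positivity),
        mul_mul_mul_comm, ← Real.rpow_add hC, mul_pow]
      simp only [sub_add_cancel, Real.rpow_one, ← Real.rpow_natCast, ← Real.rpow_mul hρ.le,
        ← Real.rpow_mul hB.le]
      rw [mul_comm (n : ℝ), mul_comm (n : ℝ)]
    · refine DifferentiableOn.diffContOnCl fun w hw => ?_
      rw [hcl] at hw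
      refine DifferentiableAt.differentiableWithinAt ?_
      have hΦd : DifferentiableAt ℂ Φ w := by
        have hZd : DifferentiableAt ℂ Z w := by simp only [Z]; fun_prop
        exact (hZd.sub_const 1).div (hZd.add_const 1) (hne w hw)
      exact (hd _ (hΦ w hw)).comp w hΦd
    · refine ⟨C * B ^ n, ?_⟩
      rintro _ ⟨w, hw, rfl⟩
      exact hb _ (hΦ w hw)
    · intro w hw
      obtain ⟨x, hx, hxe⟩ := hΦ0 w hw
      change ‖f (Φ w)‖ ≤ _
      rw [hxe]
      exact hr x hx
    · intro w hw
      have hw1 : w.re = 1 := hw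
      refine hb _ (hΦ w ?_)
      change w.re ∈ Set.Icc (0 : ℝ) 1
      rw [hw1]; exact ⟨zero_le_one, le_rfl⟩
end HMMEntropy

/-! ### Real parameters inside complex space, and branches of the logarithm -/

namespace HMMEntropy
open Metric Complex

/-- `toComplex` as a continuous `ℝ`-linear map. -/
def toComplexL (d : ℕ) : EuclideanSpace ℝ (Fin d) →L[ℝ] EuclideanSpace ℂ (Fin d) :=
  LinearMap.toContinuousLinearMap
    { toFun := toComplex
      map_add' := fun x y => by ext i; simp [toComplex]
      map_smul' := fun a x => by ext i; simp [toComplex] }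

theorem toComplex_sub {d : ℕ} (a b : EuclideanSpace ℝ (Fin d)) :
    toComplex (a - b) = toComplex a - toComplex b := (toComplexL d).map_sub a b

theorem toComplex_add {d : ℕ} (a b : EuclideanSpace ℝ (Fin d)) :
    toComplex (a + b) = toComplex a + toComplex b := (toComplexL d).map_add a b

theorem toComplex_smul {d : ℕ} (t : ℝ) (b : EuclideanSpace ℝ (Fin d)) :
    toComplex (t • b) = (t : ℂ) • toComplex b := (toComplexL d).map_smul t b

theorem norm_toComplex {d : ℕ} (θ : EuclideanSpace ℝ (Fin d)) : ‖toComplex θ‖ = ‖θ‖ := by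
  simp [EuclideanSpace.norm_eq, toComplex]

theorem toComplex_mem_ball {d : ℕ} {θ θ₀ : EuclideanSpace ℝ (Fin d)} {r : ℝ} :
    toComplex θ ∈ ball (toComplex θ₀) r ↔ θ ∈ ball θ₀ r := by
  rw [mem_ball_iff_norm, mem_ball_iff_norm, ← toComplex_sub, norm_toComplex]

/-- The decomposition into real and imaginary parts, with norm bounds. -/
theorem exists_eq_toComplex_add_I_smul {d : ℕ} (η : EuclideanSpace ℂ (Fin d))
    (θ₀ : EuclideanSpace ℝ (Fin d)) : ∃ a b : EuclideanSpace ℝ (Fin d),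
      η = toComplex a + I • toComplex b ∧ ‖a - θ₀‖ ≤ ‖η - toComplex θ₀‖ ∧
        ‖b‖ ≤ ‖η - toComplex θ₀‖ := by
  refine ⟨WithLp.toLp 2 fun i => (η i).re, WithLp.toLp 2 fun i => (η i).im, ?_, ?_, ?_⟩
  · ext i
    simp [toComplex, mul_comm I, re_add_im]
  · simp only [EuclideanSpace.norm_eq]
    gcongr with i
    have := abs_re_le_norm (η i - θ₀ i)
    simpa [toComplex] using this
  · simp only [EuclideanSpace.norm_eq]
    gcongr with i
    have := abs_im_le_norm (η i - θ₀ i)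
    simpa [toComplex] using this

/-- If holomorphic functions on a complex ball grow at most geometrically and decay geometrically at
the real points, then they decay geometrically on a smaller complex ball. The radius and the rate do
not depend on the centre nor on the functions. -/
theorem exists_geometric_bound_of_real (d : ℕ) {B ρ r : ℝ} (hB : 0 < B) (hρ : 0 < ρ) (hρ1 : ρ < 1)
    (hr : 0 < r) : ∃ r' : ℝ, 0 < r' ∧ r' ≤ r ∧ ∃ ρ' : ℝ, 0 < ρ' ∧ ρ' < 1 ∧
      ∀ (θ₀ : EuclideanSpace ℝ (Fin d)) (C : ℝ) (n : ℕ) (F : EuclideanSpace ℂ (Fin d) → ℂ), 0 < C →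
        AnalyticOnNhd ℂ F (ball (toComplex θ₀) r) →
        (∀ η ∈ ball (toComplex θ₀) r, ‖F η‖ ≤ C * B ^ n) →
        (∀ θ ∈ ball θ₀ r, ‖F (toComplex θ)‖ ≤ C * ρ ^ n) →
        ∀ η ∈ ball (toComplex θ₀) r', ‖F η‖ ≤ C * ρ' ^ n := by
  obtain ⟨t, ht0, ht1, ρ', hρ0', hρ1', h⟩ := exists_two_constants hB hρ hρ1
  refine ⟨r * t / 2, by positivity, by nlinarith, ρ', hρ0', hρ1',
    fun θ₀ C n F hC hF hb hreal η hη => ?_⟩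
  obtain ⟨a, b, hab, ha, hb'⟩ := exists_eq_toComplex_add_I_smul η θ₀
  rw [mem_ball_iff_norm] at hη
  -- the complex line through `η` whose real points are real parameters
  have hbt : ‖b‖ / t < r / 2 := by
    rw [div_lt_iff₀ ht0]; linarith
  have har : ‖a - θ₀‖ < r / 2 := by nlinarith
  have hmem : ∀ z ∈ closedBall (0 : ℂ) 1,
      toComplex a + (z / t) • toComplex b ∈ ball (toComplex θ₀) r := by
    intro z hz
    rw [mem_closedBall_zero_iff] at hz
    rw [mem_ball_iff_norm, add_sub_right_comm, ← toComplex_sub]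
    refine (norm_add_le _ _).trans_lt ?_
    rw [norm_toComplex, norm_smul, norm_toComplex, norm_div, norm_real, Real.norm_eq_abs,
      abs_of_pos ht0, div_mul_eq_mul_div]
    have : ‖z‖ * ‖b‖ / t ≤ ‖b‖ / t := by
      gcongr
      exact mul_le_of_le_one_left (norm_nonneg _) hz
    linarith
  have h1 := h C n (fun z => F (toComplex a + (z / t) • toComplex b)) hC ?_ ?_ ?_
  · have : ((t : ℂ) * I) / t = I := by
      rw [mul_comm, mul_div_assoc, div_self (by exact_mod_cast ht0.ne'), mul_one]
    rw [this] at h1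
    rwa [hab]
  · intro z hz
    have h2 : DifferentiableAt ℂ F (toComplex a + (z / t) • toComplex b) :=
      (hF _ (hmem z hz)).differentiableAt
    exact DifferentiableAt.comp (f := fun z : ℂ => toComplex a + (z / t) • toComplex b) z h2
      (by fun_prop)
  · exact fun z hz => hb _ (hmem z hz)
  · intro x hx
    have h3 := hmem (x : ℂ) (by simpa using hx)
    have h4 : toComplex a + ((x : ℂ) / t) • toComplex b = toComplex (a + (x / t) • b) := by
      rw [toComplex_add, toComplex_smul]; push_cast; rfl
    rw [h4] at h3 ⊢
    exact hreal _ (toComplex_mem_ball.1 h3)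

/-- `log (g c)` plus the sum of the principal logarithms of the successive quotients of `g` along a
subdivision of the segment from `c` to `η` into `N` pieces. For large `N` this is the value at `η`
of the branch of `log g` that extends the principal value at `c`. -/
def segmentLog {E : Type*} [AddCommGroup E] [Module ℝ E] (g : E → ℂ) (c η : E) (N : ℕ) : ℂ :=
  log (g c) + ∑ j ∈ Finset.range N,
    log (g (c + (((j + 1 : ℕ) : ℝ) / N) • (η - c)) / g (c + ((j : ℝ) / N) • (η - c)))

theorem segment_mem_ball {E : Type*} [NormedAddCommGroup E] [NormedSpace ℝ E] {c η : E} {r : ℝ}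
    (hη : η ∈ ball c r) {s : ℝ} (hs0 : 0 ≤ s) (hs1 : s ≤ 1) : c + s • (η - c) ∈ ball c r := by
  rw [mem_ball_iff_norm] at *
  rw [add_sub_cancel_left, norm_smul, Real.norm_eq_abs, abs_of_nonneg hs0]
  exact (mul_le_of_le_one_left (norm_nonneg _) hs1).trans_lt hη

/-- A zero-free analytic function on a ball has an analytic logarithm there, and the latter is a
limit of sums of principal logarithms. The second part gives measurable dependence on parameters. -/
theorem exists_log_branch {d : ℕ} {g : EuclideanSpace ℂ (Fin d) → ℂ}
    {c : EuclideanSpace ℂ (Fin d)} {r : ℝ} (hr : 0 < r) (hg : AnalyticOnNhd ℂ g (ball c r))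
    (hg0 : ∀ η ∈ ball c r, g η ≠ 0) : ∃ Λ : EuclideanSpace ℂ (Fin d) → ℂ,
      AnalyticOnNhd ℂ Λ (ball c r) ∧ (∀ η ∈ ball c r, exp (Λ η) = g η) ∧ Λ c = log (g c) ∧
        ∀ η ∈ ball c r, Tendsto (segmentLog g c η) atTop (𝓝 (Λ η)) := by
  have hcm := mem_ball_self hr (x := c)
  have hsc : IsSimplyConnected (ball c r) := by
    have := (convex_ball c r).contractibleSpace ⟨c, hcm⟩
    exact SimplyConnectedSpace.ofContractible _
  obtain ⟨L, hLc, hLe⟩ := exists_continuousOn_eqOn_exp_comp hsc isOpen_ball hg.continuousOn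
    (by rintro ⟨η, hη, h0⟩; exact hg0 η hη h0)
  let Λ : EuclideanSpace ℂ (Fin d) → ℂ := fun η => L η - L c + log (g c)
  have hΛc : ContinuousOn Λ (ball c r) := (hLc.sub continuousOn_const).add continuousOn_const
  have hΛe : ∀ η ∈ ball c r, exp (Λ η) = g η := by
    intro η hη
    have h1 : exp (L η) = g η := hLe hη
    have h2 : exp (L c) = g c := hLe hcm
    rw [exp_add, exp_sub, h1, h2, exp_log (hg0 c hcm), div_mul_cancel₀ _ (hg0 c hcm)]
  -- close points have close values of `Λ`, where the principal logarithm inverts `exp`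
  have hlog : ∀ x ∈ ball c r, ∀ y ∈ ball c r, ‖Λ x - Λ y‖ < 1 → log (g x / g y) = Λ x - Λ y := by
    intro x hx y hy hxy
    rw [← hΛe x hx, ← hΛe y hy, ← exp_sub]
    have := (abs_im_le_norm (Λ x - Λ y)).trans_lt hxy
    rw [abs_lt] at this
    exact log_exp (by linarith [Real.pi_gt_three]) (by linarith [Real.pi_gt_three])
  refine ⟨Λ, ?_, hΛe, by simp [Λ], ?_⟩
  · intro x hx
    have h1 : ∀ᶠ y in 𝓝 x, Λ x + log (g y / g x) = Λ y := by
      have h2 : ContinuousAt Λ x := hΛc.continuousAt (isOpen_ball.mem_nhds hx)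
      have h3 : ∀ᶠ y in 𝓝 x, ‖Λ y - Λ x‖ < 1 := by
        simpa [dist_eq_norm] using h2.eventually (ball_mem_nhds (Λ x) one_pos)
      filter_upwards [h3, isOpen_ball.mem_nhds hx] with y hy hyb
      rw [hlog y hyb x hx hy]; ring
    refine AnalyticAt.congr ?_ h1
    refine analyticAt_const.add (AnalyticAt.clog ((hg x hx).div_const) ?_)
    rw [div_self (hg0 x hx)]; exact one_mem_slitPlane
  · intro η hη
    have hseg : ContinuousOn (fun s : ℝ => Λ (c + s • (η - c))) (Set.Icc 0 1) :=
      hΛc.comp (by fun_prop) fun s hs => segment_mem_ball hη hs.1 hs.2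
    have huc := isCompact_Icc.uniformContinuousOn_of_continuous hseg
    rw [Metric.uniformContinuousOn_iff] at huc
    obtain ⟨ε, hε, huc⟩ := huc 1 one_pos
    refine tendsto_const_nhds.congr' ?_
    obtain ⟨N₀, hN₀⟩ := exists_nat_gt (1 / ε)
    filter_upwards [eventually_ge_atTop (N₀ + 1)] with N hN
    have hN0 : (0 : ℝ) < N := by exact_mod_cast (by omega : 0 < N)
    have hNε : 1 / (N : ℝ) < ε := by
      rw [div_lt_iff₀ hε] at hN₀
      rw [div_lt_iff₀ hN0]
      have : (N₀ : ℝ) ≤ N := by exact_mod_cast (by omega : N₀ ≤ N)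
      nlinarith
    have hsum : ∀ j ∈ Finset.range N,
        log (g (c + (((j + 1 : ℕ) : ℝ) / N) • (η - c)) / g (c + ((j : ℝ) / N) • (η - c)))
        = Λ (c + (((j + 1 : ℕ) : ℝ) / N) • (η - c)) - Λ (c + ((j : ℝ) / N) • (η - c)) := by
      intro j hj
      rw [Finset.mem_range] at hj
      have h1 : ((j + 1 : ℕ) : ℝ) / N ∈ Set.Icc (0 : ℝ) 1 :=
        ⟨by positivity, (div_le_one hN0).2 (by exact_mod_cast hj)⟩
      have h2 : (j : ℝ) / N ∈ Set.Icc (0 : ℝ) 1 :=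
        ⟨by positivity, (div_le_one hN0).2 (by exact_mod_cast hj.le)⟩
      refine hlog _ (segment_mem_ball hη h1.1 h1.2) _ (segment_mem_ball hη h2.1 h2.2) ?_
      have := huc _ h1 _ h2 (by
        rw [Real.dist_eq, ← sub_div, Nat.cast_add_one, add_sub_cancel_left,
          abs_of_pos (by positivity)]
        exact hNε)
      rwa [dist_eq_norm] at this
    rw [segmentLog, Finset.sum_congr rfl hsum,
      Finset.sum_range_sub (fun j : ℕ => Λ (c + ((j : ℝ) / N) • (η - c)))]
    simp only [div_self hN0.ne', Nat.cast_zero, zero_div, zero_smul, add_zero, one_smul,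
      add_sub_cancel, Λ]
    ring

/-- On a segment where `g` is real and positive, every subdivision gives the principal logarithm. -/
theorem segmentLog_eq_of_pos {E : Type*} [AddCommGroup E] [Module ℝ E] {g : E → ℂ} {c η : E}
    (hg : ∀ s : ℝ, 0 ≤ s → s ≤ 1 → ∃ x : ℝ, 0 < x ∧ g (c + s • (η - c)) = x) {N : ℕ} (hN : N ≠ 0) :
    segmentLog g c η N = log (g η) := by
  have hN0 : (0 : ℝ) < N := by exact_mod_cast Nat.pos_of_ne_zero hN
  have hsum : ∀ j ∈ Finset.range N,
      log (g (c + (((j + 1 : ℕ) : ℝ) / N) • (η - c)) / g (c + ((j : ℝ) / N) • (η - c)))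
      = log (g (c + (((j + 1 : ℕ) : ℝ) / N) • (η - c))) -
        log (g (c + ((j : ℝ) / N) • (η - c))) := by
    intro j hj
    rw [Finset.mem_range] at hj
    obtain ⟨x, hx, hxe⟩ := hg (((j + 1 : ℕ) : ℝ) / N) (by positivity)
      ((div_le_one hN0).2 (by exact_mod_cast hj))
    obtain ⟨y, hy, hye⟩ := hg ((j : ℝ) / N) (by positivity)
      ((div_le_one hN0).2 (by exact_mod_cast hj.le))
    rw [hxe, hye, ← ofReal_div, ← ofReal_log (by positivity), ← ofReal_log hx.le,
      ← ofReal_log hy.le, Real.log_div hx.ne' hy.ne', ofReal_sub]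
  rw [segmentLog, Finset.sum_congr rfl hsum,
    Finset.sum_range_sub (fun j : ℕ => log (g (c + ((j : ℝ) / N) • (η - c))))]
  simp [div_self hN0.ne']

/-- The Borel-Carathéodory theorem on complex lines: a bound on the real part, that is on `log |g|`,
bounds a branch of the logarithm which is real at the centre. -/
theorem norm_log_branch_le {d : ℕ} {Λ : EuclideanSpace ℂ (Fin d) → ℂ}
    {c : EuclideanSpace ℂ (Fin d)} {r W : ℝ} (hW : 0 < W)
    (hΛ : AnalyticOnNhd ℂ Λ (ball c r)) (hre : ∀ η ∈ ball c r, |(Λ η).re| ≤ W)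
    (hc : (Λ c).im = 0) {η : EuclideanSpace ℂ (Fin d)} (hη : η ∈ ball c (r / 2)) :
    ‖Λ η‖ ≤ 5 * W := by
  rw [mem_ball_iff_norm] at hη
  have hmem : ∀ z ∈ ball (0 : ℂ) 2, c + z • (η - c) ∈ ball c r := by
    intro z hz
    rw [mem_ball_zero_iff] at hz
    rw [mem_ball_iff_norm, add_sub_cancel_left, norm_smul]
    nlinarith [norm_nonneg (η - c)]
  have h := borelCaratheodory (f := fun z => Λ (c + z • (η - c))) (M := W) (R := 2) (z := 1) hW
    (fun z hz => by
      have h2 : DifferentiableAt ℂ Λ (c + z • (η - c)) := (hΛ _ (hmem z hz)).differentiableAt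
      exact (DifferentiableAt.comp (f := fun z : ℂ => c + z • (η - c)) z h2
        (by fun_prop)).differentiableWithinAt)
    (fun z hz => (le_abs_self _).trans (hre _ (hmem z hz))) two_pos (by simp)
  have h0 : ‖Λ c‖ ≤ W := by
    have h1 : Λ c = ((Λ c).re : ℂ) := Complex.ext (by simp) (by simp [hc])
    rw [h1, norm_real]
    refine hre c (mem_ball_self ?_)
    linarith [norm_nonneg (η - c)]
  simp only [one_smul, add_sub_cancel, zero_smul, add_zero, norm_one] at h
  norm_num at h
  linarith
end HMMEntropy

/-! ### Weighted averages of functions with small oscillation -/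

namespace HMMEntropy

section Contraction
variable {S E : Type*} [MeasurableSpace S] [NormedAddCommGroup E] [NormedSpace ℝ E]

theorem integrable_smul_of_oscillation_le {μ : Measure S} {k : S → ℝ} {w : S → E} {D : ℝ}
    (hk : Integrable k μ) (hw : StronglyMeasurable w) (hD : ∀ a b, ‖w a - w b‖ ≤ D) :
    Integrable (fun a => k a • w a) μ := by
  rcases isEmpty_or_nonempty S with hS | ⟨⟨s⟩⟩
  · rw [Measure.eq_zero_of_isEmpty μ]; exact integrable_zero_measure
  · have h1 : Integrable (fun a => ‖k a‖ * (D + ‖w s‖)) μ := hk.norm.mul_const _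
    refine h1.mono' (hk.aestronglyMeasurable.smul hw.aestronglyMeasurable)
      (Eventually.of_forall fun a => ?_)
    rw [norm_smul]
    gcongr
    have := norm_sub_norm_le (w a) (w s)
    linarith [hD a s]

variable [CompleteSpace E]

/-- An average of `w` is within the oscillation of `w` from each of its values. -/
theorem norm_integral_smul_sub_le {μ : Measure S} {k : S → ℝ} {w : S → E} {D : ℝ}
    (hk : Integrable k μ) (hk0 : 0 ≤ᵐ[μ] k) (hk1 : ∫ a, k a ∂μ = 1)
    (hw : StronglyMeasurable w) (hD : ∀ a b, ‖w a - w b‖ ≤ D) (b : S) :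
    ‖(∫ a, k a • w a ∂μ) - w b‖ ≤ D := by
  have hi := integrable_smul_of_oscillation_le hk hw hD
  have h1 : (∫ a, k a • w a ∂μ) - w b = ∫ a, k a • (w a - w b) ∂μ := by
    simp only [smul_sub]
    rw [integral_sub hi (hk.smul_const _), integral_smul_const, hk1, one_smul]
  rw [h1]
  calc _ ≤ ∫ a, k a * D ∂μ := by
        refine norm_integral_le_of_norm_le (hk.mul_const D) ?_
        filter_upwards [hk0] with a ha
        rw [norm_smul, Real.norm_eq_abs, abs_of_nonneg ha]
        exact mul_le_mul_of_nonneg_left (hD a b) ha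
    _ = D := by rw [integral_mul_const, hk1, one_mul]

/-- Doeblin's contraction: if the probability density `k₁` dominates `c * k₂`, the averages of `w`
with respect to `k₁` and `k₂` differ by at most `1 - c` times the oscillation of `w`. -/
theorem norm_integral_smul_sub_integral_smul_le {μ : Measure S} {k₁ k₂ : S → ℝ} {w : S → E}
    {c D : ℝ} (hk₁ : Integrable k₁ μ) (hk₂ : Integrable k₂ μ) (hk₂0 : 0 ≤ᵐ[μ] k₂)
    (h1 : ∫ a, k₁ a ∂μ = 1) (h2 : ∫ a, k₂ a ∂μ = 1)
    (hc : ∀ᵐ a ∂μ, c * k₂ a ≤ k₁ a)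
    (hw : StronglyMeasurable w) (hD : ∀ a b, ‖w a - w b‖ ≤ D) :
    ‖(∫ a, k₁ a • w a ∂μ) - ∫ a, k₂ a • w a ∂μ‖ ≤ (1 - c) * D := by
  have hi₁ := integrable_smul_of_oscillation_le hk₁ hw hD
  have hi₂ := integrable_smul_of_oscillation_le hk₂ hw hD
  set v := ∫ a, k₂ a • w a ∂μ with hv
  have hkd : Integrable (fun a => k₁ a - c * k₂ a) μ := hk₁.sub (hk₂.const_mul c)
  have h3 : (∫ a, k₁ a • w a ∂μ) - v = ∫ a, (k₁ a - c * k₂ a) • (w a - v) ∂μ := by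
    simp only [smul_sub, sub_smul, mul_smul]
    rw [integral_sub, integral_sub, integral_sub, integral_smul, ← hv, integral_smul_const, h1,
      integral_smul, integral_smul_const, h2, one_smul]
    · abel
    · exact hk₁.smul_const v
    · exact (hk₂.smul_const v).smul c
    · exact hi₁
    · exact hi₂.smul c
    · exact hi₁.sub (hi₂.smul c)
    · exact (hk₁.smul_const v).sub ((hk₂.smul_const v).smul c)
  rw [h3]
  calc _ ≤ ∫ a, (k₁ a - c * k₂ a) * D ∂μ := by
        refine norm_integral_le_of_norm_le (hkd.mul_const D) ?_
        filter_upwards [hc] with a ha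
        rw [norm_smul, Real.norm_eq_abs, abs_of_nonneg (by linarith), norm_sub_rev]
        exact mul_le_mul_of_nonneg_left (norm_integral_smul_sub_le hk₂ hk₂0 h2 hw hD a)
          (by linarith)
    _ = (1 - c) * D := by
        rw [integral_mul_const, integral_sub hk₁ (hk₂.const_mul c), integral_const_mul, h1, h2,
          mul_one]

/-- Weighted averages with respect to weights that are comparable up to a factor `c` differ by at
most `1 - c ^ 2` times the oscillation of the averaged function. -/
theorem norm_weighted_average_sub_le {μ : Measure S} {k₁ k₂ : S → ℝ} {w : S → E} {c D : ℝ}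
    (hk₁ : Integrable k₁ μ) (hk₂ : Integrable k₂ μ) (hk₂0 : 0 ≤ᵐ[μ] k₂)
    (h1 : 0 < ∫ a, k₁ a ∂μ) (h2 : 0 < ∫ a, k₂ a ∂μ) (hc0 : 0 < c)
    (hc : ∀ᵐ a ∂μ, c * k₂ a ≤ k₁ a) (hc' : ∀ᵐ a ∂μ, c * k₁ a ≤ k₂ a)
    (hw : StronglyMeasurable w) (hD : ∀ a b, ‖w a - w b‖ ≤ D) :
    ‖((∫ a, k₁ a ∂μ)⁻¹ • ∫ a, k₁ a • w a ∂μ) - (∫ a, k₂ a ∂μ)⁻¹ • ∫ a, k₂ a • w a ∂μ‖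
      ≤ (1 - c ^ 2) * D := by
  have hle : c * ∫ a, k₁ a ∂μ ≤ ∫ a, k₂ a ∂μ := by
    rw [← integral_const_mul]
    exact integral_mono_ae (hk₁.const_mul c) hk₂ hc'
  rw [← integral_smul, ← integral_smul]
  simp only [smul_smul]
  refine norm_integral_smul_sub_integral_smul_le (c := c ^ 2) (hk₁.const_mul _) (hk₂.const_mul _)
    ?_ ?_ ?_ ?_ hw hD
  · filter_upwards [hk₂0] with a ha
    exact mul_nonneg (inv_nonneg.2 h2.le) ha
  · rw [integral_const_mul, inv_mul_cancel₀ h1.ne']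
  · rw [integral_const_mul, inv_mul_cancel₀ h2.ne']
  · filter_upwards [hc, hk₂0] with a ha ha0
    have ha0 : 0 ≤ k₂ a := ha0
    have h3 : c * (∫ a, k₂ a ∂μ)⁻¹ ≤ (∫ a, k₁ a ∂μ)⁻¹ := by
      rw [← div_eq_mul_inv, div_le_iff₀ h2, inv_mul_eq_div, le_div_iff₀ h1]
      exact hle
    calc c ^ 2 * ((∫ a, k₂ a ∂μ)⁻¹ * k₂ a) = (c * (∫ a, k₂ a ∂μ)⁻¹) * (c * k₂ a) := by ring
      _ ≤ (∫ a, k₁ a ∂μ)⁻¹ * k₁ a := by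
        have := inv_nonneg.2 h1.le
        have h4 : 0 ≤ c * k₂ a := by positivity
        gcongr
end Contraction
end HMMEntropy

/-! ### Mixing kernels and the law of the observations -/

namespace HMMEntropy
open scoped ENNReal

/-- `r y x' x` is the density, in `(y, x')`, of a Markov kernel from `S` to `T × S`. The densities
for different states `x` are comparable up to the factor `e`, the density is at most `m y`, and the
observation density `∫ r y x' x μ(dx')` is at least `γ * m y`. -/
structure IsMixingKernel {S T : Type*} [MeasurableSpace S] [MeasurableSpace T] (μ : Measure S)
    (ν : Measure T) (r : T → S → S → ℝ) (e γ : ℝ) (m : T → ℝ) : Prop where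
  nonneg : ∀ y x' x, 0 ≤ r y x' x
  measurable : Measurable fun z : T × S × S => r z.1 z.2.1 z.2.2
  lintegral_eq_one : ∀ x, ∫⁻ y, ∫⁻ x', ENNReal.ofReal (r y x' x) ∂μ ∂ν = 1
  mixing : ∀ y x₁ x₂, ∀ᵐ x' ∂μ, e * r y x' x₁ ≤ r y x' x₂
  le_bound : ∀ y x' x, r y x' x ≤ m y
  lower : ∀ y x, γ * m y ≤ ∫ x', r y x' x ∂μ
  bound_pos : ∀ y, 0 < m y
  e_pos : 0 < e
  e_lt_one : e < 1
  γ_pos : 0 < γ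

/-- The real-valued version of `condObsDensity`. -/
def obsKernel {S T : Type*} [MeasurableSpace S] (μ : Measure S) (r : T → S → S → ℝ) (n : ℕ)
    (y : Fin n → T) (x : S) : ℝ :=
  (condObsDensity μ r n y x).toReal

/-- The law of the next observation and the next state. -/
def stepKernel {S T : Type*} [MeasurableSpace S] [MeasurableSpace T] (μ : Measure S)
    (ν : Measure T) [SFinite μ] [SFinite ν] (r : T → S → S → ℝ) : Kernel S (T × S) :=
  Kernel.withDensity (Kernel.const S (ν.prod μ)) fun x z => ENNReal.ofReal (r z.1 z.2 x)

/-- The law of the next `n` observations. -/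
def pathKernel {S T : Type*} [MeasurableSpace S] [MeasurableSpace T] (μ : Measure S)
    (ν : Measure T) [SigmaFinite ν] (r : T → S → S → ℝ) (n : ℕ) : Kernel S (Fin n → T) :=
  Kernel.withDensity (Kernel.const S (Measure.pi fun _ => ν)) fun x y => condObsDensity μ r n y x

theorem measurable_condObsDensity {S T : Type*} [MeasurableSpace S] [MeasurableSpace T]
    {μ : Measure S} [SFinite μ] {r : T → S → S → ℝ}
    (hr : Measurable fun z : T × S × S => r z.1 z.2.1 z.2.2) (n : ℕ) :
    Measurable fun z : (Fin n → T) × S => condObsDensity μ r n z.1 z.2 := by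
  induction n with
  | zero => exact measurable_const
  | succ n ih =>
    simp only [condObsDensity]
    refine Measurable.lintegral_prod_right'
      (f := fun z : ((Fin (n + 1) → T) × S) × S => ENNReal.ofReal (r (z.1.1 0) z.2 z.1.2) *
        condObsDensity μ r n (fun k => z.1.1 k.succ) z.2) ?_
    have h1 : Measurable fun z : ((Fin (n + 1) → T) × S) × S => (z.1.1 0, z.2, z.1.2) := by fun_prop
    have h2 : Measurable fun z : ((Fin (n + 1) → T) × S) × S =>
        (fun k : Fin n => z.1.1 k.succ, z.2) := by fun_prop
    exact (hr.comp h1).ennreal_ofReal.mul (ih.comp h2)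

theorem measurable_finCons (T : Type*) [MeasurableSpace T] (n : ℕ) :
    Measurable fun z : T × (Fin n → T) => (Fin.cons z.1 z.2 : Fin (n + 1) → T) := by
  refine measurable_pi_iff.2 fun i => ?_
  refine Fin.cases ?_ (fun j => ?_) i
  · simp only [Fin.cons_zero]; fun_prop
  · simp only [Fin.cons_succ]; fun_prop

theorem measurable_finInit (T : Type*) [MeasurableSpace T] (n : ℕ) :
    Measurable (Fin.init : (Fin (n + 1) → T) → Fin n → T) :=
  measurable_pi_iff.2 fun _ => measurable_pi_apply _

namespace IsMixingKernel
variable {S T : Type*} [MeasurableSpace S] [MeasurableSpace T] {μ : Measure S} [IsFiniteMeasure μ]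
  {ν : Measure T} {r : T → S → S → ℝ} {e γ : ℝ} {m : T → ℝ}

section
variable (h : IsMixingKernel μ ν r e γ m)
include h

omit [IsFiniteMeasure μ] in
theorem measurable_section (y : T) (x : S) : Measurable fun x' => r y x' x :=
  h.measurable.comp (by fun_prop : Measurable fun x' : S => (y, x', x))

theorem integrable (y : T) (x : S) : Integrable (fun x' => r y x' x) μ := by
  refine Integrable.of_bound (h.measurable_section y x).aestronglyMeasurable (m y)
    (Eventually.of_forall fun x' => ?_)
  rw [Real.norm_eq_abs, abs_of_nonneg (h.nonneg y x' x)]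
  exact h.le_bound y x' x

theorem condObsDensity_le (n : ℕ) (y : Fin n → T) (x : S) :
    condObsDensity μ r n y x ≤ ∏ k, ENNReal.ofReal (μ.real Set.univ * m (y k)) := by
  induction n generalizing x with
  | zero => simp [condObsDensity]
  | succ n ih =>
    rw [condObsDensity, Fin.prod_univ_succ]
    calc _ ≤ ∫⁻ _, ENNReal.ofReal (m (y 0)) *
          ∏ k : Fin n, ENNReal.ofReal (μ.real Set.univ * m (y k.succ)) ∂μ := by
          refine lintegral_mono fun x' => ?_
          exact mul_le_mul' (ENNReal.ofReal_le_ofReal (h.le_bound _ _ _)) (ih _ _)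
      _ = _ := by
        rw [lintegral_const, ENNReal.ofReal_mul measureReal_nonneg, ofReal_measureReal]
        ring

theorem condObsDensity_ne_top (n : ℕ) (y : Fin n → T) (x : S) :
    condObsDensity μ r n y x ≠ ∞ :=
  ((h.condObsDensity_le n y x).trans_lt (ENNReal.prod_lt_top fun _ _ => ENNReal.ofReal_lt_top)).ne

theorem ofReal_obsKernel (n : ℕ) (y : Fin n → T) (x : S) :
    ENNReal.ofReal (obsKernel μ r n y x) = condObsDensity μ r n y x :=
  ENNReal.ofReal_toReal (h.condObsDensity_ne_top n y x)

theorem measurable_obsKernel (n : ℕ) :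
    Measurable fun z : (Fin n → T) × S => obsKernel μ r n z.1 z.2 :=
  (measurable_condObsDensity h.measurable n).ennreal_toReal

theorem measurable_obsKernel_left (n : ℕ) (x : S) : Measurable fun y => obsKernel μ r n y x :=
  (h.measurable_obsKernel n).comp (by fun_prop : Measurable fun y : Fin n → T => (y, x))

theorem measurable_obsKernel_right (n : ℕ) (y : Fin n → T) : Measurable (obsKernel μ r n y) :=
  (h.measurable_obsKernel n).comp (by fun_prop : Measurable fun x : S => (y, x))

theorem obsKernel_le (n : ℕ) (y : Fin n → T) (x : S) :
    obsKernel μ r n y x ≤ ∏ k, (μ.real Set.univ * m (y k)) := by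
  have h0 : ∀ k, 0 ≤ μ.real Set.univ * m (y k) := fun k =>
    mul_nonneg measureReal_nonneg (h.bound_pos _).le
  refine ENNReal.toReal_le_of_le_ofReal (Finset.prod_nonneg fun k _ => h0 k) ?_
  rw [ENNReal.ofReal_prod_of_nonneg fun k _ => h0 k]
  exact h.condObsDensity_le n y x
end

omit [MeasurableSpace T] [IsFiniteMeasure μ] in
theorem obsKernel_nonneg (n : ℕ) (y : Fin n → T) (x : S) : 0 ≤ obsKernel μ r n y x :=
  ENNReal.toReal_nonneg

omit [MeasurableSpace T] [IsFiniteMeasure μ] in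
theorem obsKernel_zero (y : Fin 0 → T) (x : S) : obsKernel μ r 0 y x = 1 := by
  simp [obsKernel, condObsDensity]

section
variable (h : IsMixingKernel μ ν r e γ m)
include h

theorem obsKernel_succ (n : ℕ) (y : Fin (n + 1) → T) (x : S) :
    obsKernel μ r (n + 1) y x =
      ∫ x', r (y 0) x' x * obsKernel μ r n (fun k => y k.succ) x' ∂μ := by
  rw [integral_eq_lintegral_of_nonneg_ae, obsKernel, condObsDensity]
  · congr 1
    refine lintegral_congr fun x' => ?_
    rw [ENNReal.ofReal_mul (h.nonneg _ _ _), h.ofReal_obsKernel]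
  · exact Eventually.of_forall fun x' => mul_nonneg (h.nonneg _ _ _) (obsKernel_nonneg _ _ _)
  · exact ((h.measurable_section _ _).mul (h.measurable_obsKernel_right n _)).aestronglyMeasurable

theorem integrable_mul_obsKernel (n : ℕ) (y₀ : T) (y : Fin n → T) (x : S) :
    Integrable (fun x' => r y₀ x' x * obsKernel μ r n y x') μ := by
  refine (h.integrable y₀ x).mul_bdd (c := ∏ k, (μ.real Set.univ * m (y k)))
    (h.measurable_obsKernel_right n y).aestronglyMeasurable (Eventually.of_forall fun x' => ?_)
  rw [Real.norm_eq_abs, abs_of_nonneg (obsKernel_nonneg _ _ _)]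
  exact h.obsKernel_le n y x'

theorem le_obsKernel (n : ℕ) (y : Fin n → T) (x : S) :
    ∏ k, (γ * m (y k)) ≤ obsKernel μ r n y x := by
  induction n generalizing x with
  | zero => simp [obsKernel_zero]
  | succ n ih =>
    rw [h.obsKernel_succ, Fin.prod_univ_succ]
    have h0 : 0 ≤ ∏ k : Fin n, (γ * m (y k.succ)) :=
      Finset.prod_nonneg fun k _ => mul_nonneg h.γ_pos.le (h.bound_pos _).le
    calc _ ≤ (∫ x', r (y 0) x' x ∂μ) * ∏ k : Fin n, (γ * m (y k.succ)) := by
          gcongr; exact h.lower _ _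
      _ = ∫ x', r (y 0) x' x * ∏ k : Fin n, (γ * m (y k.succ)) ∂μ := by rw [integral_mul_const]
      _ ≤ _ := by
        refine integral_mono ((h.integrable _ _).mul_const _) (h.integrable_mul_obsKernel n _ _ _)
          fun x' => ?_
        exact mul_le_mul_of_nonneg_left (ih _ _) (h.nonneg _ _ _)

theorem obsKernel_pos (n : ℕ) (y : Fin n → T) (x : S) : 0 < obsKernel μ r n y x :=
  (Finset.prod_pos fun _ _ => mul_pos h.γ_pos (h.bound_pos _)).trans_le (h.le_obsKernel n y x)

/-- Mixing of the first step makes the observation densities for different initial states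
comparable. -/
theorem mul_obsKernel_le (n : ℕ) (y : Fin n → T) (x₁ x₂ : S) :
    e * obsKernel μ r n y x₁ ≤ obsKernel μ r n y x₂ := by
  cases n with
  | zero => simpa [obsKernel_zero] using h.e_lt_one.le
  | succ n =>
    rw [h.obsKernel_succ, h.obsKernel_succ, ← integral_const_mul]
    refine integral_mono_ae ((h.integrable_mul_obsKernel n _ _ _).const_mul e)
      (h.integrable_mul_obsKernel n _ _ _) ?_
    filter_upwards [h.mixing (y 0) x₁ x₂] with x' hx'
    rw [← mul_assoc]
    exact mul_le_mul_of_nonneg_right hx' (obsKernel_nonneg _ _ _)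

variable [SigmaFinite ν]

omit [IsFiniteMeasure μ] in
theorem stepKernel_eq [SFinite μ] (x : S) :
    stepKernel μ ν r x = (ν.prod μ).withDensity fun z => ENNReal.ofReal (r z.1 z.2 x) := by
  rw [stepKernel, Kernel.withDensity_apply, Kernel.const_apply]
  exact (h.measurable.comp (by fun_prop : Measurable fun z : S × T × S => (z.2.1, z.2.2, z.1))
    ).ennreal_ofReal

theorem pathKernel_eq (n : ℕ) (x : S) : pathKernel μ ν r n x =
    (Measure.pi fun _ => ν).withDensity fun y => condObsDensity μ r n y x := by
  rw [pathKernel, Kernel.withDensity_apply, Kernel.const_apply]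
  exact (measurable_condObsDensity h.measurable n).comp measurable_swap

theorem lintegral_stepKernel (x : S) {F : T × S → ℝ≥0∞} (hF : Measurable F) :
    ∫⁻ z, F z ∂stepKernel μ ν r x =
      ∫⁻ y, ∫⁻ x', ENNReal.ofReal (r y x' x) * F (y, x') ∂μ ∂ν := by
  have h1 : Measurable fun z : T × S => ENNReal.ofReal (r z.1 z.2 x) :=
    (h.measurable.comp (by fun_prop : Measurable fun z : T × S => (z.1, z.2, x))).ennreal_ofReal
  rw [h.stepKernel_eq, lintegral_withDensity_eq_lintegral_mul _ h1 hF, lintegral_prod]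
  · rfl
  · exact (h1.mul hF).aemeasurable

theorem lintegral_pathKernel (n : ℕ) (x : S) {F : (Fin n → T) → ℝ≥0∞} (hF : Measurable F) :
    ∫⁻ y, F y ∂pathKernel μ ν r n x =
      ∫⁻ y, condObsDensity μ r n y x * F y ∂(Measure.pi fun _ => ν) := by
  have h1 : Measurable fun y : Fin n → T => condObsDensity μ r n y x :=
    (measurable_condObsDensity h.measurable n).comp (by fun_prop : Measurable fun y => (y, x))
  rw [h.pathKernel_eq, lintegral_withDensity_eq_lintegral_mul _ h1 hF]
  rfl

/-- The Markov property at the first step. -/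
theorem lintegral_pathKernel_succ (n : ℕ) (x : S) {F : (Fin (n + 1) → T) → ℝ≥0∞}
    (hF : Measurable F) :
    ∫⁻ y, F y ∂pathKernel μ ν r (n + 1) x =
      ∫⁻ z, ∫⁻ y, F (Fin.cons z.1 y) ∂pathKernel μ ν r n z.2 ∂stepKernel μ ν r x := by
  have hcons := measurable_finCons T n
  have hd := measurable_condObsDensity h.measurable (μ := μ) n
  have hd' := measurable_condObsDensity h.measurable (μ := μ) (n + 1)
  have hF' : Measurable fun p : (T × S) × (Fin n → T) => F (Fin.cons p.1.1 p.2) :=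
    hF.comp (hcons.comp (by fun_prop : Measurable fun p : (T × S) × (Fin n → T) => (p.1.1, p.2)))
  have h3 : ∀ y₀ x', ∫⁻ y, F (Fin.cons y₀ y) ∂pathKernel μ ν r n x' =
      ∫⁻ y, condObsDensity μ r n y x' * F (Fin.cons y₀ y) ∂(Measure.pi fun _ => ν) :=
    fun y₀ x' => h.lintegral_pathKernel n x' (hF.comp (hcons.comp (by fun_prop :
      Measurable fun y : Fin n → T => (y₀, y))))
  have h1 : Measurable fun z : T × S => ∫⁻ y, F (Fin.cons z.1 y) ∂pathKernel μ ν r n z.2 := by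
    simp only [h3]
    refine Measurable.lintegral_prod_right' (f := fun p : (T × S) × (Fin n → T) =>
      condObsDensity μ r n p.2 p.1.2 * F (Fin.cons p.1.1 p.2)) (Measurable.mul ?_ hF')
    exact hd.comp (by fun_prop : Measurable fun p : (T × S) × (Fin n → T) => (p.2, p.1.2))
  have hdF : Measurable fun y : Fin (n + 1) → T => condObsDensity μ r (n + 1) y x * F y :=
    (hd'.comp (by fun_prop : Measurable fun y => (y, x))).mul hF
  rw [h.lintegral_stepKernel x h1, h.lintegral_pathKernel (n + 1) x hF,
    ← (measurePreserving_piFinSuccAbove (fun _ : Fin (n + 1) => ν) 0).symm.lintegral_comp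
      hdF, lintegral_prod]
  · refine lintegral_congr fun y₀ => ?_
    have h2 : ∀ y : Fin n → T, (MeasurableEquiv.piFinSuccAbove (fun _ => T) 0).symm (y₀, y)
        = (Fin.cons y₀ y : Fin (n + 1) → T) := fun y => by
      simp [MeasurableEquiv.piFinSuccAbove, Fin.insertNthEquiv]
    simp only [h2, h3, condObsDensity, Fin.cons_zero, Fin.cons_succ]
    have h4 : ∀ y : Fin n → T, (∫⁻ x', ENNReal.ofReal (r y₀ x' x) * condObsDensity μ r n y x' ∂μ)
        * F (Fin.cons y₀ y) = ∫⁻ x', ENNReal.ofReal (r y₀ x' x) *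
          (condObsDensity μ r n y x' * F (Fin.cons y₀ y)) ∂μ := fun y => by
      rw [← lintegral_mul_const]
      · simp only [mul_assoc]
      · exact (h.measurable_section y₀ x).ennreal_ofReal.mul
          (hd.comp (by fun_prop : Measurable fun x' : S => (y, x')))
    simp only [h4]
    rw [lintegral_lintegral_swap]
    · refine lintegral_congr fun x' => ?_
      rw [lintegral_const_mul]
      exact (hd.comp (by fun_prop : Measurable fun y : Fin n → T => (y, x'))).mul
        (hF.comp (hcons.comp (by fun_prop : Measurable fun y : Fin n → T => (y₀, y))))
    · refine Measurable.aemeasurable ?_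
      refine Measurable.mul ((h.measurable_section y₀ x).ennreal_ofReal.comp measurable_snd)
        (hd.mul (hF.comp (hcons.comp (by fun_prop :
          Measurable fun p : (Fin n → T) × S => (y₀, p.1)))))
  · refine Measurable.aemeasurable ?_
    exact (hdF.comp (MeasurableEquiv.piFinSuccAbove (fun _ => T) 0).symm.measurable)

theorem isMarkovKernel_stepKernel : IsMarkovKernel (stepKernel μ ν r) := by
  refine ⟨fun x => ⟨?_⟩⟩
  have := h.lintegral_stepKernel x (F := fun _ => 1) measurable_const
  simp only [mul_one, lintegral_one] at this
  rw [this, h.lintegral_eq_one]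

theorem isMarkovKernel_pathKernel (n : ℕ) : IsMarkovKernel (pathKernel μ ν r n) := by
  induction n with
  | zero =>
    refine ⟨fun x => ⟨?_⟩⟩
    have := h.lintegral_pathKernel 0 x (F := fun _ => 1) measurable_const
    simp only [mul_one, lintegral_one] at this
    rw [this]
    simp [condObsDensity]
  | succ n ih =>
    have := h.isMarkovKernel_stepKernel
    refine ⟨fun x => ⟨?_⟩⟩
    have := h.lintegral_pathKernel_succ n x (F := fun _ => 1) measurable_const
    simpa using this

/-- Forgetting the last observation. -/
theorem map_init_pathKernel (n : ℕ) (x : S) :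
    (pathKernel μ ν r (n + 1) x).map Fin.init = pathKernel μ ν r n x := by
  refine Measure.ext_of_lintegral _ fun F hF => ?_
  rw [lintegral_map hF (measurable_finInit T n)]
  induction n generalizing x with
  | zero =>
    have := h.isMarkovKernel_pathKernel 0
    have := h.isMarkovKernel_pathKernel 1
    have h1 : ∀ y : Fin 0 → T, F y = F finZeroElim := fun y => by rw [Subsingleton.elim y]
    simp [h1]
  | succ n ih =>
    have hFi : Measurable fun y : Fin (n + 2) → T => F (Fin.init y) :=
      hF.comp (measurable_finInit T _)
    rw [h.lintegral_pathKernel_succ (n + 1) x hFi, h.lintegral_pathKernel_succ n x hF]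
    refine lintegral_congr fun z => ?_
    rw [← ih z.2 (F := fun y => F (Fin.cons z.1 y)) (hF.comp ((measurable_finCons T n).comp
      (by fun_prop : Measurable fun y : Fin n → T => (z.1, y))))]
    refine lintegral_congr fun y => ?_
    congr 1
    ext i
    refine Fin.cases ?_ (fun j => ?_) i <;> simp [Fin.init]

/-- The Markov property at the first step, for integrable functions. -/
theorem integral_pathKernel_succ (n : ℕ) (x : S) {F : (Fin (n + 1) → T) → ℝ}
    (hF : StronglyMeasurable F) (hFi : Integrable F (pathKernel μ ν r (n + 1) x)) :
    ∫ y, F y ∂pathKernel μ ν r (n + 1) x =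
      ∫ z, ∫ y, F (Fin.cons z.1 y) ∂pathKernel μ ν r n z.2 ∂stepKernel μ ν r x := by
  have hcons : Measurable fun p : (T × S) × (Fin n → T) =>
      (Fin.cons p.1.1 p.2 : Fin (n + 1) → T) :=
    (measurable_finCons T n).comp
      (by fun_prop : Measurable fun p : (T × S) × (Fin n → T) => (p.1.1, p.2))
  have := h.isMarkovKernel_stepKernel
  have := h.isMarkovKernel_pathKernel n
  let κ : Kernel (T × S) (Fin n → T) := (pathKernel μ ν r n).comap Prod.snd measurable_snd
  have heq : pathKernel μ ν r (n + 1) x =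
      (stepKernel μ ν r x ⊗ₘ κ).map fun p => (Fin.cons p.1.1 p.2 : Fin (n + 1) → T) := by
    refine Measure.ext_of_lintegral _ fun F hF => ?_
    have hFc : Measurable fun p : (T × S) × (Fin n → T) => F (Fin.cons p.1.1 p.2) :=
      hF.comp hcons
    rw [lintegral_map hF hcons, Measure.lintegral_compProd hFc,
      h.lintegral_pathKernel_succ n x hF]
    rfl
  rw [heq] at hFi ⊢
  rw [integral_map hcons.aemeasurable hF.aestronglyMeasurable, Measure.integral_compProd]
  · rfl
  · exact (integrable_map_measure hF.aestronglyMeasurable hcons.aemeasurable).1 hFi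
end
end IsMixingKernel
end HMMEntropy

/-! ### Log-likelihood bounds and forgetting of the initial state -/

namespace HMMEntropy
open scoped ENNReal

theorem abs_log_sub_log_le {a b l : ℝ} (hl : 0 < l) (ha : l ≤ a) (hb : l ≤ b) :
    |Real.log a - Real.log b| ≤ |a - b| / l := by
  have key : ∀ a b : ℝ, l ≤ a → l ≤ b → Real.log a - Real.log b ≤ |a - b| / l := by
    intro a b ha hb
    have ha0 := hl.trans_le ha
    have hb0 := hl.trans_le hb
    rw [← Real.log_div ha0.ne' hb0.ne']
    calc _ ≤ a / b - 1 := Real.log_le_sub_one_of_pos (by positivity)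
      _ = (a - b) / b := by field_simp
      _ ≤ |a - b| / b := by gcongr; exact le_abs_self _
      _ ≤ |a - b| / l := by gcongr
  rw [abs_le]
  constructor
  · have := key b a hb ha
    rw [abs_sub_comm] at this; linarith
  · exact key a b ha hb

theorem abs_log_le_sum {n : ℕ} {a b c : Fin n → ℝ} {g : ℝ} (ha : ∀ k, 0 < a k)
    (hb : ∀ k, 0 < b k) (hag : ∏ k, a k ≤ g) (hgb : g ≤ ∏ k, b k)
    (hac : ∀ k, |Real.log (a k)| ≤ c k) (hbc : ∀ k, |Real.log (b k)| ≤ c k) :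
    |Real.log g| ≤ ∑ k, c k := by
  have hpos : 0 < ∏ k, a k := Finset.prod_pos fun k _ => ha k
  have h1 := Real.log_le_log hpos hag
  have h2 := Real.log_le_log (hpos.trans_le hag) hgb
  rw [Real.log_prod fun k _ => (ha k).ne'] at h1
  rw [Real.log_prod fun k _ => (hb k).ne'] at h2
  rw [abs_le]
  constructor
  · have : ∑ k, -c k ≤ ∑ k, Real.log (a k) :=
      Finset.sum_le_sum fun k _ => (abs_le.1 (hac k)).1
    rw [Finset.sum_neg_distrib] at this
    linarith
  · have : ∑ k, Real.log (b k) ≤ ∑ k, c k :=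
      Finset.sum_le_sum fun k _ => (abs_le.1 (hbc k)).2
    linarith

/-- Constants and functions that control the observation densities and their logarithms. -/
structure IsLogBound {S T : Type*} [MeasurableSpace S] [MeasurableSpace T] (μ : Measure S)
    (ν : Measure T) (γ K C : ℝ) (φ ψ : T → ℝ) : Prop where
  K_pos : 0 < K
  measure_le : μ.real Set.univ ≤ K
  abs_log_γ_le : |Real.log γ| ≤ C
  abs_log_K_le : |Real.log K| ≤ C
  φ_pos : ∀ y, 0 < φ y
  ψ_pos : ∀ y, 0 < ψ y
  integrable_φ : Integrable φ ν
  integrable_mul : Integrable (fun y => ψ y * φ y) ν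

/-- The bound `∏ₖ K φ(yₖ)` of the observation density times the bound `∑ₖ (C + ψ(yₖ))` of its
logarithm. -/
def logBound {T : Type*} (K C : ℝ) (φ ψ : T → ℝ) (n : ℕ) (y : Fin n → T) : ℝ :=
  (∏ k, K * φ (y k)) * ∑ k, (C + ψ (y k))

/-- The growth rate of the integrals of `logBound`. -/
def logBoundRate {T : Type*} [MeasurableSpace T] (ν : Measure T) (K C : ℝ) (φ ψ : T → ℝ) : ℝ :=
  (∫ y, K * φ y ∂ν) + ∫ y, K * φ y * (C + ψ y) ∂ν

namespace IsLogBound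
variable {S T : Type*} [MeasurableSpace S] [MeasurableSpace T] {μ : Measure S}
  {ν : Measure T} {γ K C : ℝ} {φ ψ : T → ℝ} (hb : IsLogBound μ ν γ K C φ ψ)
include hb

theorem C_nonneg : 0 ≤ C := (abs_nonneg _).trans hb.abs_log_γ_le

theorem integrable_one : Integrable (fun y => K * φ y) ν := hb.integrable_φ.const_mul K

theorem integrable_log : Integrable (fun y => K * φ y * (C + ψ y)) ν := by
  have : (fun y => K * φ y * (C + ψ y)) = fun y => (K * C) * φ y + K * (ψ y * φ y) := by
    ext y; ring
  rw [this]
  exact (hb.integrable_φ.const_mul _).add (hb.integrable_mul.const_mul _)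

theorem integral_one_nonneg : 0 ≤ ∫ y, K * φ y ∂ν :=
  integral_nonneg fun y => (mul_pos hb.K_pos (hb.φ_pos y)).le

theorem integral_log_nonneg : 0 ≤ ∫ y, K * φ y * (C + ψ y) ∂ν :=
  integral_nonneg fun y => mul_nonneg (mul_pos hb.K_pos (hb.φ_pos y)).le
    (add_nonneg hb.C_nonneg (hb.ψ_pos y).le)

theorem logBoundRate_nonneg : 0 ≤ logBoundRate ν K C φ ψ :=
  add_nonneg hb.integral_one_nonneg hb.integral_log_nonneg

/-- Expanding the sum in `logBound` gives `n` products, in each of which one factor carries the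
logarithmic term. -/
theorem integrable_logBound_and_le [SigmaFinite ν] (n : ℕ) :
    Integrable (logBound K C φ ψ n) (Measure.pi fun _ => ν) ∧
      ∫ y, logBound K C φ ψ n y ∂(Measure.pi fun _ => ν) ≤ n * logBoundRate ν K C φ ψ ^ n := by
  let f : Fin n → Fin n → T → ℝ := fun j k y =>
    if k = j then K * φ y * (C + ψ y) else K * φ y
  have hf : ∀ j k, Integrable (f j k) ν := by
    intro j k
    by_cases hk : k = j
    · simpa only [f, hk, if_true] using hb.integrable_log
    · simpa only [f, hk, if_false] using hb.integrable_one
  have hfle : ∀ j k, ∫ y, f j k y ∂ν ≤ logBoundRate ν K C φ ψ := by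
    intro j k
    have h1 := hb.integral_one_nonneg
    have h2 := hb.integral_log_nonneg
    by_cases hk : k = j
    · simp only [f, hk, if_true, logBoundRate]; linarith
    · simp only [f, hk, if_false, logBoundRate]; linarith
  have hf0 : ∀ j k, 0 ≤ ∫ y, f j k y ∂ν := by
    intro j k
    by_cases hk : k = j
    · simpa only [f, hk, if_true] using hb.integral_log_nonneg
    · simpa only [f, hk, if_false] using hb.integral_one_nonneg
  have heq : logBound K C φ ψ n = fun y => ∑ j, ∏ k, f j k (y k) := by
    ext y
    rw [logBound, Finset.mul_sum]
    refine Finset.sum_congr rfl fun j _ => ?_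
    rw [← Finset.mul_prod_erase _ _ (Finset.mem_univ j),
      ← Finset.mul_prod_erase _ (fun k => f j k (y k)) (Finset.mem_univ j)]
    have : ∏ k ∈ Finset.univ.erase j, f j k (y k) = ∏ k ∈ Finset.univ.erase j, K * φ (y k) :=
      Finset.prod_congr rfl fun k hk => by simp [f, Finset.ne_of_mem_erase hk]
    rw [this]
    simp only [f, if_true]
    ring
  have hi : ∀ j, Integrable (fun y : Fin n → T => ∏ k, f j k (y k)) (Measure.pi fun _ => ν) :=
    fun j => Integrable.fintype_prod (fun k => hf j k)
  rw [heq]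
  refine ⟨integrable_finsetSum _ fun j _ => hi j, ?_⟩
  rw [integral_finsetSum _ fun j _ => hi j]
  calc _ ≤ ∑ _j : Fin n, logBoundRate ν K C φ ψ ^ n := by
        refine Finset.sum_le_sum fun j _ => ?_
        rw [integral_fintype_prod_eq_prod (fun k => f j k)]
        calc _ ≤ ∏ _k : Fin n, logBoundRate ν K C φ ψ :=
              Finset.prod_le_prod (fun k _ => hf0 j k) fun k _ => hfle j k
          _ = _ := by simp
    _ = _ := by simp
end IsLogBound

/-- The increment of the log-likelihood, for the initial state `x₀`, due to the last of `n + 1`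
observations. -/
def logIncrement {S T : Type*} [MeasurableSpace S] (μ : Measure S) (r : T → S → S → ℝ) (x₀ : S)
    (n : ℕ) (y : Fin (n + 1) → T) : ℝ :=
  Real.log (obsKernel μ r (n + 1) y x₀) - Real.log (obsKernel μ r n (Fin.init y) x₀)

/-- The mean of `logIncrement` when the observations are generated from the initial state `x`. -/
def meanLogIncrement {S T : Type*} [MeasurableSpace S] [MeasurableSpace T] (μ : Measure S)
    (ν : Measure T) [SigmaFinite ν] (r : T → S → S → ℝ) (x₀ : S) (n : ℕ) (x : S) : ℝ :=
  ∫ y, logIncrement μ r x₀ n y ∂pathKernel μ ν r (n + 1) x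

namespace IsMixingKernel
variable {S T : Type*} [MeasurableSpace S] [MeasurableSpace T] {μ : Measure S} [IsFiniteMeasure μ]
  {ν : Measure T} {r : T → S → S → ℝ} {e γ : ℝ} {m : T → ℝ} (h : IsMixingKernel μ ν r e γ m)
include h

theorem integral_mul_obsKernel_pos (n : ℕ) (y₀ : T) (y : Fin n → T) (x : S) :
    0 < ∫ x', r y₀ x' x * obsKernel μ r n y x' ∂μ := by
  have := h.obsKernel_pos (n + 1) (Fin.cons y₀ y) x
  rwa [h.obsKernel_succ] at this

omit [IsFiniteMeasure μ] in
theorem mixing_mul_obsKernel (n : ℕ) (y₀ : T) (y : Fin n → T) (x₁ x₂ : S) :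
    ∀ᵐ x' ∂μ, e * (r y₀ x' x₁ * obsKernel μ r n y x') ≤ r y₀ x' x₂ * obsKernel μ r n y x' := by
  filter_upwards [h.mixing y₀ x₁ x₂] with x' hx'
  rw [← mul_assoc]
  exact mul_le_mul_of_nonneg_right hx' (obsKernel_nonneg _ _ _)

/-- Adding an observation in front averages the predictive density of the last one. -/
theorem obsKernel_div_succ (n : ℕ) (y : Fin (n + 2) → T) (x : S) :
    obsKernel μ r (n + 2) y x / obsKernel μ r (n + 1) (Fin.init y) x =
      (∫ x', r (y 0) x' x * obsKernel μ r n (Fin.init fun k => y k.succ) x' ∂μ)⁻¹ •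
        ∫ x', (r (y 0) x' x * obsKernel μ r n (Fin.init fun k => y k.succ) x') •
          (obsKernel μ r (n + 1) (fun k => y k.succ) x' /
            obsKernel μ r n (Fin.init fun k => y k.succ) x') ∂μ := by
  rw [h.obsKernel_succ (n + 1) y, h.obsKernel_succ n (Fin.init y), smul_eq_mul, div_eq_inv_mul]
  congr 1
  refine integral_congr_ae (Eventually.of_forall fun x' => ?_)
  have := (h.obsKernel_pos n (Fin.init fun k => y k.succ) x').ne'
  simp only [smul_eq_mul]
  field_simp

theorem stronglyMeasurable_obsKernel_div (n : ℕ) (y : Fin (n + 1) → T) :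
    StronglyMeasurable fun x => obsKernel μ r (n + 1) y x / obsKernel μ r n (Fin.init y) x :=
  ((h.measurable_obsKernel_right _ _).div (h.measurable_obsKernel_right _ _)).stronglyMeasurable

/-- The predictive density of the last observation given the earlier ones depends on the initial
state only up to an error that is geometrically small relative to a common lower bound `l`. Each
observation in front replaces it by a weighted average, which preserves `l` and contracts the
oscillation. -/
theorem exists_obsKernel_div_oscillation [Nonempty S] (n : ℕ) (y : Fin (n + 1) → T) :
    ∃ l : ℝ, 0 < l ∧
      (∀ a, l ≤ obsKernel μ r (n + 1) y a / obsKernel μ r n (Fin.init y) a) ∧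
      ∀ a b, |obsKernel μ r (n + 1) y a / obsKernel μ r n (Fin.init y) a -
        obsKernel μ r (n + 1) y b / obsKernel μ r n (Fin.init y) b|
          ≤ (1 - e ^ 2) ^ n * (l / e ^ 2) := by
  have he := h.e_pos
  induction n with
  | zero =>
    obtain ⟨s⟩ := ‹Nonempty S›
    have hs := h.obsKernel_pos 1 y s
    refine ⟨e * obsKernel μ r 1 y s, by positivity, fun a => ?_, fun a b => ?_⟩
    · simpa [obsKernel_zero] using h.mul_obsKernel_le 1 y s a
    · have hle : ∀ a, obsKernel μ r 1 y a ≤ obsKernel μ r 1 y s / e := fun a => by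
        rw [le_div_iff₀ he, mul_comm]; exact h.mul_obsKernel_le 1 y a s
      have h0 : ∀ a, 0 ≤ obsKernel μ r 1 y a := fun a => obsKernel_nonneg _ _ _
      have h1 : e * obsKernel μ r 1 y s / e ^ 2 = obsKernel μ r 1 y s / e := by
        field_simp
      simp only [obsKernel_zero, div_one, pow_zero, one_mul, h1]
      rw [abs_le]
      constructor <;> linarith [hle a, hle b, h0 a, h0 b]
  | succ n ih =>
    obtain ⟨l, hl, hlow, hosc⟩ := ih fun k => y k.succ
    refine ⟨l, hl, fun a => ?_, fun a b => ?_⟩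
    · rw [h.obsKernel_div_succ, smul_eq_mul, inv_mul_eq_div,
        le_div_iff₀ (h.integral_mul_obsKernel_pos n _ _ _), ← integral_const_mul]
      refine integral_mono ((h.integrable_mul_obsKernel n _ _ _).const_mul l)
        (integrable_smul_of_oscillation_le (h.integrable_mul_obsKernel n _ _ _)
          (h.stronglyMeasurable_obsKernel_div n _) hosc) fun x' => ?_
      rw [mul_comm, smul_eq_mul]
      exact mul_le_mul_of_nonneg_left (hlow x') (mul_nonneg (h.nonneg _ _ _)
        (obsKernel_nonneg _ _ _))
    · rw [h.obsKernel_div_succ, h.obsKernel_div_succ, ← Real.norm_eq_abs, pow_succ', mul_assoc]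
      exact norm_weighted_average_sub_le (h.integrable_mul_obsKernel n _ _ _)
        (h.integrable_mul_obsKernel n _ _ _)
        (Eventually.of_forall fun x' => mul_nonneg (h.nonneg _ _ _) (obsKernel_nonneg _ _ _))
        (h.integral_mul_obsKernel_pos n _ _ _) (h.integral_mul_obsKernel_pos n _ _ _) he
        (h.mixing_mul_obsKernel n _ _ _ _) (h.mixing_mul_obsKernel n _ _ _ _)
        (h.stronglyMeasurable_obsKernel_div n _) hosc

/-- The log-likelihood increment forgets the earliest observation at a geometric rate. -/
theorem abs_logIncrement_succ_sub_le (x₀ : S) (n : ℕ) (y : Fin (n + 2) → T) :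
    |logIncrement μ r x₀ (n + 1) y - logIncrement μ r x₀ n fun k => y k.succ|
      ≤ (1 - e ^ 2) ^ n / e ^ 2 := by
  have : Nonempty S := ⟨x₀⟩
  obtain ⟨l, hl, hlow, hosc⟩ := h.exists_obsKernel_div_oscillation n fun k => y k.succ
  have hpos := h.integral_mul_obsKernel_pos n (y 0) (Fin.init fun k => y k.succ) x₀
  have hint := h.integrable_mul_obsKernel n (y 0) (Fin.init fun k => y k.succ) x₀
  have hw := h.stronglyMeasurable_obsKernel_div n fun k => y k.succ
  have hk0 : ∀ x', 0 ≤ r (y 0) x' x₀ * obsKernel μ r n (Fin.init fun k => y k.succ) x' :=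
    fun x' => mul_nonneg (h.nonneg _ _ _) (obsKernel_nonneg _ _ _)
  have hlow' : l ≤ obsKernel μ r (n + 2) y x₀ / obsKernel μ r (n + 1) (Fin.init y) x₀ := by
    rw [h.obsKernel_div_succ, smul_eq_mul, inv_mul_eq_div, le_div_iff₀ hpos, ← integral_const_mul]
    refine integral_mono (hint.const_mul l) (integrable_smul_of_oscillation_le hint hw hosc)
      fun x' => ?_
    rw [mul_comm, smul_eq_mul]
    exact mul_le_mul_of_nonneg_left (hlow x') (hk0 x')
  rw [logIncrement, logIncrement,
    ← Real.log_div (h.obsKernel_pos _ _ _).ne' (h.obsKernel_pos _ _ _).ne',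
    ← Real.log_div (h.obsKernel_pos _ _ _).ne' (h.obsKernel_pos _ _ _).ne']
  refine (abs_log_sub_log_le hl hlow' (hlow x₀)).trans ?_
  rw [div_le_iff₀ hl, h.obsKernel_div_succ, ← integral_smul]
  simp only [← smul_assoc]
  have := norm_integral_smul_sub_le (hint.const_mul _)
    (Eventually.of_forall fun x' => mul_nonneg (inv_nonneg.2 hpos.le) (hk0 x'))
    (by rw [integral_const_mul, inv_mul_cancel₀ hpos.ne']) hw hosc x₀
  refine this.trans (le_of_eq ?_)
  ring
end IsMixingKernel
end HMMEntropy

/-! ### Mean log-likelihood increments -/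

namespace HMMEntropy
open scoped ENNReal

namespace IsMixingKernel
variable {S T : Type*} [MeasurableSpace S] [MeasurableSpace T] {μ : Measure S} [IsFiniteMeasure μ]
  {ν : Measure T} {r : T → S → S → ℝ} {e γ : ℝ} {m : T → ℝ} (h : IsMixingKernel μ ν r e γ m)
  {K C : ℝ} {φ ψ : T → ℝ} (hb : IsLogBound μ ν γ K C φ ψ) (hmφ : ∀ y, m y ≤ φ y)
  (hmψ : ∀ y, |Real.log (m y)| ≤ ψ y)

section
include h hb hmφ

theorem obsKernel_le_prod (n : ℕ) (y : Fin n → T) (x : S) :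
    obsKernel μ r n y x ≤ ∏ k, K * φ (y k) :=
  (h.obsKernel_le n y x).trans (Finset.prod_le_prod
    (fun _ _ => mul_nonneg measureReal_nonneg (h.bound_pos _).le) fun _ _ =>
      mul_le_mul hb.measure_le (hmφ _) (h.bound_pos _).le hb.K_pos.le)

variable [SigmaFinite ν]

/-- A measurable function with the growth of the log-likelihood is integrable, with a bound on the
integral that does not depend on the kernel. -/
theorem integrable_pathKernel (n : ℕ) (x : S) {F : (Fin n → T) → ℝ} (hF : Measurable F)
    (hFb : ∀ y, |F y| ≤ ∑ k, (C + ψ (y k))) : Integrable F (pathKernel μ ν r n x) ∧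
      |∫ y, F y ∂pathKernel μ ν r n x| ≤ n * logBoundRate ν K C φ ψ ^ n := by
  have hbnd := hb.integrable_logBound_and_le n
  have hle : ∀ y, ‖obsKernel μ r n y x • F y‖ ≤ logBound K C φ ψ n y := by
    intro y
    rw [norm_smul, Real.norm_eq_abs, abs_of_nonneg (obsKernel_nonneg _ _ _), logBound]
    refine mul_le_mul (h.obsKernel_le_prod hb hmφ n y x) (hFb y) (norm_nonneg _) ?_
    exact Finset.prod_nonneg fun k _ => (mul_pos hb.K_pos (hb.φ_pos _)).le
  have hmeas : Measurable fun y : Fin n → T => condObsDensity μ r n y x :=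
    (measurable_condObsDensity h.measurable n).comp (by fun_prop : Measurable fun y => (y, x))
  have hfin : ∀ᵐ y ∂(Measure.pi fun _ : Fin n => ν), condObsDensity μ r n y x < ∞ :=
    Eventually.of_forall fun y => (h.condObsDensity_ne_top n y x).lt_top
  rw [h.pathKernel_eq, integrable_withDensity_iff_integrable_smul' hmeas hfin,
    integral_withDensity_eq_integral_toReal_smul hmeas hfin]
  refine ⟨hbnd.1.mono' ((h.measurable_obsKernel_left n x).mul hF).aestronglyMeasurable
    (Eventually.of_forall hle), ?_⟩
  exact (norm_integral_le_of_norm_le hbnd.1 (Eventually.of_forall hle)).trans hbnd.2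
end

section
include h hb hmψ

theorem abs_log_obsKernel_le (n : ℕ) (y : Fin n → T) (x : S) :
    |Real.log (obsKernel μ r n y x)| ≤ ∑ k, (C + ψ (y k)) := by
  refine abs_log_le_sum (a := fun k => γ * m (y k)) (b := fun k => K * m (y k))
    (fun k => mul_pos h.γ_pos (h.bound_pos _)) (fun k => mul_pos hb.K_pos (h.bound_pos _))
    (h.le_obsKernel n y x) ((h.obsKernel_le n y x).trans (Finset.prod_le_prod
      (fun _ _ => mul_nonneg measureReal_nonneg (h.bound_pos _).le) fun _ _ =>
      mul_le_mul_of_nonneg_right hb.measure_le (h.bound_pos _).le)) (fun k => ?_) fun k => ?_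
  · rw [Real.log_mul h.γ_pos.ne' (h.bound_pos _).ne']
    exact (abs_add_le _ _).trans (add_le_add hb.abs_log_γ_le (hmψ _))
  · rw [Real.log_mul hb.K_pos.ne' (h.bound_pos _).ne']
    exact (abs_add_le _ _).trans (add_le_add hb.abs_log_K_le (hmψ _))
end

variable [SigmaFinite ν]

omit [SigmaFinite ν] in
include h in
theorem measurable_logIncrement (x₀ : S) (n : ℕ) : Measurable (logIncrement μ r x₀ n) :=
  (h.measurable_obsKernel_left (n + 1) x₀).log.sub
    ((h.measurable_obsKernel_left n x₀).comp (measurable_finInit T n)).log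

section
include h hb hmφ hmψ

theorem integrable_log_obsKernel (n : ℕ) (x₀ x : S) :
    Integrable (fun y => Real.log (obsKernel μ r n y x₀)) (pathKernel μ ν r n x) :=
  (h.integrable_pathKernel hb hmφ n x (h.measurable_obsKernel_left n x₀).log
    fun y => h.abs_log_obsKernel_le hb hmψ n y x₀).1

theorem integrable_log_obsKernel_init (n : ℕ) (x₀ x : S) :
    Integrable (fun y => Real.log (obsKernel μ r n (Fin.init y) x₀))
      (pathKernel μ ν r (n + 1) x) := by
  have := h.integrable_log_obsKernel hb hmφ hmψ n x₀ x
  rw [← h.map_init_pathKernel n x] at this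
  exact (integrable_map_measure
    (h.measurable_obsKernel_left n x₀).log.aestronglyMeasurable
    (measurable_finInit T n).aemeasurable).1 this

theorem integrable_logIncrement (x₀ : S) (n : ℕ) (x : S) :
    Integrable (logIncrement μ r x₀ n) (pathKernel μ ν r (n + 1) x) :=
  (h.integrable_log_obsKernel hb hmφ hmψ (n + 1) x₀ x).sub
    (h.integrable_log_obsKernel_init hb hmφ hmψ n x₀ x)

/-- The mean log-likelihood is the sum of the mean increments. -/
theorem integral_log_obsKernel (n : ℕ) (x₀ x : S) :
    ∫ y, Real.log (obsKernel μ r n y x₀) ∂pathKernel μ ν r n x =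
      ∑ k ∈ Finset.range n, meanLogIncrement μ ν r x₀ k x := by
  induction n with
  | zero => simp [obsKernel_zero]
  | succ n ih =>
    rw [Finset.sum_range_succ, ← ih, meanLogIncrement]
    have h1 : ∫ y, Real.log (obsKernel μ r n (Fin.init y) x₀) ∂pathKernel μ ν r (n + 1) x
        = ∫ y, Real.log (obsKernel μ r n y x₀) ∂pathKernel μ ν r n x := by
      rw [← h.map_init_pathKernel n x, integral_map (measurable_finInit T n).aemeasurable
        (h.measurable_obsKernel_left n x₀).log.aestronglyMeasurable]
    simp only [logIncrement]
    rw [integral_sub (h.integrable_log_obsKernel hb hmφ hmψ (n + 1) x₀ x)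
      (h.integrable_log_obsKernel_init hb hmφ hmψ n x₀ x), h1]
    ring

/-- Up to the forgetting error, the mean increments satisfy `a (n + 1) = Q (a n)` for the transition
operator `Q` of the state. -/
theorem abs_meanLogIncrement_succ_sub_integral_le (x₀ : S) (n : ℕ) (x : S) :
    |meanLogIncrement μ ν r x₀ (n + 1) x -
      ∫ z, meanLogIncrement μ ν r x₀ n z.2 ∂stepKernel μ ν r x| ≤ (1 - e ^ 2) ^ n / e ^ 2 := by
  have := h.isMarkovKernel_pathKernel (n + 2)
  have htail : Measurable fun y : Fin (n + 2) → T => fun k : Fin (n + 1) => y k.succ :=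
    measurable_pi_iff.2 fun k => measurable_pi_apply _
  have hm := (h.measurable_logIncrement x₀ n).comp htail
  have hd : ∀ y : Fin (n + 2) → T,
      ‖logIncrement μ r x₀ (n + 1) y - logIncrement μ r x₀ n fun k => y k.succ‖
        ≤ (1 - e ^ 2) ^ n / e ^ 2 := h.abs_logIncrement_succ_sub_le x₀ n
  have hi1 := h.integrable_logIncrement hb hmφ hmψ x₀ (n + 1) x
  have hi2 : Integrable (fun y : Fin (n + 2) → T => logIncrement μ r x₀ n fun k => y k.succ)
      (pathKernel μ ν r (n + 2) x) := by
    have h3 : Integrable (fun y : Fin (n + 2) → T =>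
        logIncrement μ r x₀ (n + 1) y - logIncrement μ r x₀ n fun k => y k.succ)
        (pathKernel μ ν r (n + 2) x) := by
      refine Integrable.of_bound ?_ _ (Eventually.of_forall hd)
      exact ((h.measurable_logIncrement x₀ (n + 1)).sub hm).aestronglyMeasurable
    exact (hi1.sub h3).congr (Eventually.of_forall fun y => by simp)
  have h4 := h.integral_pathKernel_succ (n + 1) x hm.stronglyMeasurable hi2
  simp only [Function.comp_def, Fin.cons_succ] at h4
  change |∫ y, logIncrement μ r x₀ (n + 1) y ∂pathKernel μ ν r (n + 2) x -
    ∫ z, (∫ y, logIncrement μ r x₀ n y ∂pathKernel μ ν r (n + 1) z.2) ∂stepKernel μ ν r x| ≤ _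
  rw [← h4, ← integral_sub hi1 hi2]
  simpa using norm_integral_le_of_norm_le_const (Eventually.of_forall hd)
    (μ := pathKernel μ ν r (n + 2) x)
end

section
include h

theorem integral_stepKernel (x : S) (F : T × S → ℝ) :
    ∫ z, F z ∂stepKernel μ ν r x = ∫ z, r z.1 z.2 x • F z ∂(ν.prod μ) := by
  have hm : Measurable fun z : T × S => r z.1 z.2 x :=
    h.measurable.comp (by fun_prop : Measurable fun z : T × S => (z.1, z.2, x))
  rw [h.stepKernel_eq, integral_withDensity_eq_integral_toReal_smul hm.ennreal_ofReal
    (Eventually.of_forall fun z => ENNReal.ofReal_lt_top)]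
  simp only [ENNReal.toReal_ofReal (h.nonneg _ _ _)]

omit [SigmaFinite ν] in
theorem integrable_prod (x : S) : Integrable (fun z : T × S => r z.1 z.2 x) (ν.prod μ) ∧
    ∫ z, r z.1 z.2 x ∂(ν.prod μ) = 1 := by
  have hm : Measurable fun z : T × S => r z.1 z.2 x :=
    h.measurable.comp (by fun_prop : Measurable fun z : T × S => (z.1, z.2, x))
  have h1 : ∫⁻ z, ENNReal.ofReal (r z.1 z.2 x) ∂(ν.prod μ) = 1 := by
    rw [lintegral_prod _ hm.ennreal_ofReal.aemeasurable]
    exact h.lintegral_eq_one x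
  have h0 : ∀ᵐ z ∂(ν.prod μ), 0 ≤ r z.1 z.2 x := Eventually.of_forall fun z => h.nonneg _ _ _
  refine ⟨⟨hm.aestronglyMeasurable, ?_⟩, ?_⟩
  · rw [hasFiniteIntegral_iff_ofReal h0, h1]; exact ENNReal.one_lt_top
  · rw [integral_eq_lintegral_of_nonneg_ae h0 hm.aestronglyMeasurable, h1]; simp

omit [SigmaFinite ν] in
theorem mixing_prod (x₁ x₂ : S) : ∀ᵐ z ∂(ν.prod μ), e * r z.1 z.2 x₁ ≤ r z.1 z.2 x₂ := by
  have hm : ∀ x, Measurable fun z : T × S => r z.1 z.2 x := fun x =>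
    h.measurable.comp (by fun_prop : Measurable fun z : T × S => (z.1, z.2, x))
  refine (Measure.ae_prod_iff_ae_ae (measurableSet_le ((hm x₁).const_mul e) (hm x₂))).2 ?_
  exact Eventually.of_forall fun y => h.mixing y x₁ x₂

theorem stronglyMeasurable_meanLogIncrement (x₀ : S) (n : ℕ) :
    StronglyMeasurable (meanLogIncrement μ ν r x₀ n) :=
  have := h.isMarkovKernel_pathKernel (n + 1)
  (h.measurable_logIncrement x₀ n).stronglyMeasurable.integral_kernel

/-- One step of the chain contracts oscillations. -/
theorem abs_integral_stepKernel_sub_le {w : S → ℝ} {D : ℝ} (hw : StronglyMeasurable w)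
    (hD : ∀ a b, |w a - w b| ≤ D) (x₁ x₂ : S) :
    |∫ z, w z.2 ∂stepKernel μ ν r x₁ - ∫ z, w z.2 ∂stepKernel μ ν r x₂| ≤ (1 - e) * D := by
  rw [h.integral_stepKernel, h.integral_stepKernel]
  exact norm_integral_smul_sub_integral_smul_le (h.integrable_prod x₁).1 (h.integrable_prod x₂).1
    (Eventually.of_forall fun z => h.nonneg _ _ _) (h.integrable_prod x₁).2
    (h.integrable_prod x₂).2 (h.mixing_prod x₂ x₁) (hw.comp_measurable measurable_snd)
    fun a b => hD a.2 b.2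

theorem abs_integral_stepKernel_sub_apply_le {w : S → ℝ} {D : ℝ} (hw : StronglyMeasurable w)
    (hD : ∀ a b, |w a - w b| ≤ D) (x b : S) :
    |∫ z, w z.2 ∂stepKernel μ ν r x - w b| ≤ D := by
  have hne : Nonempty T := by
    by_contra hT
    rw [not_nonempty_iff] at hT
    have := h.lintegral_eq_one x
    rw [Measure.eq_zero_of_isEmpty ν] at this
    simp at this
  obtain ⟨t⟩ := hne
  rw [h.integral_stepKernel]
  exact norm_integral_smul_sub_le (w := fun z : T × S => w z.2) (h.integrable_prod x).1
    (Eventually.of_forall fun z => h.nonneg _ _ _) (h.integrable_prod x).2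
    (hw.comp_measurable measurable_snd) (fun a b => hD a.2 b.2) (t, b)
end

include h hb hmφ hmψ

/-- The influence of the initial state on the mean increments decays geometrically: the contraction
by `1 - e` and the forgetting rate `1 - e ^ 2` combine to the rate `1 - e ^ 2 / 2`. -/
theorem abs_meanLogIncrement_sub_le (x₀ : S) (n : ℕ) (a b : S) :
    |meanLogIncrement μ ν r x₀ n a - meanLogIncrement μ ν r x₀ n b| ≤
      (2 * logBoundRate ν K C φ ψ + 4 / e ^ 3) * (1 - e ^ 2 / 2) ^ n := by
  have he := h.e_pos
  have he1 := h.e_lt_one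
  have hA := hb.logBoundRate_nonneg
  induction n generalizing a b with
  | zero =>
    have h1 : ∀ x, |meanLogIncrement μ ν r x₀ 0 x| ≤ logBoundRate ν K C φ ψ := by
      intro x
      have := (h.integrable_pathKernel hb hmφ 1 x (h.measurable_obsKernel_left 1 x₀).log
        fun y => h.abs_log_obsKernel_le hb hmψ 1 y x₀).2
      rw [h.integral_log_obsKernel hb hmφ hmψ] at this
      simpa using this
    have := abs_sub (meanLogIncrement μ ν r x₀ 0 a) (meanLogIncrement μ ν r x₀ 0 b)
    have h4 : 0 < 4 / e ^ 3 := by positivity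
    rw [pow_zero, mul_one]
    linarith [h1 a, h1 b]
  | succ n ih =>
    have h1 := h.abs_meanLogIncrement_succ_sub_integral_le hb hmφ hmψ x₀ n a
    have h2 := h.abs_meanLogIncrement_succ_sub_integral_le hb hmφ hmψ x₀ n b
    have h3 := h.abs_integral_stepKernel_sub_le (h.stronglyMeasurable_meanLogIncrement x₀ n) ih a b
    have hpow : (1 - e ^ 2) ^ n ≤ (1 - e ^ 2 / 2) ^ n :=
      pow_le_pow_left₀ (by nlinarith) (by nlinarith) n
    set q := (1 - e ^ 2 / 2) ^ n with hq
    have hq0 : 0 ≤ q := pow_nonneg (by nlinarith) n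
    have h5 : (1 - e ^ 2) ^ n / e ^ 2 ≤ q / e ^ 2 := by gcongr
    rw [pow_succ (1 - e ^ 2 / 2) n, ← hq]
    have h6 : 2 * (q / e ^ 2) ≤
        (2 * logBoundRate ν K C φ ψ + 4 / e ^ 3) * q * (e / 2) := by
      have : 2 * (q / e ^ 2) = 4 / e ^ 3 * q * (e / 2) := by field_simp; ring
      rw [this]
      gcongr
      linarith
    have h7 : 0 ≤ (2 * logBoundRate ν K C φ ψ + 4 / e ^ 3) * q := by positivity
    have h8 : (2 * logBoundRate ν K C φ ψ + 4 / e ^ 3) * q * (e / 2) ≤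
        (2 * logBoundRate ν K C φ ψ + 4 / e ^ 3) * q * (e - e ^ 2 / 2) := by
      apply mul_le_mul_of_nonneg_left _ h7
      nlinarith
    rw [abs_le] at h1 h2 h3 ⊢
    constructor <;> linarith [h1.1, h1.2, h2.1, h2.2, h3.1, h3.2]

/-- The mean increments converge at a geometric rate which depends only on the constants. -/
theorem abs_meanLogIncrement_succ_sub_le (x₀ : S) (n : ℕ) (a b : S) :
    |meanLogIncrement μ ν r x₀ (n + 1) a - meanLogIncrement μ ν r x₀ n b| ≤
      (2 * logBoundRate ν K C φ ψ + 4 / e ^ 3 + 1 / e ^ 2) * (1 - e ^ 2 / 2) ^ n := by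
  have he := h.e_pos
  have he1 := h.e_lt_one
  have h1 := h.abs_meanLogIncrement_succ_sub_integral_le hb hmφ hmψ x₀ n a
  have h2 := h.abs_integral_stepKernel_sub_apply_le (h.stronglyMeasurable_meanLogIncrement x₀ n)
    (h.abs_meanLogIncrement_sub_le hb hmφ hmψ x₀ n) a b
  have hpow : (1 - e ^ 2) ^ n ≤ (1 - e ^ 2 / 2) ^ n :=
    pow_le_pow_left₀ (by nlinarith) (by nlinarith) n
  have h5 : (1 - e ^ 2) ^ n / e ^ 2 ≤ 1 / e ^ 2 * (1 - e ^ 2 / 2) ^ n := by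
    rw [div_mul_eq_mul_div, one_mul]; gcongr
  rw [abs_le] at h1 h2 ⊢
  constructor <;> linarith [h1.1, h1.2, h2.1, h2.2]
end IsMixingKernel
end HMMEntropy

/-! ### Complex perturbations of a mixing kernel -/

namespace HMMEntropy

/-- The analogue of `obsKernel` for a complex kernel. -/
def complexObsKernel {S T : Type*} [MeasurableSpace S] (μ : Measure S) (k : T → S → S → ℂ) :
    (n : ℕ) → (Fin n → T) → S → ℂ
  | 0, _, _ => 1
  | n + 1, y, x => ∫ x', k (y 0) x' x * complexObsKernel μ k n (fun j => y j.succ) x' ∂μ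

/-- The complex kernel `k` is bounded by `m'`, and for every observation it is close to a complex
multiple of the real kernel `r`, where `m` is the bound of `r`. -/
structure IsPerturbation {S T : Type*} [MeasurableSpace S] [MeasurableSpace T]
    (r : T → S → S → ℝ) (m : T → ℝ) (k : T → S → S → ℂ) (m' : T → ℝ) (τ : ℝ) : Prop where
  measurable : Measurable fun z : T × S × S => k z.1 z.2.1 z.2.2
  norm_le : ∀ y x' x, ‖k y x' x‖ ≤ m' y
  bound_pos : ∀ y, 0 < m' y
  exists_close : ∀ y, ∃ c : ℂ, ‖c‖ * m y = m' y ∧ ∀ x' x, ‖k y x' x - c * r y x' x‖ ≤ τ * m' y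

section
variable {S T : Type*} [MeasurableSpace S] [MeasurableSpace T] {μ : Measure S} [IsFiniteMeasure μ]
  {k : T → S → S → ℂ} {m' : T → ℝ}

theorem stronglyMeasurable_complexObsKernel
    (hk : Measurable fun z : T × S × S => k z.1 z.2.1 z.2.2) (n : ℕ) :
    StronglyMeasurable fun z : (Fin n → T) × S => complexObsKernel μ k n z.1 z.2 := by
  induction n with
  | zero => exact stronglyMeasurable_const
  | succ n ih =>
    simp only [complexObsKernel]
    have h1 : Measurable fun z : ((Fin (n + 1) → T) × S) × S => (z.1.1 0, z.2, z.1.2) := by fun_prop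
    have h2 : Measurable fun z : ((Fin (n + 1) → T) × S) × S =>
        (fun j : Fin n => z.1.1 j.succ, z.2) := by fun_prop
    exact StronglyMeasurable.integral_prod_right (f := fun (z : (Fin (n + 1) → T) × S) (x' : S) =>
      k (z.1 0) x' z.2 * complexObsKernel μ k n (fun j => z.1 j.succ) x')
      ((hk.comp h1).mul (ih.measurable.comp h2)).stronglyMeasurable

theorem measurable_complexObsKernel_right
    (hk : Measurable fun z : T × S × S => k z.1 z.2.1 z.2.2) (n : ℕ) (y : Fin n → T) :
    Measurable (complexObsKernel μ k n y) :=
  (stronglyMeasurable_complexObsKernel hk n).measurable.comp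
    (by fun_prop : Measurable fun x : S => (y, x))

theorem measurable_complexObsKernel_left
    (hk : Measurable fun z : T × S × S => k z.1 z.2.1 z.2.2) (n : ℕ) (x : S) :
    Measurable fun y => complexObsKernel μ k n y x :=
  (stronglyMeasurable_complexObsKernel hk n).measurable.comp
    (by fun_prop : Measurable fun y : Fin n → T => (y, x))

omit [MeasurableSpace T] in
theorem norm_complexObsKernel_le {K : ℝ} (hK : μ.real Set.univ ≤ K)
    (hk : ∀ y x' x, ‖k y x' x‖ ≤ m' y) (hm : ∀ y, 0 ≤ m' y) (n : ℕ) (y : Fin n → T) (x : S) :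
    ‖complexObsKernel μ k n y x‖ ≤ ∏ j, K * m' (y j) := by
  induction n generalizing x with
  | zero => simp [complexObsKernel]
  | succ n ih =>
    rw [complexObsKernel, Fin.prod_univ_succ]
    have hK0 : 0 ≤ K := measureReal_nonneg.trans hK
    have h0 : 0 ≤ ∏ j : Fin n, K * m' (y j.succ) :=
      Finset.prod_nonneg fun j _ => mul_nonneg hK0 (hm _)
    calc _ ≤ m' (y 0) * (∏ j : Fin n, K * m' (y j.succ)) * μ.real Set.univ := by
          refine norm_integral_le_of_norm_le_const (Eventually.of_forall fun x' => ?_)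
          rw [norm_mul]
          exact mul_le_mul (hk _ _ _) (ih _ _) (norm_nonneg _) (hm _)
      _ ≤ m' (y 0) * (∏ j : Fin n, K * m' (y j.succ)) * K := by
          gcongr
          exact mul_nonneg (hm _) h0
      _ = _ := by ring

theorem complexObsKernel_ofReal {ν : Measure T} {r : T → S → S → ℝ} {e γ : ℝ} {m : T → ℝ}
    (h : IsMixingKernel μ ν r e γ m) (n : ℕ) (y : Fin n → T) (x : S) :
    complexObsKernel μ (fun y x' x => (r y x' x : ℂ)) n y x = (obsKernel μ r n y x : ℂ) := by
  induction n generalizing x with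
  | zero => simp [complexObsKernel, IsMixingKernel.obsKernel_zero]
  | succ n ih =>
    rw [complexObsKernel, h.obsKernel_succ, ← integral_complex_ofReal]
    simp [ih]
end

namespace IsMixingKernel
variable {S T : Type*} [MeasurableSpace S] [MeasurableSpace T] {μ : Measure S} [IsFiniteMeasure μ]
  {ν : Measure T} {r : T → S → S → ℝ} {e γ : ℝ} {m : T → ℝ} (h : IsMixingKernel μ ν r e γ m)
include h

/-- Averaging against the bound `m` is controlled by averaging against the kernel, whatever the
state. -/
theorem mul_integral_obsKernel_le {K : ℝ} (hK : μ.real Set.univ ≤ K) (n : ℕ) (y₀ : T)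
    (y : Fin n → T) (x : S) : m y₀ * ∫ x', obsKernel μ r n y x' ∂μ ≤
      K / (γ * e ^ 2) * ∫ x', r y₀ x' x * obsKernel μ r n y x' ∂μ := by
  have he := h.e_pos
  have hγ := h.γ_pos
  have hm := h.bound_pos y₀
  have hG := h.obsKernel_pos n y x
  have hK0 : 0 ≤ K := measureReal_nonneg.trans hK
  have h1 : ∫ x', obsKernel μ r n y x' ∂μ ≤ obsKernel μ r n y x / e * K := by
    calc _ ≤ ∫ _, obsKernel μ r n y x / e ∂μ := by
          refine integral_mono_of_nonneg (Eventually.of_forall fun x' => obsKernel_nonneg _ _ _)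
            (integrable_const _) (Eventually.of_forall fun x' => ?_)
          change _ ≤ obsKernel μ r n y x / e
          rw [le_div_iff₀ he, mul_comm]
          exact h.mul_obsKernel_le n y x' x
      _ = μ.real Set.univ * (obsKernel μ r n y x / e) := by simp
      _ ≤ _ := by rw [mul_comm]; gcongr
  have h2 : γ * m y₀ * (e * obsKernel μ r n y x) ≤ ∫ x', r y₀ x' x * obsKernel μ r n y x' ∂μ := by
    calc _ ≤ (∫ x', r y₀ x' x ∂μ) * (e * obsKernel μ r n y x) := by
          gcongr; exact h.lower y₀ x
      _ = ∫ x', r y₀ x' x * (e * obsKernel μ r n y x) ∂μ := by rw [integral_mul_const]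
      _ ≤ _ := by
        refine integral_mono ((h.integrable y₀ x).mul_const _) (h.integrable_mul_obsKernel n _ _ _)
          fun x' => ?_
        exact mul_le_mul_of_nonneg_left (h.mul_obsKernel_le n y x x') (h.nonneg _ _ _)
  calc _ ≤ m y₀ * (obsKernel μ r n y x / e * K) := by gcongr
    _ = K / (γ * e ^ 2) * (γ * m y₀ * (e * obsKernel μ r n y x)) := by field_simp
    _ ≤ _ := by gcongr

/-- The quotient of the perturbed by the real observation density stays in a cone: its oscillation
is at most `e ^ 2 / 2` times its smallest modulus. The averaging step contracts oscillations by
`1 - e ^ 2`, which leaves room for the error of the perturbation. -/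
theorem complexObsKernel_div_mem_cone {K τ : ℝ} {k : T → S → S → ℂ} {m' : T → ℝ}
    (hk : IsPerturbation r m k m' τ) (hK : μ.real Set.univ ≤ K) (hτ0 : 0 ≤ τ)
    (hτ : τ * (K / (γ * e ^ 2)) ≤ e ^ 4 / 16) (n : ℕ) (y : Fin n → T) :
    (∀ a b z, ‖complexObsKernel μ k n y a / obsKernel μ r n y a -
        complexObsKernel μ k n y b / obsKernel μ r n y b‖ ≤
          e ^ 2 / 2 * ‖complexObsKernel μ k n y z / obsKernel μ r n y z‖) ∧
      ∀ z, ∏ j, (m' (y j) / m (y j) / 4) ≤ ‖complexObsKernel μ k n y z / obsKernel μ r n y z‖ := by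
  have he := h.e_pos
  have he1 := h.e_lt_one
  induction n with
  | zero =>
    constructor
    · intro a b z
      simp only [complexObsKernel, obsKernel_zero, sub_self, norm_zero]
      positivity
    · intro z
      simp [complexObsKernel, obsKernel_zero]
  | succ n ih =>
    obtain ⟨hosc, hlow⟩ := ih fun j => y j.succ
    set y' : Fin n → T := fun j => y j.succ with hy'
    set R : S → ℂ := fun x => complexObsKernel μ k n y' x / obsKernel μ r n y' x with hR
    obtain ⟨c, hcm, hc⟩ := hk.exists_close (y 0)
    have hm := h.bound_pos (y 0)
    have hm' := hk.bound_pos (y 0)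
    have hc0 : 0 < ‖c‖ := by
      by_contra h0
      have : ‖c‖ = 0 := le_antisymm (not_lt.1 h0) (norm_nonneg _)
      rw [this, zero_mul] at hcm
      linarith
    have hG := fun x => h.obsKernel_pos n y' x
    have hRm : StronglyMeasurable R :=
      ((measurable_complexObsKernel_right hk.measurable n y').div
        (Complex.measurable_ofReal.comp (h.measurable_obsKernel_right n y'))).stronglyMeasurable
    have hRG : ∀ x, complexObsKernel μ k n y' x = obsKernel μ r n y' x * R x := fun x => by
      have : (obsKernel μ r n y' x : ℂ) ≠ 0 := by exact_mod_cast (hG x).ne'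
      rw [hR]; field_simp
    let I : S → ℝ := fun x => ∫ x', r (y 0) x' x * obsKernel μ r n y' x' ∂μ
    have hI : ∀ x, 0 < I x := fun x => h.integral_mul_obsKernel_pos n (y 0) y' x
    let A : S → ℂ := fun x => (I x)⁻¹ • ∫ x', (r (y 0) x' x * obsKernel μ r n y' x') • R x' ∂μ
    -- `c * A` is the value for the kernel `c * r`; the perturbation error is measured against the
    -- value of `R` at an arbitrary state `s`
    have key : ∀ s x : S, ‖complexObsKernel μ k (n + 1) y x / obsKernel μ r (n + 1) y x - c * A x‖
        ≤ ‖c‖ * (e ^ 4 * (3 / 32) * ‖R s‖) := by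
      intro s x
      have hRs : ∀ x', ‖R x'‖ ≤ 3 / 2 * ‖R s‖ := fun x' => by
        have h1 := hosc x' s s
        have h2 := norm_sub_norm_le (R x') (R s)
        have h3 : e ^ 2 / 2 * ‖R s‖ ≤ 1 / 2 * ‖R s‖ := by gcongr; nlinarith
        linarith
      have hGb : ∀ x', ‖(obsKernel μ r n y' x' : ℂ)‖ ≤ ∏ j, (μ.real Set.univ * m (y' j)) :=
        fun x' => by
          rw [Complex.norm_real, Real.norm_eq_abs, abs_of_pos (hG x')]
          exact h.obsKernel_le n y' x'
      have hGm : Measurable fun x' => (obsKernel μ r n y' x' : ℂ) :=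
        Complex.measurable_ofReal.comp (h.measurable_obsKernel_right n y')
      have hkm : Measurable fun x' => k (y 0) x' x :=
        hk.measurable.comp (by fun_prop : Measurable fun x' : S => (y 0, x', x))
      have hrm : Measurable fun x' => (r (y 0) x' x : ℂ) :=
        Complex.measurable_ofReal.comp (h.measurable_section _ _)
      have hGi : Integrable (fun x' => obsKernel μ r n y' x') μ :=
        Integrable.of_bound (h.measurable_obsKernel_right n y').aestronglyMeasurable _
          (Eventually.of_forall fun x' => by simpa using hGb x')
      have hi1 : Integrable (fun x' => k (y 0) x' x * (obsKernel μ r n y' x' * R x')) μ := by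
        refine Integrable.of_bound (C := m' (y 0) * ((∏ j, (μ.real Set.univ * m (y' j))) *
          (3 / 2 * ‖R s‖))) (hkm.mul (hGm.mul hRm.measurable)).aestronglyMeasurable
          (Eventually.of_forall fun x' => ?_)
        rw [norm_mul, norm_mul]
        exact mul_le_mul (hk.norm_le _ _ _) (mul_le_mul (hGb _) (hRs _) (norm_nonneg _)
          ((norm_nonneg _).trans (hGb s))) (by positivity) hm'.le
      have hi2 : Integrable (fun x' => c * ((r (y 0) x' x * obsKernel μ r n y' x') • R x')) μ :=
        (integrable_smul_of_oscillation_le (h.integrable_mul_obsKernel n _ _ _) hRm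
          fun a b => hosc a b s).const_mul c
      have h1 : complexObsKernel μ k (n + 1) y x / obsKernel μ r (n + 1) y x - c * A x =
          (I x)⁻¹ • ∫ x', (k (y 0) x' x - c * r (y 0) x' x) *
            (obsKernel μ r n y' x' * R x') ∂μ := by
        have h2 : ∫ x', (k (y 0) x' x - c * r (y 0) x' x) * (obsKernel μ r n y' x' * R x') ∂μ =
            (∫ x', k (y 0) x' x * (obsKernel μ r n y' x' * R x') ∂μ) -
              ∫ x', c * ((r (y 0) x' x * obsKernel μ r n y' x') • R x') ∂μ := by
          rw [← integral_sub hi1 hi2]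
          congr 1; ext x'
          rw [Complex.real_smul]; push_cast; ring
        have h5 : complexObsKernel μ k (n + 1) y x =
            ∫ x', k (y 0) x' x * (obsKernel μ r n y' x' * R x') ∂μ := by
          simp only [← hRG]; rfl
        rw [h2, integral_const_mul, smul_sub, h5, h.obsKernel_succ]
        congr 1
        · rw [Complex.real_smul, Complex.ofReal_inv, div_eq_inv_mul]
        · rw [mul_smul_comm]
      rw [h1, norm_smul, norm_inv, Real.norm_eq_abs, abs_of_pos (hI x), inv_mul_le_iff₀ (hI x)]
      have h3 : ‖∫ x', (k (y 0) x' x - c * r (y 0) x' x) * (obsKernel μ r n y' x' * R x') ∂μ‖ ≤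
          ∫ x', τ * m' (y 0) * (3 / 2 * ‖R s‖) * obsKernel μ r n y' x' ∂μ := by
        refine norm_integral_le_of_norm_le (hGi.const_mul _) (Eventually.of_forall fun x' => ?_)
        rw [norm_mul, norm_mul, Complex.norm_real, Real.norm_eq_abs, abs_of_pos (hG x')]
        calc _ ≤ τ * m' (y 0) * (obsKernel μ r n y' x' * (3 / 2 * ‖R s‖)) := by
              have := (hG x').le
              exact mul_le_mul (hc _ _) (mul_le_mul_of_nonneg_left (hRs x') this) (by positivity)
                (by positivity)
          _ = _ := by ring
      refine h3.trans ?_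
      rw [integral_const_mul, ← hcm]
      have h4 := h.mul_integral_obsKernel_le hK n (y 0) y' x
      calc _ = τ * ‖c‖ * (3 / 2 * ‖R s‖) * (m (y 0) * ∫ x', obsKernel μ r n y' x' ∂μ) := by ring
        _ ≤ τ * ‖c‖ * (3 / 2 * ‖R s‖) * (K / (γ * e ^ 2) * I x) := by gcongr
        _ = (τ * (K / (γ * e ^ 2))) * (‖c‖ * (3 / 2 * ‖R s‖) * I x) := by ring
        _ ≤ e ^ 4 / 16 * (‖c‖ * (3 / 2 * ‖R s‖) * I x) := by
          have := (hI x).le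
          gcongr
        _ = _ := by ring
    have hA1 : ∀ s a b : S, ‖A a - A b‖ ≤ (1 - e ^ 2) * (e ^ 2 / 2 * ‖R s‖) := fun s a b =>
      norm_weighted_average_sub_le (h.integrable_mul_obsKernel n _ _ _)
        (h.integrable_mul_obsKernel n _ _ _)
        (Eventually.of_forall fun x' => mul_nonneg (h.nonneg _ _ _) (obsKernel_nonneg _ _ _))
        (hI a) (hI b) he (h.mixing_mul_obsKernel n _ _ _ _) (h.mixing_mul_obsKernel n _ _ _ _)
        hRm fun a b => hosc a b s
    have hA2 : ∀ s x : S, ‖A x - R s‖ ≤ e ^ 2 / 2 * ‖R s‖ := fun s x => by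
      have hint := h.integrable_mul_obsKernel n (y 0) y' x
      have := norm_integral_smul_sub_le (hint.const_mul (I x)⁻¹)
        (Eventually.of_forall fun x' => mul_nonneg (inv_nonneg.2 (hI x).le)
          (mul_nonneg (h.nonneg _ _ _) (obsKernel_nonneg _ _ _)))
        (by rw [integral_const_mul, inv_mul_cancel₀ (hI x).ne']) hRm (fun a b => hosc a b s) s
      simp only [mul_smul, integral_smul] at this
      simpa only [A, mul_smul] using this
    have he4 : e ^ 4 ≤ e ^ 2 := pow_le_pow_of_le_one he.le he1.le (by norm_num)
    have he2 : e ^ 2 ≤ 1 := by nlinarith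
    have hlow' : ∀ s x : S, ‖c‖ * ((1 - e ^ 2 / 2 - e ^ 4 * (3 / 32)) * ‖R s‖) ≤
        ‖complexObsKernel μ k (n + 1) y x / obsKernel μ r (n + 1) y x‖ := by
      intro s x
      have h1 := key s x
      have h2 := hA2 s x
      have h3 : ‖c * A x‖ - ‖complexObsKernel μ k (n + 1) y x / obsKernel μ r (n + 1) y x‖ ≤
          ‖c‖ * (e ^ 4 * (3 / 32) * ‖R s‖) := by
        refine (norm_sub_norm_le _ _).trans ?_
        rwa [norm_sub_rev]
      have h4 : ‖R s‖ - ‖A x‖ ≤ e ^ 2 / 2 * ‖R s‖ :=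
        (norm_sub_norm_le _ _).trans (by rwa [norm_sub_rev])
      rw [norm_mul] at h3
      have h5 : ‖c‖ * (‖R s‖ - e ^ 2 / 2 * ‖R s‖) ≤ ‖c‖ * ‖A x‖ := by
        gcongr; linarith
      linarith
    constructor
    · intro a b z
      have h1 := key z a
      have h2 := key z b
      have h3 := hA1 z a b
      have h4 := hlow' z z
      have h5 : ‖complexObsKernel μ k (n + 1) y a / obsKernel μ r (n + 1) y a -
          complexObsKernel μ k (n + 1) y b / obsKernel μ r (n + 1) y b‖ ≤
          ‖c‖ * (e ^ 4 * (3 / 32) * ‖R z‖) + ‖c‖ * ((1 - e ^ 2) * (e ^ 2 / 2 * ‖R z‖)) +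
            ‖c‖ * (e ^ 4 * (3 / 32) * ‖R z‖) := by
        have h6 : complexObsKernel μ k (n + 1) y a / obsKernel μ r (n + 1) y a -
          complexObsKernel μ k (n + 1) y b / obsKernel μ r (n + 1) y b =
          (complexObsKernel μ k (n + 1) y a / obsKernel μ r (n + 1) y a - c * A a) +
            c * (A a - A b) -
          (complexObsKernel μ k (n + 1) y b / obsKernel μ r (n + 1) y b - c * A b) := by ring
        rw [h6]
        refine (norm_sub_le _ _).trans (add_le_add ((norm_add_le _ _).trans
          (add_le_add h1 ?_)) h2)
        rw [norm_mul]
        gcongr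
      refine h5.trans ?_
      calc _ = ‖c‖ * ‖R z‖ * (e ^ 4 * (3 / 16) + (1 - e ^ 2) * (e ^ 2 / 2)) := by ring
        _ ≤ ‖c‖ * ‖R z‖ * (e ^ 2 / 2 * (1 - e ^ 2 / 2 - e ^ 4 * (3 / 32))) := by
          gcongr
          nlinarith [pow_pos he 4]
        _ = e ^ 2 / 2 * (‖c‖ * ((1 - e ^ 2 / 2 - e ^ 4 * (3 / 32)) * ‖R z‖)) := by ring
        _ ≤ _ := by gcongr
    · intro z
      rw [Fin.prod_univ_succ, ← hcm, mul_div_cancel_right₀ _ hm.ne']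
      have h1 : 0 ≤ ∏ j, (m' (y' j) / m (y' j) / 4) := Finset.prod_nonneg fun j _ =>
        div_nonneg (div_nonneg (hk.bound_pos _).le (h.bound_pos _).le) (by norm_num)
      calc _ ≤ ‖c‖ / 4 * ‖R z‖ := by gcongr; exact hlow z
        _ = ‖c‖ * (1 / 4 * ‖R z‖) := by ring
        _ ≤ ‖c‖ * ((1 - e ^ 2 / 2 - e ^ 4 * (3 / 32)) * ‖R z‖) := by gcongr; nlinarith
        _ ≤ _ := hlow' z z

/-- Membership in the cone keeps the perturbed observation density away from `0`. -/
theorem le_norm_complexObsKernel {K τ : ℝ} {k : T → S → S → ℂ} {m' : T → ℝ}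
    (hk : IsPerturbation r m k m' τ) (hK : μ.real Set.univ ≤ K) (hτ0 : 0 ≤ τ)
    (hτ : τ * (K / (γ * e ^ 2)) ≤ e ^ 4 / 16) (n : ℕ) (y : Fin n → T) (x : S) :
    ∏ j, (γ / 4 * m' (y j)) ≤ ‖complexObsKernel μ k n y x‖ := by
  have h1 := (h.complexObsKernel_div_mem_cone hk hK hτ0 hτ n y).2 x
  have hG := h.obsKernel_pos n y x
  rw [norm_div, Complex.norm_real, Real.norm_eq_abs, abs_of_pos hG, le_div_iff₀ hG] at h1
  refine le_trans ?_ h1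
  calc _ = (∏ j, (m' (y j) / m (y j) / 4)) * ∏ j, (γ * m (y j)) := by
        rw [← Finset.prod_mul_distrib]
        refine Finset.prod_congr rfl fun j _ => ?_
        have := (h.bound_pos (y j)).ne'
        field_simp
    _ ≤ _ := by
      gcongr
      · exact Finset.prod_nonneg fun j _ =>
          div_nonneg (div_nonneg (hk.bound_pos _).le (h.bound_pos _).le) (by norm_num)
      · exact h.le_obsKernel n y x
end IsMixingKernel
end HMMEntropy

/-! ### Analytic extension of the mean log-likelihood -/

namespace HMMEntropy
open Metric

section
variable {d : ℕ} {S T : Type*} [MeasurableSpace S] [MeasurableSpace T]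
  {Θ : Set (EuclideanSpace ℝ (Fin d))} {μ : Measure S} {ν : Measure T}
  {r : EuclideanSpace ℝ (Fin d) → T → S → S → ℝ} {δ : ℝ}
  {rhat : EuclideanSpace ℂ (Fin d) → T → S → S → ℂ}
  {varphi : EuclideanSpace ℂ (Fin d) → T → ℂ} {phi psi : T → ℝ}

theorem ball_subset_vicinity {δ s : ℝ} {θ₀ : EuclideanSpace ℝ (Fin d)} (hθ₀ : θ₀ ∈ Θ)
    (hs : s ≤ δ) :
    ball (toComplex θ₀) s ⊆ vicinity δ Θ := fun _ hη =>
  ⟨θ₀, hθ₀, (mem_ball_iff_norm.1 hη).trans_le hs⟩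

/-- By the Schwarz lemma, applied to the quotient of `rhat` by `varphi`, the complex kernels near
a real parameter are perturbations of the real kernel. -/
theorem IsAnalyticContinuation.isPerturbation
    (hc : IsAnalyticContinuation Θ ν r δ rhat varphi phi psi) {θ₀ : EuclideanSpace ℝ (Fin d)}
    (hθ₀ : θ₀ ∈ Θ) {s : ℝ} (hs : s ≤ δ) {η : EuclideanSpace ℂ (Fin d)}
    (hη : η ∈ ball (toComplex θ₀) s) :
    IsPerturbation (r θ₀) (fun y => ‖varphi (toComplex θ₀) y‖) (rhat η) (fun y => ‖varphi η y‖)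
      (2 * s / δ) := by
  have hδ := hc.delta_pos
  have hsub := ball_subset_vicinity (Θ := Θ) hθ₀ le_rfl (δ := δ)
  have hη' := ball_subset_ball hs hη
  have h0 : toComplex θ₀ ∈ ball (toComplex θ₀) δ := mem_ball_self hδ
  refine ⟨hc.rhat_measurable η (hsub hη'), hc.norm_rhat_le η (hsub hη'),
    fun y => norm_pos_iff.2 (hc.varphi_ne_zero η (hsub hη') y), fun y => ?_⟩
  have hv0 := hc.varphi_ne_zero _ (hsub h0) y
  have hv := hc.varphi_ne_zero _ (hsub hη') y
  refine ⟨varphi η y / varphi (toComplex θ₀) y, ?_, fun x' x => ?_⟩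
  · rw [norm_div, div_mul_cancel₀ _ (norm_ne_zero_iff.2 hv0)]
  · let f : EuclideanSpace ℂ (Fin d) → ℂ := fun η => rhat η y x' x / varphi η y
    have hfd : DifferentiableOn ℂ f (ball (toComplex θ₀) δ) := fun ξ hξ =>
      (((hc.rhat_analytic y x' x _ (hsub hξ)).div (hc.varphi_analytic y _ (hsub hξ))
        (hc.varphi_ne_zero _ (hsub hξ) y)).differentiableAt).differentiableWithinAt
    have hf1 : ∀ ξ ∈ ball (toComplex θ₀) δ, ‖f ξ‖ ≤ 1 := fun ξ hξ => by
      rw [norm_div, div_le_one (norm_pos_iff.2 (hc.varphi_ne_zero _ (hsub hξ) y))]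
      exact hc.norm_rhat_le _ (hsub hξ) _ _ _
    have hmaps : Set.MapsTo f (ball (toComplex θ₀) δ) (closedBall (f (toComplex θ₀)) 2) :=
      fun ξ hξ => by
        rw [mem_closedBall, dist_eq_norm]
        refine (norm_sub_le _ _).trans ?_
        linarith [hf1 ξ hξ, hf1 _ h0]
    have hS := Complex.dist_le_div_mul_dist_of_mapsTo_ball hfd hmaps hη'
    rw [dist_eq_norm] at hS
    have heq : rhat η y x' x - varphi η y / varphi (toComplex θ₀) y * (r θ₀ y x' x : ℂ) =
        (f η - f (toComplex θ₀)) * varphi η y := by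
      simp only [f]
      rw [← hc.rhat_eq θ₀ hθ₀]
      field_simp
    rw [heq, norm_mul]
    have h2 : 2 / δ * dist η (toComplex θ₀) ≤ 2 * s / δ := by
      rw [div_mul_eq_mul_div]
      have := (mem_ball.1 hη).le
      gcongr
    gcongr
    exact hS.trans h2

variable [IsFiniteMeasure μ]

theorem IsAnalyticContinuation.analyticOnNhd_complexObsKernel
    (hc : IsAnalyticContinuation Θ ν r δ rhat varphi phi psi) {U : Set (EuclideanSpace ℂ (Fin d))}
    (hU : IsOpen U) (hUs : U ⊆ vicinity δ Θ) (n : ℕ) (y : Fin n → T) (x : S) :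
    AnalyticOnNhd ℂ (fun η => complexObsKernel μ (rhat η) n y x) U := by
  induction n generalizing x with
  | zero => exact analyticOnNhd_const
  | succ n ih =>
    refine analyticOnNhd_integral hU (bound := fun _ => phi (y 0) *
      ∏ j : Fin n, μ.real Set.univ * phi (y j.succ)) (integrable_const _) (fun η hη => ?_)
      (fun η hη x' => ?_) fun x' => ?_
    · have hm := hc.rhat_measurable η (hUs hη)
      exact ((hm.comp (by fun_prop : Measurable fun x' : S => (y 0, x', x))).mul
        (measurable_complexObsKernel_right hm n _)).aestronglyMeasurable
    · rw [norm_mul]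
      have hle : ∀ y x' x, ‖rhat η y x' x‖ ≤ phi y := fun y x' x =>
        (hc.norm_rhat_le η (hUs hη) _ _ _).trans (hc.norm_varphi_le η (hUs hη) _)
      exact mul_le_mul (hle _ _ _) (norm_complexObsKernel_le le_rfl hle
        (fun y => (hc.phi_pos y).le) n _ _) (norm_nonneg _) (hc.phi_pos _).le
    · exact ((hc.rhat_analytic (y 0) x' x).mono hUs).mul (ih _ x')

/-- The mean log-likelihood extends to a holomorphic function near a real parameter, on a ball whose
radius does not depend on the number of observations, and grows at most geometrically. -/
theorem exists_analytic_mean_log [SigmaFinite ν]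
    (hc : IsAnalyticContinuation Θ ν r δ rhat varphi phi psi) {e γ K C : ℝ}
    (hker : ∀ θ ∈ Θ, IsMixingKernel μ ν (r θ) e γ fun y => ‖varphi (toComplex θ) y‖)
    (hb : IsLogBound μ ν γ K C phi psi) (hγ : |Real.log (γ / 4)| ≤ C)
    {θ₀ : EuclideanSpace ℝ (Fin d)} {s : ℝ} (hs0 : 0 < s) (hs : s ≤ δ)
    (hsΘ : ball θ₀ s ⊆ Θ) (hsτ : 2 * s / δ * (K / (γ * e ^ 2)) ≤ e ^ 4 / 16) (x₀ : S) (n : ℕ) :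
    ∃ H : EuclideanSpace ℂ (Fin d) → ℂ, AnalyticOnNhd ℂ H (ball (toComplex θ₀) (s / 2)) ∧
      (∀ η ∈ ball (toComplex θ₀) (s / 2), ‖H η‖ ≤ 5 * (n * logBoundRate ν K C phi psi ^ n)) ∧
      ∀ θ ∈ ball θ₀ (s / 2), H (toComplex θ) =
        (∫ y, Real.log (obsKernel μ (r θ) n y x₀) ∂pathKernel μ ν (r θ) n x₀ : ℝ) := by
  rcases Nat.eq_zero_or_pos n with rfl | hn
  · refine ⟨fun _ => 0, analyticOnNhd_const, by simp, fun θ _ => ?_⟩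
    simp [IsMixingKernel.obsKernel_zero]
  have hθ₀ : θ₀ ∈ Θ := hsΘ (mem_ball_self hs0)
  have hδ := hc.delta_pos
  have hsub : ball (toComplex θ₀) s ⊆ vicinity δ Θ := ball_subset_vicinity hθ₀ hs
  have hsub2 : ball (toComplex θ₀) (s / 2) ⊆ ball (toComplex θ₀) s :=
    ball_subset_ball (by linarith)
  have hk0 := hker θ₀ hθ₀
  let g : (Fin n → T) → EuclideanSpace ℂ (Fin d) → ℂ := fun y η =>
    complexObsKernel μ (rhat η) n y x₀
  have hgan : ∀ y, AnalyticOnNhd ℂ (g y) (ball (toComplex θ₀) s) := fun y =>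
    hc.analyticOnNhd_complexObsKernel isOpen_ball hsub n y x₀
  have hgm : ∀ η ∈ ball (toComplex θ₀) s, Measurable fun y => g y η := fun η hη =>
    measurable_complexObsKernel_left (hc.rhat_measurable η (hsub hη)) n x₀
  have hglow : ∀ y, ∀ η ∈ ball (toComplex θ₀) s,
      ∏ j, (γ / 4 * ‖varphi η (y j)‖) ≤ ‖g y η‖ := fun y η hη =>
    hk0.le_norm_complexObsKernel (hc.isPerturbation hθ₀ hs hη) hb.measure_le (by positivity) hsτ
      n y x₀
  have hgup : ∀ y, ∀ η ∈ ball (toComplex θ₀) s, ‖g y η‖ ≤ ∏ j, (K * ‖varphi η (y j)‖) :=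
    fun y η hη => norm_complexObsKernel_le hb.measure_le (hc.norm_rhat_le η (hsub hη))
      (fun _ => norm_nonneg _) n y x₀
  have hv : ∀ η ∈ ball (toComplex θ₀) s, ∀ t, 0 < ‖varphi η t‖ := fun η hη t =>
    norm_pos_iff.2 (hc.varphi_ne_zero η (hsub hη) t)
  have hγ4 : 0 < γ / 4 := by have := hk0.γ_pos; positivity
  have hg0 : ∀ y, ∀ η ∈ ball (toComplex θ₀) s, g y η ≠ 0 := fun y η hη => norm_pos_iff.1
    ((Finset.prod_pos fun j _ => mul_pos hγ4 (hv η hη _)).trans_le (hglow y η hη))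
  have hglog : ∀ y, ∀ η ∈ ball (toComplex θ₀) s, |Real.log ‖g y η‖| ≤ ∑ j, (C + psi (y j)) := by
    intro y η hη
    refine abs_log_le_sum (fun j => mul_pos hγ4 (hv η hη _))
      (fun j => mul_pos hb.K_pos (hv η hη _)) (hglow y η hη) (hgup y η hη) (fun j => ?_)
      fun j => ?_
    · rw [Real.log_mul hγ4.ne' (hv η hη _).ne']
      exact (abs_add_le _ _).trans (add_le_add hγ (hc.abs_log_varphi_le η (hsub hη) _))
    · rw [Real.log_mul hb.K_pos.ne' (hv η hη _).ne']
      exact (abs_add_le _ _).trans (add_le_add hb.abs_log_K_le (hc.abs_log_varphi_le η (hsub hη) _))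
  have hgphi : ∀ y, ∀ η ∈ ball (toComplex θ₀) s, ‖g y η‖ ≤ ∏ j, (K * phi (y j)) :=
    fun y η hη => (hgup y η hη).trans (Finset.prod_le_prod
      (fun j _ => mul_nonneg hb.K_pos.le (norm_nonneg _)) fun j _ =>
      mul_le_mul_of_nonneg_left (hc.norm_varphi_le η (hsub hη) _) hb.K_pos.le)
  have hgreal : ∀ y, ∀ θ ∈ ball θ₀ s, g y (toComplex θ) = (obsKernel μ (r θ) n y x₀ : ℂ) := by
    intro y θ hθ
    rw [← complexObsKernel_ofReal (hker θ (hsΘ hθ))]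
    have : rhat (toComplex θ) = fun y x' x => (r θ y x' x : ℂ) := by
      ext y x' x; exact hc.rhat_eq θ (hsΘ hθ) y x' x
    simp only [g, this]
  have hW : ∀ y : Fin n → T, 0 < ∑ j, (C + psi (y j)) := fun y => by
    have : Nonempty (Fin n) := ⟨⟨0, hn⟩⟩
    exact Finset.sum_pos (fun j _ => add_pos_of_nonneg_of_pos hb.C_nonneg (hb.ψ_pos _))
      Finset.univ_nonempty
  -- branches of `log (g y)` that are real at `θ₀`; as limits of `segmentLog` they are measurable in
  -- `y`, and they agree with the real logarithm at all real parameters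
  choose Λ hΛan hΛexp hΛc hΛlim using fun y => exists_log_branch hs0 (hgan y) (hg0 y)
  have hΛre : ∀ y, ∀ η ∈ ball (toComplex θ₀) s, |(Λ y η).re| ≤ ∑ j, (C + psi (y j)) := by
    intro y η hη
    have h1 : (Λ y η).re = Real.log ‖g y η‖ := by
      rw [← hΛexp y η hη, Complex.norm_exp, Real.log_exp]
    rw [h1]
    exact hglog y η hη
  have hΛim : ∀ y, (Λ y (toComplex θ₀)).im = 0 := by
    intro y
    rw [hΛc, hgreal y θ₀ (mem_ball_self hs0), ← Complex.ofReal_log (hk0.obsKernel_pos n y x₀).le,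
      Complex.ofReal_im]
  have hΛb : ∀ y, ∀ η ∈ ball (toComplex θ₀) (s / 2), ‖Λ y η‖ ≤ 5 * ∑ j, (C + psi (y j)) :=
    fun y η hη => norm_log_branch_le (hW y) (hΛan y) (hΛre y) (hΛim y) hη
  have hΛm : ∀ η ∈ ball (toComplex θ₀) s, Measurable fun y => Λ y η := by
    intro η hη
    refine measurable_of_tendsto_metrizable
      (f := fun N y => segmentLog (g y) (toComplex θ₀) η N) (fun N => ?_)
      (tendsto_pi_nhds.2 fun y => hΛlim y η hη)
    refine Measurable.add (hgm _ (mem_ball_self hs0)).clog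
      (Finset.measurable_fun_sum _ fun j hj => ?_)
    rw [Finset.mem_range] at hj
    have hN0 : (0 : ℝ) < N := by exact_mod_cast (by omega : 0 < N)
    refine Measurable.clog (Measurable.div (hgm _ ?_) (hgm _ ?_))
    · exact segment_mem_ball hη (by positivity) ((div_le_one hN0).2 (by exact_mod_cast hj))
    · exact segment_mem_ball hη (by positivity) ((div_le_one hN0).2 (by exact_mod_cast hj.le))
  have hΛreal : ∀ y, ∀ θ ∈ ball θ₀ s,
      Λ y (toComplex θ) = (Real.log (obsKernel μ (r θ) n y x₀) : ℂ) := by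
    intro y θ hθ
    have hpos := (hker θ (hsΘ hθ)).obsKernel_pos n y x₀
    rw [Complex.ofReal_log hpos.le, ← hgreal y θ hθ]
    refine tendsto_nhds_unique (hΛlim y _ (toComplex_mem_ball.2 hθ)) ?_
    refine tendsto_const_nhds.congr' ?_
    filter_upwards [eventually_ne_atTop 0] with N hN
    refine (segmentLog_eq_of_pos (fun t ht0 ht1 => ?_) hN).symm
    have h1 : toComplex θ₀ + t • (toComplex θ - toComplex θ₀) = toComplex (θ₀ + t • (θ - θ₀)) := by
      rw [toComplex_add, ← toComplex_sub]
      congr 1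
      exact ((toComplexL d).map_smul t _).symm
    have h2 : θ₀ + t • (θ - θ₀) ∈ ball θ₀ s := segment_mem_ball hθ ht0 ht1
    rw [h1, hgreal y _ h2]
    exact ⟨_, (hker _ (hsΘ h2)).obsKernel_pos n y x₀, rfl⟩
  have hbnd := hb.integrable_logBound_and_le n
  have hle : ∀ η ∈ ball (toComplex θ₀) (s / 2), ∀ y,
      ‖g y η * Λ y η‖ ≤ 5 * logBound K C phi psi n y := by
    intro η hη y
    rw [norm_mul, logBound]
    calc _ ≤ (∏ j, K * phi (y j)) * (5 * ∑ j, (C + psi (y j))) :=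
          mul_le_mul (hgphi y η (hsub2 hη)) (hΛb y η hη) (norm_nonneg _)
            (Finset.prod_nonneg fun j _ => (mul_pos hb.K_pos (hb.φ_pos _)).le)
      _ = _ := by ring
  refine ⟨fun η => ∫ y, g y η * Λ y η ∂(Measure.pi fun _ => ν), ?_, fun η hη => ?_, fun θ hθ => ?_⟩
  · refine analyticOnNhd_integral isOpen_ball (hbnd.1.const_mul 5) (fun η hη => ?_) hle fun y => ?_
    · exact ((hgm η (hsub2 hη)).mul (hΛm η (hsub2 hη))).aestronglyMeasurable
    · exact ((hgan y).mono hsub2).mul ((hΛan y).mono hsub2)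
  · refine (norm_integral_le_of_norm_le (hbnd.1.const_mul 5)
      (Eventually.of_forall (hle η hη))).trans ?_
    rw [integral_const_mul]
    exact mul_le_mul_of_nonneg_left hbnd.2 (by norm_num)
  · have hθs : θ ∈ ball θ₀ s := ball_subset_ball (by linarith) hθ
    have h := hker θ (hsΘ hθs)
    have hmeas : Measurable fun y : Fin n → T => condObsDensity μ (r θ) n y x₀ :=
      (measurable_condObsDensity h.measurable n).comp (by fun_prop : Measurable fun y => (y, x₀))
    rw [h.pathKernel_eq, integral_withDensity_eq_integral_toReal_smul hmeas
      (Eventually.of_forall fun y => (h.condObsDensity_ne_top n y x₀).lt_top),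
      ← integral_complex_ofReal]
    refine integral_congr_ae (Eventually.of_forall fun y => ?_)
    change g y (toComplex θ) * Λ y (toComplex θ) =
      (((condObsDensity μ (r θ) n y x₀).toReal • Real.log (obsKernel μ (r θ) n y x₀) : ℝ) : ℂ)
    rw [hgreal y θ hθs, hΛreal y θ hθs, smul_eq_mul, Complex.ofReal_mul]
    rfl
end
end HMMEntropy

/-! ### Analyticity of the limit -/

namespace HMMEntropy
open Metric

section
variable {d : ℕ} {S T : Type*} [MeasurableSpace S] [MeasurableSpace T]
  {Θ : Set (EuclideanSpace ℝ (Fin d))} {μ : Measure S} {ν : Measure T}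
  {r : EuclideanSpace ℝ (Fin d) → T → S → S → ℝ} {δ : ℝ}
  {rhat : EuclideanSpace ℂ (Fin d) → T → S → S → ℂ}
  {varphi : EuclideanSpace ℂ (Fin d) → T → ℂ} {phi psi : T → ℝ}

/-- A sequence of functions of a real parameter with geometrically decaying increments, whose
members extend holomorphically to a fixed complex neighbourhood with at most geometric growth, has
a real-analytic limit. -/
theorem analyticAt_of_tendsto_of_geometric {a : ℕ → EuclideanSpace ℝ (Fin d) → ℝ}
    {L : EuclideanSpace ℝ (Fin d) → ℝ} {θ₀ : EuclideanSpace ℝ (Fin d)} {s ρ C B : ℝ} (hs : 0 < s)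
    (hρ : 0 < ρ) (hρ1 : ρ < 1) (hC : 0 < C) (hB : 0 < B)
    (hL : ∀ θ ∈ ball θ₀ s, Tendsto (fun n => a n θ) atTop (𝓝 (L θ)))
    (ha : ∀ θ ∈ ball θ₀ s, ∀ n, |a (n + 1) θ - a n θ| ≤ C * ρ ^ n)
    {F : ℕ → EuclideanSpace ℂ (Fin d) → ℂ}
    (hF : ∀ n, AnalyticOnNhd ℂ (F n) (ball (toComplex θ₀) s))
    (hFB : ∀ n, ∀ η ∈ ball (toComplex θ₀) s, ‖F (n + 1) η - F n η‖ ≤ C * B ^ n)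
    (hFa : ∀ n, ∀ θ ∈ ball θ₀ s, F n (toComplex θ) = a n θ) : AnalyticAt ℝ L θ₀ := by
  obtain ⟨s', hs', hss', ρ', hρ', hρ1', hgeo⟩ := exists_geometric_bound_of_real d hB hρ hρ1 hs
  have hinc : ∀ n, ∀ η ∈ ball (toComplex θ₀) s', dist (F n η) (F (n + 1) η) ≤ C * ρ' ^ n := by
    intro n η hη
    rw [dist_comm, dist_eq_norm]
    refine hgeo θ₀ C n (fun η => F (n + 1) η - F n η) hC ((hF _).sub (hF _)) (hFB n)
      (fun θ hθ => ?_) η hη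
    rw [hFa _ θ hθ, hFa _ θ hθ, ← Complex.ofReal_sub, Complex.norm_real]
    exact ha θ hθ n
  have hlim : ∀ η ∈ ball (toComplex θ₀) s', Tendsto (fun n => F n η) atTop
      (𝓝 (limUnder atTop fun n => F n η)) := fun η hη =>
    (cauchySeq_of_le_geometric ρ' C hρ1' fun n => hinc n η hη).tendsto_limUnder
  have hunif : TendstoUniformlyOn F (fun η => limUnder atTop fun n => F n η) atTop
      (ball (toComplex θ₀) s') := by
    rw [Metric.tendstoUniformlyOn_iff]
    intro ε hε
    have h0 : Tendsto (fun n => C * ρ' ^ n / (1 - ρ')) atTop (𝓝 0) := by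
      have := ((tendsto_pow_atTop_nhds_zero_of_lt_one hρ'.le hρ1').const_mul C).div_const (1 - ρ')
      simpa using this
    filter_upwards [h0.eventually_lt_const hε] with n hn η hη
    rw [dist_comm]
    exact (dist_le_of_le_geometric_of_tendsto ρ' C hρ1' (fun n => hinc n η hη) (hlim η hη) n
      ).trans_lt hn
  have hsub := ball_subset_ball (x := toComplex θ₀) hss'
  have han := analyticOnNhd_of_tendstoUniformlyOn isOpen_ball (fun n => (hF n).mono hsub) hunif
    (toComplex θ₀) (mem_ball_self hs')
  have h1 := (Complex.reCLM.analyticAt _).comp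
    ((han.restrictScalars (𝕜 := ℝ)).comp ((toComplexL d).analyticAt θ₀))
  refine h1.congr ?_
  filter_upwards [ball_mem_nhds θ₀ hs'] with θ hθ
  have hθs := ball_subset_ball hss' hθ
  have h2 := hlim _ (toComplex_mem_ball.2 hθ)
  simp only [hFa _ θ hθs] at h2
  have h3 := tendsto_nhds_unique h2 ((Complex.continuous_ofReal.tendsto _).comp (hL θ hθs))
  simp only [Function.comp, hFa _ θ hθs, h3]
  simp

/-- The mean log-likelihood increments converge to a real-analytic function. -/
theorem exists_analytic_limit [IsFiniteMeasure μ] [SigmaFinite ν] (hΘ : IsOpen Θ)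
    (hc : IsAnalyticContinuation Θ ν r δ rhat varphi phi psi) {e γ K C : ℝ}
    (hker : ∀ θ ∈ Θ, IsMixingKernel μ ν (r θ) e γ fun y => ‖varphi (toComplex θ) y‖)
    (hb : IsLogBound μ ν γ K C phi psi) (hγ : |Real.log (γ / 4)| ≤ C) (x₀ : S) :
    ∃ L : EuclideanSpace ℝ (Fin d) → ℝ, AnalyticOnNhd ℝ L Θ ∧
      ∀ θ ∈ Θ, Tendsto (fun n => meanLogIncrement μ ν (r θ) x₀ n x₀) atTop (𝓝 (L θ)) := by
  have hsubv : ∀ θ ∈ Θ, toComplex θ ∈ vicinity δ Θ := fun θ hθ =>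
    ball_subset_vicinity hθ le_rfl (mem_ball_self hc.delta_pos)
  have hinc : ∀ θ ∈ Θ, ∀ n, |meanLogIncrement μ ν (r θ) x₀ (n + 1) x₀ -
      meanLogIncrement μ ν (r θ) x₀ n x₀| ≤
        (2 * logBoundRate ν K C phi psi + 4 / e ^ 3 + 1 / e ^ 2) * (1 - e ^ 2 / 2) ^ n :=
    fun θ hθ n => (hker θ hθ).abs_meanLogIncrement_succ_sub_le hb
      (hc.norm_varphi_le _ (hsubv θ hθ)) (hc.abs_log_varphi_le _ (hsubv θ hθ)) x₀ n x₀ x₀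
  refine ⟨fun θ => limUnder atTop fun n => meanLogIncrement μ ν (r θ) x₀ n x₀, ?_, ?_⟩
  swap
  · intro θ hθ
    have he := (hker θ hθ).e_pos
    refine (cauchySeq_of_le_geometric (1 - e ^ 2 / 2)
      (2 * logBoundRate ν K C phi psi + 4 / e ^ 3 + 1 / e ^ 2) (by nlinarith) fun n => ?_
      ).tendsto_limUnder
    rw [dist_comm]
    exact hinc θ hθ n
  · intro θ₀ hθ₀
    have he := (hker θ₀ hθ₀).e_pos
    have he1 := (hker θ₀ hθ₀).e_lt_one
    have hγ0 := (hker θ₀ hθ₀).γ_pos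
    have hδ := hc.delta_pos
    have hK := hb.K_pos
    have hA := hb.logBoundRate_nonneg
    set A := logBoundRate ν K C phi psi with hAdef
    obtain ⟨s₁, hs₁, hs₁Θ⟩ := Metric.isOpen_iff.1 hΘ θ₀ hθ₀
    -- a radius small enough for the perturbation bound
    let s₂ : ℝ := e ^ 4 / 16 * δ / (2 * (K / (γ * e ^ 2)))
    have hs₂ : 0 < s₂ := by positivity
    let s : ℝ := min s₁ (min δ s₂)
    have hs : 0 < s := lt_min hs₁ (lt_min hδ hs₂)
    have hsδ : s ≤ δ := (min_le_right _ _).trans (min_le_left _ _)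
    have hss₂ : s ≤ s₂ := (min_le_right _ _).trans (min_le_right _ _)
    have hsΘ : ball θ₀ s ⊆ Θ := (ball_subset_ball (min_le_left _ _)).trans hs₁Θ
    have hsτ : 2 * s / δ * (K / (γ * e ^ 2)) ≤ e ^ 4 / 16 := by
      have h1 : s * (2 * (K / (γ * e ^ 2))) ≤ e ^ 4 / 16 * δ :=
        (le_div_iff₀ (by positivity)).1 hss₂
      rw [div_mul_eq_mul_div, div_le_iff₀ hδ]
      linarith
    choose H hHan hHb hHr using
      fun n : ℕ => exists_analytic_mean_log (n := n) hc hker hb hγ hs hsδ hsΘ hsτ x₀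
    have hHb' : ∀ n, ∀ η ∈ ball (toComplex θ₀) (s / 2), ‖H n η‖ ≤ 5 * (2 * (A + 1)) ^ n := by
      intro n η hη
      refine (hHb n η hη).trans ?_
      rw [mul_pow]
      have h1 : (n : ℝ) ≤ 2 ^ n := by exact_mod_cast Nat.lt_two_pow_self.le
      have h2 : A ^ n ≤ (A + 1) ^ n := pow_le_pow_left₀ hA (by linarith) n
      gcongr
    set B := 2 * (A + 1) with hBdef
    have hB : 0 < B := by positivity
    have hsub : ball θ₀ (s / 2) ⊆ Θ := (ball_subset_ball (by linarith)).trans hsΘ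
    refine analyticAt_of_tendsto_of_geometric
      (a := fun n θ => meanLogIncrement μ ν (r θ) x₀ n x₀) (half_pos hs)
      (ρ := 1 - e ^ 2 / 2) (B := B)
      (C := (2 * A + 4 / e ^ 3 + 1 / e ^ 2) + 5 * (B + 1) ^ 2) (by nlinarith) (by nlinarith)
      (by positivity) hB (fun θ hθ => ?_) (fun θ hθ n => ?_) (F := fun n η => H (n + 1) η - H n η)
      (fun n => (hHan _).sub (hHan _)) (fun n η hη => ?_) fun n θ hθ => ?_
    · refine (cauchySeq_of_le_geometric (1 - e ^ 2 / 2)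
        (2 * A + 4 / e ^ 3 + 1 / e ^ 2) (by nlinarith) fun n => ?_
        ).tendsto_limUnder
      rw [dist_comm]
      exact hinc θ (hsub hθ) n
    · refine (hinc θ (hsub hθ) n).trans ?_
      have : 0 ≤ (1 - e ^ 2 / 2) ^ n := pow_nonneg (by nlinarith) n
      have : 0 ≤ 5 * (B + 1) ^ 2 := by positivity
      refine mul_le_mul_of_nonneg_right ?_ ‹_›
      linarith
    · have h0 := hHb' n η hη
      have h1 := hHb' (n + 1) η hη
      have h2 := hHb' (n + 2) η hη
      have h3 : H (n + 1 + 1) η - H (n + 1) η - (H (n + 1) η - H n η) =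
          (H (n + 2) η - H (n + 1) η) - (H (n + 1) η - H n η) := rfl
      rw [h3]
      calc _ ≤ (‖H (n + 2) η‖ + ‖H (n + 1) η‖) + (‖H (n + 1) η‖ + ‖H n η‖) :=
            (norm_sub_le _ _).trans (add_le_add (norm_sub_le _ _) (norm_sub_le _ _))
        _ ≤ 5 * B ^ (n + 2) + 5 * B ^ (n + 1) + (5 * B ^ (n + 1) + 5 * B ^ n) := by gcongr
        _ = 5 * (B + 1) ^ 2 * B ^ n := by ring
        _ ≤ _ := by
          have : 0 ≤ 2 * A + 4 / e ^ 3 + 1 / e ^ 2 := by positivity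
          gcongr
          linarith
    · have h := hker θ (hsub hθ)
      have hφ := hc.norm_varphi_le _ (hsubv θ (hsub hθ))
      have hψ := hc.abs_log_varphi_le _ (hsubv θ (hsub hθ))
      rw [hHr _ θ hθ, hHr _ θ hθ, h.integral_log_obsKernel hb hφ hψ,
        h.integral_log_obsKernel hb hφ hψ, Finset.sum_range_succ]
      push_cast; ring
end
end HMMEntropy

/-! ### The law of the hidden Markov model -/

namespace HMMEntropy
open scoped ENNReal

namespace IsHMM
variable {S T Ω : Type*} [MeasurableSpace S] [MeasurableSpace T] [MeasurableSpace Ω]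
  {P : Measure Ω} [IsProbabilityMeasure P] {μ : Measure S} [IsFiniteMeasure μ] {ν : Measure T}
  [SigmaFinite ν] {p : S → S → ℝ} {q : T → S → ℝ} {lam : Measure S} {X : ℕ → Ω → S}
  {Y : ℕ → Ω → T} (hX : IsHMM P μ ν p q lam X Y)
include hX

omit [IsProbabilityMeasure P] [IsFiniteMeasure μ] [SigmaFinite ν] in
/-- The initial state has the prescribed law. -/
theorem map_zero (hq : ∀ x, ∫⁻ y, ENNReal.ofReal (q y x) ∂ν = 1) : P.map (X 0) = lam := by
  refine Measure.ext fun A hA => ?_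
  rw [Measure.map_apply (hX.measurable_X 0) hA]
  have h := hX.initial (A ×ˢ Set.univ) (hA.prod MeasurableSet.univ)
  simp only [Set.mem_prod, Set.mem_univ, and_true] at h
  have h2 : ∀ x, ∫⁻ y, (A ×ˢ (Set.univ : Set T)).indicator
      (fun z : S × T => ENNReal.ofReal (q z.2 z.1)) (x, y) ∂ν = A.indicator 1 x := by
    intro x
    by_cases hx : x ∈ A
    · simp [hx, hq]
    · simp [hx]
  simp only [h2] at h
  rw [lintegral_indicator_one hA] at h
  exact h

section
variable {e γ : ℝ} {m : T → ℝ} (h : IsMixingKernel μ ν (fun y x' x => q y x' * p x' x) e γ m)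
include h

/-- Given the history up to time `n`, the pair `(Y_{n+1}, X_{n+1})` has the law given by the
transition kernel at `X_n`. -/
theorem lintegral_history_step (n : ℕ) {F : (Fin (n + 1) → S × T) × (T × S) → ℝ≥0∞}
    (hF : Measurable F) :
    ∫⁻ ω, F (fun k => (X k ω, Y k ω), (Y (n + 1) ω, X (n + 1) ω)) ∂P =
      ∫⁻ ω, ∫⁻ w, F (fun k => (X k ω, Y k ω), w)
        ∂stepKernel μ ν (fun y x' x => q y x' * p x' x) (X n ω) ∂P := by
  have := h.isMarkovKernel_stepKernel
  set κ := stepKernel μ ν fun y x' x => q y x' * p x' x with hκ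
  let Z : Ω → Fin (n + 1) → S × T := fun ω k => (X k ω, Y k ω)
  have hmX := hX.measurable_X
  have hmY := hX.measurable_Y
  have hZ : Measurable Z := measurable_pi_iff.2 fun k => (hmX k).prodMk (hmY k)
  have hW : Measurable fun ω => (Y (n + 1) ω, X (n + 1) ω) := (hmY _).prodMk (hmX _)
  have hlast : Measurable fun z : Fin (n + 1) → S × T => (z (Fin.last n)).1 := by fun_prop
  have hmap : P.map (fun ω => (Z ω, (Y (n + 1) ω, X (n + 1) ω))) =
      P.map Z ⊗ₘ κ.comap _ hlast := by
    have := Measure.isProbabilityMeasure_map (μ := P) (hZ.prodMk hW).aemeasurable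
    refine Measure.ext_prod fun {A} {B} hA hB => ?_
    rw [Measure.map_apply (hZ.prodMk hW) (hA.prod hB), Measure.compProd_apply_prod hA hB,
      setLIntegral_map hA (Kernel.measurable_coe _ hB) hZ]
    have hB' : MeasurableSet {ω | (Y (n + 1) ω, X (n + 1) ω) ∈ B} := hW hB
    have htr := hX.transition n (Prod.swap ⁻¹' B) (measurable_swap hB)
    have hle : MeasurableSpace.comap Z inferInstance ≤ (inferInstance : MeasurableSpace Ω) :=
      hZ.comap_le
    have hint := setIntegral_condExp hle (μ := P) (s := Z ⁻¹' A)
      (f := {ω | (Y (n + 1) ω, X (n + 1) ω) ∈ B}.indicator fun _ => (1 : ℝ))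
      ((integrable_const _).indicator hB') ⟨A, hA, rfl⟩
    have hstep : ∀ x, (∫⁻ x', ∫⁻ y, (Prod.swap ⁻¹' B).indicator
        (fun z => ENNReal.ofReal (q z.2 z.1 * p z.1 x)) (x', y) ∂ν ∂μ) = κ x B := by
      intro x
      have h1 : Measurable fun z : T × S => ENNReal.ofReal (q z.1 z.2 * p z.2 x) :=
        (h.measurable.comp (by fun_prop : Measurable fun z : T × S => (z.1, z.2, x))).ennreal_ofReal
      rw [← lintegral_indicator_one hB, h.lintegral_stepKernel x (measurable_one.indicator hB),
        lintegral_lintegral_swap]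
      · refine lintegral_congr fun y => lintegral_congr fun x' => ?_
        by_cases hyx : (y, x') ∈ B <;> simp [hyx]
      · exact ((h1.indicator hB).comp measurable_swap).aemeasurable
    have h1 : ∫ ω in Z ⁻¹' A, (κ (X n ω) B).toReal ∂P =
        ∫ ω in Z ⁻¹' A, {ω | (Y (n + 1) ω, X (n + 1) ω) ∈ B}.indicator (fun _ => (1 : ℝ)) ω ∂P := by
      rw [← hint]
      refine integral_congr_ae (ae_restrict_of_ae ?_)
      filter_upwards [htr] with ω hω
      rw [← hstep]
      exact hω.symm
    rw [integral_indicator hB', integral_const, smul_eq_mul, mul_one,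
      integral_toReal (f := fun ω => κ (X n ω) B) ((κ.measurable_coe hB).comp (hmX n)).aemeasurable
        (Eventually.of_forall fun ω => measure_lt_top _ _), measureReal_def,
      Measure.restrict_apply_univ, Measure.restrict_apply hB'] at h1
    have h2 := (ENNReal.toReal_eq_toReal_iff' ?_ (measure_ne_top _ _)).1 h1
    · rw [Set.inter_comm] at h2
      exact h2.symm
    · refine ((lintegral_mono fun ω => prob_le_one).trans_lt ?_).ne
      simp
  calc _ = ∫⁻ z, F z ∂(P.map fun ω => (Z ω, (Y (n + 1) ω, X (n + 1) ω))) :=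
        (lintegral_map hF (hZ.prodMk hW)).symm
    _ = ∫⁻ z, ∫⁻ w, F (z, w) ∂(κ.comap _ hlast) z ∂(P.map Z) := by
        rw [hmap, Measure.lintegral_compProd hF]
    _ = _ := by
        rw [lintegral_map hF.lintegral_kernel_prod_right' hZ]
        rfl

/-- Given the history up to time `j`, the next `n` observations have the law given by the path
kernel at `X_j`. -/
theorem lintegral_history_path (n j : ℕ) {G : (Fin (j + 1) → S × T) × (Fin n → T) → ℝ≥0∞}
    (hG : Measurable G) :
    ∫⁻ ω, G (fun k => (X k ω, Y k ω), fun k => Y (j + 1 + k) ω) ∂P =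
      ∫⁻ ω, ∫⁻ y, G (fun k => (X k ω, Y k ω), y)
        ∂pathKernel μ ν (fun y x' x => q y x' * p x' x) n (X j ω) ∂P := by
  have := h.isMarkovKernel_pathKernel n
  induction n generalizing j with
  | zero =>
    refine lintegral_congr fun ω => ?_
    have : ∀ y : Fin 0 → T, G (fun k => (X k ω, Y k ω), y) =
        G (fun k => (X k ω, Y k ω), fun k => Y (j + 1 + k) ω) := fun y => by
      congr 2; exact Subsingleton.elim _ _
    simp [this]
  | succ n ih =>
    have := h.isMarkovKernel_pathKernel n
    have hcons := measurable_finCons T n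
    -- `Y_{j+1}` is part of the history up to time `j + 1`
    let G' : (Fin (j + 1 + 1) → S × T) × (Fin n → T) → ℝ≥0∞ := fun z =>
      G (fun k => z.1 k.castSucc, Fin.cons (z.1 (Fin.last _)).2 z.2)
    have hG' : Measurable G' := hG.comp (Measurable.prodMk (by fun_prop)
      (hcons.comp (by fun_prop : Measurable fun z : (Fin (j + 1 + 1) → S × T) × (Fin n → T) =>
        ((z.1 (Fin.last _)).2, z.2))))
    let G₁ : (Fin (j + 1) → S × T) × (T × S) → ℝ≥0∞ := fun z =>
      ∫⁻ y, G (z.1, Fin.cons z.2.1 y) ∂pathKernel μ ν (fun y x' x => q y x' * p x' x) n z.2.2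
    have hG₁ : Measurable G₁ := by
      have hk : Measurable fun z : (Fin (j + 1) → S × T) × (T × S) => z.2.2 := by fun_prop
      refine Measurable.lintegral_kernel_prod_right'
        (κ := (pathKernel μ ν (fun y x' x => q y x' * p x' x) n).comap _ hk)
        (f := fun z : ((Fin (j + 1) → S × T) × (T × S)) × (Fin n → T) =>
          G (z.1.1, Fin.cons z.1.2.1 z.2)) ?_
      exact hG.comp (Measurable.prodMk (by fun_prop) (hcons.comp (by fun_prop :
        Measurable fun z : ((Fin (j + 1) → S × T) × (T × S)) × (Fin n → T) => (z.1.2.1, z.2))))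
    have hfn : ∀ ω, (fun k : Fin (n + 1) => Y (j + 1 + k) ω) =
        Fin.cons (Y (j + 1) ω) fun k : Fin n => Y (j + 1 + 1 + k) ω := by
      intro ω
      refine funext fun k => Fin.cases rfl (fun i => ?_) k
      simp only [Fin.cons_succ, Fin.val_succ]
      congr 1; omega
    calc _ = ∫⁻ ω, G' (fun k => (X k ω, Y k ω), fun k => Y (j + 1 + 1 + k) ω) ∂P := by
          refine lintegral_congr fun ω => ?_
          rw [hfn]; rfl
      _ = ∫⁻ ω, G₁ (fun k => (X k ω, Y k ω), (Y (j + 1) ω, X (j + 1) ω)) ∂P := ih (j + 1) hG' this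
      _ = _ := by
          rw [hX.lintegral_history_step h j hG₁]
          refine lintegral_congr fun ω => ?_
          exact (h.lintegral_pathKernel_succ n (X j ω)
            (hG.comp (Measurable.prodMk measurable_const measurable_id))).symm

/-- The law of `Y_1, …, Y_n` is the mixture over the initial state of the path kernel. -/
theorem map_observations (hq : ∀ x, ∫⁻ y, ENNReal.ofReal (q y x) ∂ν = 1) (n : ℕ) :
    P.map (fun ω (k : Fin n) => Y (k + 1) ω) =
      lam.bind (pathKernel μ ν (fun y x' x => q y x' * p x' x) n) := by
  have hm : Measurable fun ω (k : Fin n) => Y (k + 1) ω :=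
    measurable_pi_iff.2 fun k => hX.measurable_Y _
  refine Measure.ext fun B hB => ?_
  rw [Measure.map_apply hm hB, Measure.bind_apply hB (Kernel.measurable _).aemeasurable,
    ← hX.map_zero hq, lintegral_map (Kernel.measurable_coe _ hB) (hX.measurable_X 0),
    ← lintegral_indicator_one (hm hB)]
  have h1 := hX.lintegral_history_path h n 0 (G := fun z => B.indicator 1 z.2)
    ((measurable_one.indicator hB).comp measurable_snd)
  simp only [lintegral_indicator_one hB] at h1
  rw [← h1]
  refine lintegral_congr fun ω => ?_
  have : (fun k : Fin n => Y (0 + 1 + k) ω) = fun k : Fin n => Y (k + 1) ω :=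
    funext fun k => by rw [zero_add, add_comm]
  rw [this]
  rfl

end
end IsHMM
end HMMEntropy

/-! ### Entropy for an arbitrary initial distribution -/

namespace HMMEntropy
open scoped ENNReal

namespace IsMixingKernel
variable {S T : Type*} [MeasurableSpace S] [MeasurableSpace T] {μ : Measure S} [IsFiniteMeasure μ]
  {ν : Measure T} {r : T → S → S → ℝ} {e γ : ℝ} {m : T → ℝ} (h : IsMixingKernel μ ν r e γ m)
include h

/-- By mixing, the choice of the initial law changes the log-likelihood by at most `-log e`. -/
theorem abs_log_obsDensity_sub_le (lam : Measure S) [IsProbabilityMeasure lam] (n : ℕ)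
    (y : Fin n → T) (x₀ : S) :
    |Real.log (obsDensity μ r lam n y) - Real.log (obsKernel μ r n y x₀)| ≤ -Real.log e := by
  have hpos := h.obsKernel_pos n y x₀
  have he := h.e_pos
  have heq : obsDensity μ r lam n y = ∫ x, obsKernel μ r n y x ∂lam :=
    (integral_toReal ((measurable_condObsDensity h.measurable n).comp
      (by fun_prop : Measurable fun x => (y, x))).aemeasurable
      (Eventually.of_forall fun x => (h.condObsDensity_ne_top n y x).lt_top)).symm
  have hup : ∀ x, obsKernel μ r n y x ≤ obsKernel μ r n y x₀ / e := fun x =>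
    (le_div_iff₀' he).2 (h.mul_obsKernel_le n y x x₀)
  have hint : Integrable (obsKernel μ r n y) lam :=
    Integrable.of_bound (h.measurable_obsKernel_right n y).aestronglyMeasurable _
      (Eventually.of_forall fun x => by
        rw [Real.norm_eq_abs, abs_of_nonneg (obsKernel_nonneg _ _ _)]; exact hup x)
  have h1 : e * obsKernel μ r n y x₀ ≤ obsDensity μ r lam n y := by
    rw [heq]
    calc _ = ∫ _, e * obsKernel μ r n y x₀ ∂lam := by simp
      _ ≤ _ := integral_mono (integrable_const _) hint fun x => h.mul_obsKernel_le n y x₀ x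
  have h2 : obsDensity μ r lam n y ≤ obsKernel μ r n y x₀ / e := by
    rw [heq]
    calc _ ≤ ∫ _, obsKernel μ r n y x₀ / e ∂lam := integral_mono hint (integrable_const _) hup
      _ = _ := by simp
  have h3 := Real.log_le_log (by positivity) h1
  have h4 := Real.log_le_log ((by positivity : 0 < e * obsKernel μ r n y x₀).trans_le h1) h2
  rw [Real.log_mul he.ne' hpos.ne'] at h3
  rw [Real.log_div hpos.ne' he.ne'] at h4
  rw [abs_le]
  constructor <;> linarith

theorem measurable_obsDensity (lam : Measure S) [SFinite lam] (n : ℕ) :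
    Measurable (obsDensity μ r lam n) :=
  ((measurable_condObsDensity h.measurable n).lintegral_prod_right').ennreal_toReal

variable {K C : ℝ} {φ ψ : T → ℝ} (hb : IsLogBound μ ν γ K C φ ψ) (hmφ : ∀ y, m y ≤ φ y)
  (hmψ : ∀ y, |Real.log (m y)| ≤ ψ y) [SigmaFinite ν]
include hb hmφ hmψ

theorem integrable_log_obsKernel_bind (lam : Measure S) [IsProbabilityMeasure lam] (n : ℕ)
    (x₀ : S) : Integrable (fun y => Real.log (obsKernel μ r n y x₀))
      (lam.bind (pathKernel μ ν r n)) := by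
  have := h.isMarkovKernel_pathKernel n
  have hm : Measurable fun y => Real.log (obsKernel μ r n y x₀) :=
    (h.measurable_obsKernel_left n x₀).log
  rw [Measure.integrable_comp_iff hm.aestronglyMeasurable]
  refine ⟨Eventually.of_forall fun x => h.integrable_log_obsKernel hb hmφ hmψ n x₀ x, ?_⟩
  refine Integrable.of_bound (C := n * logBoundRate ν K C φ ψ ^ n)
    (StronglyMeasurable.integral_kernel hm.norm.stronglyMeasurable).aestronglyMeasurable
    (Eventually.of_forall fun x => ?_)
  refine (h.integrable_pathKernel hb hmφ n x hm.norm fun y => ?_).2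
  rw [abs_norm]
  exact h.abs_log_obsKernel_le hb hmψ n y x₀

/-- The log-likelihood is integrable under the law of the observations. -/
theorem integrable_log_obsDensity (lam : Measure S) [IsProbabilityMeasure lam] (n : ℕ) :
    Integrable (fun y => Real.log (obsDensity μ r lam n y)) (lam.bind (pathKernel μ ν r n)) := by
  have := h.isMarkovKernel_pathKernel n
  obtain ⟨x₀⟩ := lam.nonempty_of_neZero
  have h1 := h.integrable_log_obsKernel_bind hb hmφ hmψ lam n x₀
  have h2 : Integrable (fun y => Real.log (obsDensity μ r lam n y) -
      Real.log (obsKernel μ r n y x₀)) (lam.bind (pathKernel μ ν r n)) :=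
    Integrable.of_bound ((h.measurable_obsDensity lam n).log.sub
      (h.measurable_obsKernel_left n x₀).log).aestronglyMeasurable (-Real.log e)
      (Eventually.of_forall fun y => h.abs_log_obsDensity_sub_le lam n y x₀)
  exact (h2.add h1).congr (Eventually.of_forall fun y => sub_add_cancel _ _)

/-- The mean log-likelihood equals, up to a bounded error, the sum of the mean increments at a
fixed state. -/
theorem abs_integral_log_obsDensity_sub_sum_le (lam : Measure S) [IsProbabilityMeasure lam]
    (n : ℕ) (x₀ : S) :
    |∫ y, Real.log (obsDensity μ r lam n y) ∂lam.bind (pathKernel μ ν r n) -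
      ∑ k ∈ Finset.range n, meanLogIncrement μ ν r x₀ k x₀| ≤
        -Real.log e + (2 * logBoundRate ν K C φ ψ + 4 / e ^ 3) * (2 / e ^ 2) := by
  have := h.isMarkovKernel_pathKernel n
  have he := h.e_pos
  have he1 := h.e_lt_one
  have hA := hb.logBoundRate_nonneg
  set D := 2 * logBoundRate ν K C φ ψ + 4 / e ^ 3 with hD
  have hD0 : 0 ≤ D := by positivity
  have h1 := h.integrable_log_obsKernel_bind hb hmφ hmψ lam n x₀
  have h2 := h.integrable_log_obsDensity hb hmφ hmψ lam n
  have h3 : |∫ y, Real.log (obsDensity μ r lam n y) ∂lam.bind (pathKernel μ ν r n) -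
      ∫ y, Real.log (obsKernel μ r n y x₀) ∂lam.bind (pathKernel μ ν r n)| ≤ -Real.log e := by
    rw [← integral_sub h2 h1]
    have := norm_integral_le_of_norm_le_const (μ := lam.bind (pathKernel μ ν r n))
      (f := fun y => Real.log (obsDensity μ r lam n y) - Real.log (obsKernel μ r n y x₀))
      (Eventually.of_forall fun y => h.abs_log_obsDensity_sub_le lam n y x₀)
    simpa using this
  have hgeo : ∑ k ∈ Finset.range n, D * (1 - e ^ 2 / 2) ^ k ≤ D * (2 / e ^ 2) := by
    rw [← Finset.mul_sum]
    refine mul_le_mul_of_nonneg_left ?_ hD0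
    have h0 : (0 : ℝ) ≤ 1 - e ^ 2 / 2 := by nlinarith
    have h1 : 1 - e ^ 2 / 2 < 1 := by nlinarith
    refine ((summable_geometric_of_lt_one h0 h1).sum_le_tsum _ fun k _ => pow_nonneg h0 k).trans ?_
    rw [tsum_geometric_of_lt_one h0 h1, sub_sub_cancel, inv_div]
  have hsum : ∀ x, |∑ k ∈ Finset.range n, meanLogIncrement μ ν r x₀ k x -
      ∑ k ∈ Finset.range n, meanLogIncrement μ ν r x₀ k x₀| ≤ D * (2 / e ^ 2) := by
    intro x
    rw [← Finset.sum_sub_distrib]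
    exact ((Finset.abs_sum_le_sum_abs _ _).trans (Finset.sum_le_sum fun k _ =>
      h.abs_meanLogIncrement_sub_le hb hmφ hmψ x₀ k x x₀)).trans hgeo
  have h4 : |∫ y, Real.log (obsKernel μ r n y x₀) ∂lam.bind (pathKernel μ ν r n) -
      ∑ k ∈ Finset.range n, meanLogIncrement μ ν r x₀ k x₀| ≤ D * (2 / e ^ 2) := by
    have hmeas : StronglyMeasurable fun x =>
        ∑ k ∈ Finset.range n, meanLogIncrement μ ν r x₀ k x :=
      Finset.stronglyMeasurable_fun_sum _ fun k _ => h.stronglyMeasurable_meanLogIncrement x₀ k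
    have hint : Integrable (fun x => ∑ k ∈ Finset.range n, meanLogIncrement μ ν r x₀ k x -
        ∑ k ∈ Finset.range n, meanLogIncrement μ ν r x₀ k x₀) lam :=
      Integrable.of_bound (hmeas.sub stronglyMeasurable_const).aestronglyMeasurable _
        (Eventually.of_forall hsum)
    have heq : ∫ y, Real.log (obsKernel μ r n y x₀) ∂lam.bind (pathKernel μ ν r n) -
        ∑ k ∈ Finset.range n, meanLogIncrement μ ν r x₀ k x₀ =
        ∫ x, (∑ k ∈ Finset.range n, meanLogIncrement μ ν r x₀ k x -
          ∑ k ∈ Finset.range n, meanLogIncrement μ ν r x₀ k x₀) ∂lam := by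
      rw [Measure.comp_eq_comp_const_apply] at h1 ⊢
      rw [Kernel.integral_comp h1, Kernel.const_apply, integral_sub ?_ (integrable_const _)]
      · simp [h.integral_log_obsKernel hb hmφ hmψ n x₀]
      · exact (hint.add (integrable_const _)).congr
          (Eventually.of_forall fun x => sub_add_cancel _ _)
    rw [heq]
    have := norm_integral_le_of_norm_le_const (μ := lam) (f := fun x =>
      ∑ k ∈ Finset.range n, meanLogIncrement μ ν r x₀ k x -
        ∑ k ∈ Finset.range n, meanLogIncrement μ ν r x₀ k x₀) (Eventually.of_forall hsum)
    simpa using this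
  exact (abs_sub_le _ _ _).trans (add_le_add h3 h4)

end IsMixingKernel

/-- If the mean increments converge to `L`, then the entropy per observation converges to `-L`. -/
theorem IsHMM.tendsto_entropy {S T Ω : Type*} [MeasurableSpace S] [MeasurableSpace T]
    [MeasurableSpace Ω] {P : Measure Ω} [IsProbabilityMeasure P] {μ : Measure S}
    [IsFiniteMeasure μ] {ν : Measure T} [SigmaFinite ν] {p : S → S → ℝ} {q : T → S → ℝ}
    {lam : Measure S} [IsProbabilityMeasure lam] {X : ℕ → Ω → S} {Y : ℕ → Ω → T}
    (hX : IsHMM P μ ν p q lam X Y) {e γ K C : ℝ} {m φ ψ : T → ℝ}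
    (h : IsMixingKernel μ ν (fun y x' x => q y x' * p x' x) e γ m)
    (hb : IsLogBound μ ν γ K C φ ψ) (hmφ : ∀ y, m y ≤ φ y) (hmψ : ∀ y, |Real.log (m y)| ≤ ψ y)
    (hq : ∀ x, ∫⁻ y, ENNReal.ofReal (q y x) ∂ν = 1) {x₀ : S} {L : ℝ}
    (hL : Tendsto (fun n => meanLogIncrement μ ν (fun y x' x => q y x' * p x' x) x₀ n x₀) atTop
      (𝓝 L)) :
    (∀ n : ℕ, Integrable (fun ω => Real.log (obsDensity μ (fun y x' x => q y x' * p x' x) lam n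
      fun k => Y (k + 1) ω)) P) ∧
    Tendsto (fun n => entropy P μ (fun y x' x => q y x' * p x' x) lam Y n) atTop (𝓝 (-L)) := by
  set r : T → S → S → ℝ := fun y x' x => q y x' * p x' x with hr
  have hm : ∀ n : ℕ, Measurable fun ω (k : Fin n) => Y (k + 1) ω := fun n =>
    measurable_pi_iff.2 fun k => hX.measurable_Y _
  have hlog : ∀ n, Measurable fun y => Real.log (obsDensity μ r lam n y) := fun n =>
    (h.measurable_obsDensity lam n).log
  refine ⟨fun n => ?_, ?_⟩
  · have h1 := h.integrable_log_obsDensity hb hmφ hmψ lam n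
    rw [← hX.map_observations h hq n] at h1
    exact h1.comp_measurable (hm n)
  set I : ℕ → ℝ := fun n => ∫ y, Real.log (obsDensity μ r lam n y) ∂lam.bind (pathKernel μ ν r n)
  have hent : ∀ n, entropy P μ r lam Y n = -((n : ℝ)⁻¹ * I n) := by
    intro n
    rw [entropy, integral_const_mul, one_div]
    simp only [I]
    rw [← hX.map_observations h hq n,
      integral_map (hm n).aemeasurable (hlog n).aestronglyMeasurable]
  simp only [hent]
  refine Tendsto.neg ?_
  have hces := hL.cesaro
  -- the bounded error disappears after division by `n`, and the Cesàro means converge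
  have hdiff : Tendsto (fun n : ℕ => (n : ℝ)⁻¹ * (I n -
      ∑ k ∈ Finset.range n, meanLogIncrement μ ν r x₀ k x₀)) atTop (𝓝 0) :=
    tendsto_inv_atTop_nhds_zero_nat.zero_mul_isBoundedUnder_le
      (isBoundedUnder_of ⟨_, fun n => h.abs_integral_log_obsDensity_sub_sum_le hb hmφ hmψ lam n x₀⟩)
  have := hdiff.add hces
  rw [zero_add] at this
  refine this.congr fun n => ?_
  ring
end HMMEntropy

/-! ### From the hypotheses on the densities to a mixing kernel -/

namespace HMMEntropy
open scoped ENNReal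

/-- A measure with a positive integrable function is `σ`-finite. -/
theorem sigmaFinite_of_integrable_of_pos {T : Type*} [MeasurableSpace T] {ν : Measure T}
    {φ : T → ℝ} (hφ : Integrable φ ν) (hpos : ∀ y, 0 < φ y) : SigmaFinite ν := by
  refine ⟨⟨⟨fun n : ℕ => {y | 1 / ((n : ℝ) + 1) ≤ φ y}, fun _ => trivial, fun n => ?_, ?_⟩⟩⟩
  · exact hφ.measure_ge_lt_top (by positivity)
  · refine Set.eq_univ_of_forall fun y => Set.mem_iUnion.2 ?_
    obtain ⟨n, hn⟩ := exists_nat_one_div_lt (hpos y)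
    exact ⟨n, hn.le⟩

theorem toComplex_mem_vicinity {d : ℕ} {δ : ℝ} (hδ : 0 < δ) {Θ : Set (EuclideanSpace ℝ (Fin d))}
    {θ : EuclideanSpace ℝ (Fin d)} (hθ : θ ∈ Θ) : toComplex θ ∈ vicinity δ Θ :=
  ⟨θ, hθ, by simpa using hδ⟩

section
variable {d : ℕ} {S T : Type*} [MeasurableSpace S] [MeasurableSpace T]
  {Θ : Set (EuclideanSpace ℝ (Fin d))} {μ : Measure S} {ν : Measure T}
  {p : EuclideanSpace ℝ (Fin d) → S → S → ℝ} {q : EuclideanSpace ℝ (Fin d) → T → S → ℝ}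

theorem IsDensityFamily.measurable_jointDensity (hpq : IsDensityFamily Θ μ ν p q)
    {θ : EuclideanSpace ℝ (Fin d)} (hθ : θ ∈ Θ) :
    Measurable fun z : T × S × S => jointDensity p q θ z.1 z.2.1 z.2.2 :=
  ((hpq.q_measurable θ hθ).comp (by fun_prop : Measurable fun z : T × S × S => (z.1, z.2.1))).mul
    ((hpq.p_measurable θ hθ).comp (by fun_prop : Measurable fun z : T × S × S => (z.2.1, z.2.2)))

theorem IsDensityFamily.lintegral_jointDensity [SFinite μ] [SigmaFinite ν]
    (hpq : IsDensityFamily Θ μ ν p q)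
    {θ : EuclideanSpace ℝ (Fin d)} (hθ : θ ∈ Θ) (x : S) :
    ∫⁻ y, ∫⁻ x', ENNReal.ofReal (jointDensity p q θ y x' x) ∂μ ∂ν = 1 := by
  have hm := (hpq.measurable_jointDensity hθ).comp
    (by fun_prop : Measurable fun z : T × S => (z.1, z.2, x))
  rw [lintegral_lintegral_swap (f := fun y x' => ENNReal.ofReal (jointDensity p q θ y x' x))
    hm.ennreal_ofReal.aemeasurable]
  have h1 : ∀ x', ∫⁻ y, ENNReal.ofReal (jointDensity p q θ y x' x) ∂ν =
      ENNReal.ofReal (p θ x' x) := by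
    intro x'
    simp only [jointDensity, ENNReal.ofReal_mul (hpq.q_nonneg θ hθ _ _)]
    have hq : Measurable fun y => q θ y x' := (hpq.q_measurable θ hθ).comp
      (by fun_prop : Measurable fun y : T => (y, x'))
    rw [lintegral_mul_const _ hq.ennreal_ofReal, hpq.q_lintegral θ hθ, one_mul]
  simp only [h1, hpq.p_lintegral θ hθ]

/-- Under the mixing condition with constant `ε`, the densities for different starting states are
comparable up to the factor `ε ^ 2`. -/
theorem MixingCondition.exists_ae_mul_le [SigmaFinite μ]
    {r : EuclideanSpace ℝ (Fin d) → T → S → S → ℝ}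
    (hmix : MixingCondition Θ μ r)
    (hr : ∀ θ ∈ Θ, Measurable fun z : T × S × S => r θ z.1 z.2.1 z.2.2)
    (hr0 : ∀ θ ∈ Θ, ∀ y x' x, 0 ≤ r θ y x' x) :
    ∃ e : ℝ, 0 < e ∧ e < 1 ∧
      ∀ θ ∈ Θ, ∀ y x₁ x₂, ∀ᵐ x' ∂μ, e * r θ y x' x₁ ≤ r θ y x' x₂ := by
  obtain ⟨ε, hε, hε1, h⟩ := hmix
  refine ⟨ε ^ 2, by positivity, by nlinarith, fun θ hθ y x₁ x₂ => ?_⟩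
  obtain ⟨lam, _, hlam⟩ := h θ hθ y
  have hm : ∀ x, Measurable fun x' => ENNReal.ofReal (r θ y x' x) := fun x =>
    ((hr θ hθ).comp (by fun_prop : Measurable fun x' : S => (y, x', x))).ennreal_ofReal
  have hε0 : ENNReal.ofReal ε ≠ 0 := by simpa using hε
  have key : (fun x' => ENNReal.ofReal (ε ^ 2) * ENNReal.ofReal (r θ y x' x₁)) ≤ᵐ[μ]
      fun x' => ENNReal.ofReal (r θ y x' x₂) := by
    refine ae_le_of_forall_setLIntegral_le_of_sigmaFinite ((hm x₁).const_mul _) fun B hB _ => ?_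
    rw [lintegral_const_mul _ (hm x₁)]
    calc _ ≤ ENNReal.ofReal (ε ^ 2) * (lam B / ENNReal.ofReal ε) :=
          mul_le_mul_right ((hlam x₁ B hB).2) _
      _ = ENNReal.ofReal ε * lam B := by
          rw [pow_two, ENNReal.ofReal_mul hε.le, mul_assoc,
            ENNReal.mul_div_cancel hε0 ENNReal.ofReal_ne_top]
      _ ≤ _ := (hlam x₂ B hB).1
  filter_upwards [key] with x' hx'
  rwa [← ENNReal.ofReal_mul (by positivity), ENNReal.ofReal_le_ofReal_iff (hr0 θ hθ _ _ _)] at hx'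

variable {δ : ℝ} {rhat : EuclideanSpace ℂ (Fin d) → T → S → S → ℂ}
  {varphi : EuclideanSpace ℂ (Fin d) → T → ℂ} {phi psi : T → ℝ}

/-- At a real parameter, `|varphi|` is the pointwise bound of the density. -/
theorem IsAnalyticContinuation.isMixingKernel [IsFiniteMeasure μ] [SigmaFinite ν]
    (hcont : IsAnalyticContinuation Θ ν (jointDensity p q) δ rhat varphi phi psi)
    (hpq : IsDensityFamily Θ μ ν p q) {e γ : ℝ} (he : 0 < e) (he1 : e < 1) (hγ : 0 < γ)
    (hae : ∀ θ ∈ Θ, ∀ y x₁ x₂, ∀ᵐ x' ∂μ,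
      e * jointDensity p q θ y x' x₁ ≤ jointDensity p q θ y x' x₂)
    (hlow : ∀ θ ∈ Θ, ∀ x y, ENNReal.ofReal (γ * ‖varphi (toComplex θ) y‖) ≤
      ∫⁻ x', ENNReal.ofReal (jointDensity p q θ y x' x) ∂μ)
    {θ : EuclideanSpace ℝ (Fin d)} (hθ : θ ∈ Θ) :
    IsMixingKernel μ ν (jointDensity p q θ) e γ fun y => ‖varphi (toComplex θ) y‖ := by
  have hvic := toComplex_mem_vicinity hcont.delta_pos hθ
  have hnn : ∀ y x' x, 0 ≤ jointDensity p q θ y x' x := fun y x' x =>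
    mul_nonneg (hpq.q_nonneg θ hθ y x') (hpq.p_nonneg θ hθ x' x)
  have hm := hpq.measurable_jointDensity hθ
  have hle : ∀ y x' x, jointDensity p q θ y x' x ≤ ‖varphi (toComplex θ) y‖ := by
    intro y x' x
    have := hcont.norm_rhat_le _ hvic y x' x
    rwa [hcont.rhat_eq θ hθ, Complex.norm_real, Real.norm_eq_abs,
      abs_of_nonneg (hnn y x' x)] at this
  refine ⟨hnn, hm, hpq.lintegral_jointDensity hθ, hae θ hθ, hle, fun y x => ?_,
    fun y => norm_pos_iff.2 (hcont.varphi_ne_zero _ hvic y), he, he1, hγ⟩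
  have hint : Integrable (fun x' => jointDensity p q θ y x' x) μ :=
    Integrable.of_bound (hm.comp
      (by fun_prop : Measurable fun x' : S => (y, x', x))).aestronglyMeasurable _
      (Eventually.of_forall fun x' => by
        rw [Real.norm_eq_abs, abs_of_nonneg (hnn y x' x)]; exact hle y x' x)
  have := hlow θ hθ x y
  rwa [← ofReal_integral_eq_lintegral_ofReal hint (Eventually.of_forall fun x' => hnn y x' x),
    ENNReal.ofReal_le_ofReal_iff (integral_nonneg fun x' => hnn y x' x)] at this

end
end HMMEntropy

end

theorem theorem2 {dx dy d : ℕ}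
    (𝒳 : Set (EuclideanSpace ℝ (Fin dx))) (h𝒳 : MeasurableSet 𝒳)
    (𝒴 : Set (EuclideanSpace ℝ (Fin dy))) (h𝒴 : MeasurableSet 𝒴)
    (Θ : Set (EuclideanSpace ℝ (Fin d))) (hΘ : IsOpen Θ)
    (μ : Measure 𝒳) [IsFiniteMeasure μ] (ν : Measure 𝒴)
    (p : EuclideanSpace ℝ (Fin d) → 𝒳 → 𝒳 → ℝ)
    (q : EuclideanSpace ℝ (Fin d) → 𝒴 → 𝒳 → ℝ)
    (hpq : HMMEntropy.IsDensityFamily Θ μ ν p q)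
    (hmix : HMMEntropy.MixingCondition Θ μ (HMMEntropy.jointDensity p q))
    (δ : ℝ)
    (rhat : EuclideanSpace ℂ (Fin d) → 𝒴 → 𝒳 → 𝒳 → ℂ)
    (varphi : EuclideanSpace ℂ (Fin d) → 𝒴 → ℂ) (phi psi : 𝒴 → ℝ)
    (hcont : HMMEntropy.IsAnalyticContinuation Θ ν (HMMEntropy.jointDensity p q) δ
      rhat varphi phi psi)
    (hlow : HMMEntropy.LowerBoundCondition Θ μ (HMMEntropy.jointDensity p q) varphi)
    (hint : Integrable (fun y => psi y * phi y) ν) :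
    ∃ h : EuclideanSpace ℝ (Fin d) → ℝ,
      AnalyticOnNhd ℝ h Θ ∧
      ∀ θ ∈ Θ, ∀ (lam : Measure 𝒳) [IsProbabilityMeasure lam],
        ∀ (Ω : Type*) [MeasurableSpace Ω] (P : Measure Ω) [IsProbabilityMeasure P]
          (X : ℕ → Ω → 𝒳) (Y : ℕ → Ω → 𝒴),
          HMMEntropy.IsHMM P μ ν (p θ) (q θ) lam X Y →
          (∀ n : ℕ, 1 ≤ n → Integrable (fun ω => Real.log
            (HMMEntropy.obsDensity μ (HMMEntropy.jointDensity p q θ) lam n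
              fun k => Y (k + 1) ω)) P) ∧
          Tendsto (fun n : ℕ =>
              HMMEntropy.entropy P μ (HMMEntropy.jointDensity p q θ) lam Y n)
            atTop (𝓝 (h θ)) := by
  have hν : SigmaFinite ν :=
    HMMEntropy.sigmaFinite_of_integrable_of_pos hcont.phi_integrable hcont.phi_pos
  obtain ⟨e, he, he1, hae⟩ := hmix.exists_ae_mul_le (fun θ hθ => hpq.measurable_jointDensity hθ)
    fun θ hθ y x' x => mul_nonneg (hpq.q_nonneg θ hθ y x') (hpq.p_nonneg θ hθ x' x)
  obtain ⟨γ, hγ, -, hlow⟩ := hlow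
  have hker := fun θ hθ => hcont.isMixingKernel hpq he he1 hγ hae hlow (θ := θ) hθ
  have hK : 0 < μ.real Set.univ + 1 := by positivity
  have h1 := abs_nonneg (Real.log γ)
  have h2 := abs_nonneg (Real.log (γ / 4))
  have h3 := abs_nonneg (Real.log (μ.real Set.univ + 1))
  have hb : HMMEntropy.IsLogBound μ ν γ (μ.real Set.univ + 1)
      (|Real.log γ| + |Real.log (γ / 4)| + |Real.log (μ.real Set.univ + 1)|) phi psi :=
    ⟨hK, by linarith, by linarith, by linarith, hcont.phi_pos, hcont.psi_pos,
      hcont.phi_integrable, hint⟩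
  rcases isEmpty_or_nonempty 𝒳 with hemp | ⟨⟨x₀⟩⟩
  -- an empty state space carries no initial distribution
  · refine ⟨fun _ => 0, analyticOnNhd_const, fun θ _ lam hlam => ?_⟩
    exact absurd lam.nonempty_of_neZero (not_nonempty_iff.2 hemp)
  · obtain ⟨L, hLan, hL⟩ := HMMEntropy.exists_analytic_limit hΘ hcont hker hb (by linarith) x₀
    refine ⟨fun θ => -L θ, hLan.neg, fun θ hθ lam _ Ω _ P _ X Y hX => ?_⟩
    have hvic := HMMEntropy.toComplex_mem_vicinity hcont.delta_pos hθ
    have := hX.tendsto_entropy (hker θ hθ) hb (hcont.norm_varphi_le _ hvic)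
      (hcont.abs_log_varphi_le _ hvic) (hpq.q_lintegral θ hθ) (hL θ hθ)
    exact ⟨fun n _ => this.1 n, this.2⟩
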